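/- Let $\hbar>0$. A pure state $|\psi\rangle=\sum_j\alpha_j|E_j\rangle$ ($\sum_j|\alpha_j|^2=1$) of a quantum system on a Hilbert space of any dimension, with time-independent Hamiltonian $H=\sum_jE_j|E_j\rangle\langle E_j|$, has absolute moments $\langle|E|^{r}\rangle=\sum_j|\alpha_j|^2|E_j|^r$, and after time $\tau\ge0$ it has root fidelity $\sqrt F(\tau)=|\langle\psi|e^{-iH\tau/\hbar}|\psi\rangle|$ with itself. Let $|\varphi_e\rangle=[\sqrt7|0\rangle+\sqrt2(|-\hbar\rangle+|\hbar\rangle+|-11\hbar/5\rangle+|11\hbar/5\rangle)]/\sqrt{15}$, where the kets are orthonormal energy eigenvectors labelled by their energies. Decimal values are rounded to the digits shown. (1) Let $\tau_{c1}\approx 9.693$ be the first time at which the root fidelity of $|\varphi_e\rangle$ is $0$. Its root fidelity has a local minimum at a time $\tau_{c2}\approx4.110$, of value $\sqrt{F_{c2}}\approx0.0682$, and $\tau_{c2}$ is the first time at which this value is reached. (2) There is exactly one real polynomial $p_e$ of degree at most $34$ whose derivatives of orders $0,\dots,m-1$ agree with those of $\cos$ at $x$, for $(x,m)=(0,3)$,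 $(\pm\tau_{c1},4)$, $(\pm\tau_{c2},2)$, $(\pm\frac{11}5\tau_{c1},6)$, $(\pm\frac{11}5\tau_{c2},4)$. It is even of degree $34$, $p_e(x)=\sum_{k=0}^{17}c_{2k}x^{2k}$, and $p_e(x)\le\cos x$ for all real $x$. Its coefficients are $c_0=1$, $c_2=-\frac12$ and, to five significant digits, $c_4=4.1667\cdot10^{-2}$, $c_6=-1.3889\cdot10^{-3}$, $c_8=2.4802\cdot10^{-5}$, $c_{10}=-2.7557\cdot10^{-7}$, $c_{12}=2.0876\cdot10^{-9}$, $c_{14}=-1.1469\cdot10^{-11}$, $c_{16}=4.7766\cdot10^{-14}$, $c_{18}=-1.5585\cdot10^{-16}$, $c_{20}=4.0801\cdot10^{-19}$, $c_{22}=-8.6968\cdot10^{-22}$, $c_{24}=1.5131\cdot10^{-24}$, $c_{26}=-2.1174\cdot10^{-27}$, $c_{28}=2.2953\cdot10^{-30}$, $c_{30}=-1.7982\cdot10^{-33}$, $c_{32}=8.9715\cdot10^{-37}$, $c_{34}=-2.1195\cdot10^{-40}$. (3) (QSL) Every state with finite $\langle|E|^{2k}\rangle$, $k=1,\dots,17$,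 satisfies, for all $\tau\ge0$, $$\sqrt F(\tau)\ \ge\ 1+\sum_{k=1}^{17}c_{2k}\,\langle|E|^{2k}\rangle\Big(\frac\tau\hbar\Big)^{2k}.$$ (4) Now fix $\langle|E|^{2k}\rangle=4\hbar^{2k}[1+(11/5)^{2k}]/15$ for $k=1,\dots,17$; the state $|\varphi_e\rangle$ has these moments. Call $\tau\ge0$ permissible at root fidelity $f$ if the right-hand side of (3) is at most $f$. The permissible set increases with $f$. At $f=0$ it is $[\tau_{c1},a]\cup[b,\infty)$ with $a\approx10.139$, $b\approx10.247$. At $f=\sqrt{F_{c2}}$ it is $\{\tau_{c2}\}\cup[c,\infty)$ with $c\approx9.519$. The bound (3) is an equality for $|\varphi_e\rangle$ at $\tau_{c1}$ and at $\tau_{c2}$. Hence, over all states with these moments, the least time at which root fidelity $0$ is attained is $\tau_{c1}$, and the least time at which root fidelity $\sqrt{F_{c2}}$ is attained is $\tau_{c2}$. The forbidden interval $(\tau_{c2},c)$ is genuine: for every such state, $\sqrt F(\tau)>\sqrt{F_{c2}}$ for all $\tau\in[0,c)\setminus\{\tau_{c2}\}$, while $|\varphi_e\rangle$ attains root fidelity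 $\sqrt{F_{c2}}$ at $\tau_{c2}$ and again at some time $\ge c$. (5) (First-order transition) Let $\tau_{\min}^{\rm QSL}(f)$ be the least permissible time at root fidelity $f$, and $\tau_{\min}(f)$ the infimum of the times at which some state with these moments attains root fidelity $f$. For every $f\in[0,1]$ some such state attains $f$, and $\tau_{\min}^{\rm QSL}(f)\le\tau_{\min}(f)\le\tau_{c1}$, with equalities at $f=0$. For $0\le f<\sqrt{F_{c2}}$ one has $\tau_{\min}^{\rm QSL}(f)>c$, for $\sqrt{F_{c2}}\le f\le1$ one has $\tau_{\min}(f)\le\tau_{c2}$, and both equal $\tau_{c2}$ at $f=\sqrt{F_{c2}}$. As $f\uparrow\sqrt{F_{c2}}$, $\tau_{\min}^{\rm QSL}(f)\to c$; as $f\downarrow\sqrt{F_{c2}}$, both tend to $\tau_{c2}$. So both are discontinuous at $\sqrt{F_{c2}}$. -/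

import Mathlib

open Filter Topology Set

universe u

/-- A pure state of a quantum system with a time-independent Hamiltonian
`H = ∑ j, E j |b j⟩⟨b j|` in diagonal form: a Hilbert space of arbitrary dimension, a Hilbert basis
`b` of energy eigenvectors, the (possibly unbounded, possibly degenerate) energy eigenvalues `E`,
and a normalized initial state `ψ`. -/
structure QuantumSystem where
  Space : Type u
  [instNormed : NormedAddCommGroup Space]
  [instInner : InnerProductSpace ℂ Space]
  [instComplete : CompleteSpace Space]
  Index : Type u
  basis : HilbertBasis Index ℂ Space
  energy : Index → ℝ
  ψ : Space
  norm_ψ : ‖ψ‖ = 1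

namespace QuantumSystem

attribute [instance] instNormed instInner instComplete

/-- The amplitude `α j = ⟨b j, ψ⟩` of the initial state. -/
noncomputable def amplitude (S : QuantumSystem) (j : S.Index) : ℂ := S.basis.repr S.ψ j

theorem memℓp_evolved (S : QuantumSystem) (ħ τ : ℝ) :
    Memℓp (fun j => Complex.exp (((-(S.energy j * τ / ħ) : ℝ) : ℂ) * Complex.I) * S.amplitude j)
      2 := by
  have h : Memℓp (fun j => S.basis.repr S.ψ j) 2 := lp.memℓp (S.basis.repr S.ψ)
  refine (memℓp_gen_iff (by norm_num)).2 ?_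
  refine ((memℓp_gen_iff (by norm_num)).1 h).congr fun j => ?_
  rw [norm_mul, Complex.norm_exp_ofReal_mul_I, one_mul, amplitude]

/-- The evolved state `e^{-iHτ/ħ} ψ = ∑ j, e^{-i E_j τ/ħ} α_j b_j`. -/
noncomputable def evolve (S : QuantumSystem) (ħ τ : ℝ) : S.Space :=
  S.basis.repr.symm ⟨_, S.memℓp_evolved ħ τ⟩

/-- The fidelity between the initial state and the state at time `τ`. -/
noncomputable def fidelity (S : QuantumSystem) (ħ τ : ℝ) : ℝ :=
  ‖inner ℂ S.ψ (S.evolve ħ τ)‖ ^ 2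

noncomputable def rootFidelity (S : QuantumSystem) (ħ τ : ℝ) : ℝ :=
  √(S.fidelity ħ τ)

/-- The absolute moment `⟨|E|^r⟩ = ∑ j, |α_j|² |E_j|^r` is finite. -/
def FiniteAbsMoment (S : QuantumSystem) (r : ℕ) : Prop :=
  Summable fun j => ‖S.amplitude j‖ ^ 2 * |S.energy j| ^ r

/-- The absolute moment `⟨|E|^r⟩ = ∑ j, |α_j|² |E_j|^r`. -/
noncomputable def absMoment (S : QuantumSystem) (r : ℕ) : ℝ :=
  ∑' j, ‖S.amplitude j‖ ^ 2 * |S.energy j| ^ r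

end QuantumSystem

/-- The prescribed value `4 ħ^{2k} [1 + (11/5)^{2k}] / 15` of `⟨|E|^{2k}⟩`, for `k ≥ 1`. -/
noncomputable def exampleMoment (ħ : ℝ) (k : ℕ) : ℝ :=
  4 * ħ ^ (2 * k) * (1 + (11 / 5) ^ (2 * k)) / 15

/-- The absolute moments of order `2, 4, …, 34` are finite and have the prescribed values. -/
def QuantumSystem.HasExampleMoments (S : QuantumSystem) (ħ : ℝ) : Prop :=
  ∀ k ∈ Finset.Icc 1 17, S.FiniteAbsMoment (2 * k) ∧ S.absMoment (2 * k) = exampleMoment ħ k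

theorem norm_exampleState :
    ‖(!₂[((√7 / √15 : ℝ) : ℂ), ((√2 / √15 : ℝ) : ℂ), ((√2 / √15 : ℝ) : ℂ), ((√2 / √15 : ℝ) : ℂ),
      ((√2 / √15 : ℝ) : ℂ)] : EuclideanSpace ℂ (Fin 5))‖ = 1 := by
  rw [EuclideanSpace.norm_eq, Real.sqrt_eq_one]
  simp [Fin.sum_univ_succ, div_pow]
  norm_num

/-- The state `[√7 |0⟩ + √2 (|-ħ⟩ + |ħ⟩ + |-11ħ/5⟩ + |11ħ/5⟩)] / √15`, in which the kets are energy
eigenvectors labelled by their energies. -/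
noncomputable def exampleSystem (ħ : ℝ) : QuantumSystem.{0} where
  Space := EuclideanSpace ℂ (Fin 5)
  Index := Fin 5
  basis := (EuclideanSpace.basisFun (Fin 5) ℂ).toHilbertBasis
  energy := ![0, -ħ, ħ, -(11 * ħ / 5), 11 * ħ / 5]
  ψ := !₂[((√7 / √15 : ℝ) : ℂ), ((√2 / √15 : ℝ) : ℂ), ((√2 / √15 : ℝ) : ℂ), ((√2 / √15 : ℝ) : ℂ),
      ((√2 / √15 : ℝ) : ℂ)]
  norm_ψ := norm_exampleState

/-- The derivatives of `p` and of `cos` of orders `0, …, m - 1` agree at `x`. -/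
def AgreesWithCos (p : Polynomial ℝ) (x : ℝ) (m : ℕ) : Prop :=
  ∀ j < m, (Polynomial.derivative^[j] p).eval x = iteratedDeriv j Real.cos x

/-- The `35` Hermite interpolation conditions, on polynomials of degree at most `34`. -/
def IsExampleInterpolant (τ₁ τ₂ : ℝ) (p : Polynomial ℝ) : Prop :=
  p.natDegree ≤ 34 ∧
  AgreesWithCos p 0 3 ∧
  AgreesWithCos p τ₁ 4 ∧ AgreesWithCos p (-τ₁) 4 ∧
  AgreesWithCos p τ₂ 2 ∧ AgreesWithCos p (-τ₂) 2 ∧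
  AgreesWithCos p (11 * τ₁ / 5) 6 ∧ AgreesWithCos p (-(11 * τ₁ / 5)) 6 ∧
  AgreesWithCos p (11 * τ₂ / 5) 4 ∧ AgreesWithCos p (-(11 * τ₂ / 5)) 4

/-- The values of the coefficients of orders `0, 2, …, 34`, to five significant digits. -/
def HasExampleCoeffs (p : Polynomial ℝ) : Prop :=
  p.coeff 0 = 1 ∧
  p.coeff 2 = -(1 / 2) ∧
  |p.coeff 4 - 4.1667 * 10 ^ (-2 : ℤ)| ≤ 0.00005 * 10 ^ (-2 : ℤ) ∧
  |p.coeff 6 + 1.3889 * 10 ^ (-3 : ℤ)| ≤ 0.00005 * 10 ^ (-3 : ℤ) ∧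
  |p.coeff 8 - 2.4802 * 10 ^ (-5 : ℤ)| ≤ 0.00005 * 10 ^ (-5 : ℤ) ∧
  |p.coeff 10 + 2.7557 * 10 ^ (-7 : ℤ)| ≤ 0.00005 * 10 ^ (-7 : ℤ) ∧
  |p.coeff 12 - 2.0876 * 10 ^ (-9 : ℤ)| ≤ 0.00005 * 10 ^ (-9 : ℤ) ∧
  |p.coeff 14 + 1.1469 * 10 ^ (-11 : ℤ)| ≤ 0.00005 * 10 ^ (-11 : ℤ) ∧
  |p.coeff 16 - 4.7766 * 10 ^ (-14 : ℤ)| ≤ 0.00005 * 10 ^ (-14 : ℤ) ∧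
  |p.coeff 18 + 1.5585 * 10 ^ (-16 : ℤ)| ≤ 0.00005 * 10 ^ (-16 : ℤ) ∧
  |p.coeff 20 - 4.0801 * 10 ^ (-19 : ℤ)| ≤ 0.00005 * 10 ^ (-19 : ℤ) ∧
  |p.coeff 22 + 8.6968 * 10 ^ (-22 : ℤ)| ≤ 0.00005 * 10 ^ (-22 : ℤ) ∧
  |p.coeff 24 - 1.5131 * 10 ^ (-24 : ℤ)| ≤ 0.00005 * 10 ^ (-24 : ℤ) ∧
  |p.coeff 26 + 2.1174 * 10 ^ (-27 : ℤ)| ≤ 0.00005 * 10 ^ (-27 : ℤ) ∧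
  |p.coeff 28 - 2.2953 * 10 ^ (-30 : ℤ)| ≤ 0.00005 * 10 ^ (-30 : ℤ) ∧
  |p.coeff 30 + 1.7982 * 10 ^ (-33 : ℤ)| ≤ 0.00005 * 10 ^ (-33 : ℤ) ∧
  |p.coeff 32 - 8.9715 * 10 ^ (-37 : ℤ)| ≤ 0.00005 * 10 ^ (-37 : ℤ) ∧
  |p.coeff 34 + 2.1195 * 10 ^ (-40 : ℤ)| ≤ 0.00005 * 10 ^ (-40 : ℤ)

/-- The lower bound `c_0 + ∑_{k=1}^{17} c_{2k} m_k (τ/ħ)^{2k}` on the root fidelity that the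
polynomial `p = ∑ c_i x^i` gives, where `m k` stands for `⟨|E|^{2k}⟩`. -/
noncomputable def qslBound (p : Polynomial ℝ) (ħ : ℝ) (m : ℕ → ℝ) (τ : ℝ) : ℝ :=
  p.coeff 0 + ∑ k ∈ Finset.Icc 1 17, p.coeff (2 * k) * m k * (τ / ħ) ^ (2 * k)

/-- The times that the bound permits at root fidelity `f`, for the prescribed moments. -/
def permissibleTimes (p : Polynomial ℝ) (ħ f : ℝ) : Set ℝ :=
  {τ | 0 ≤ τ ∧ qslBound p ħ (exampleMoment ħ) τ ≤ f}

/-- The minimum time that the bound permits at root fidelity `f`. -/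
noncomputable def qslMinTime (p : Polynomial ℝ) (ħ f : ℝ) : ℝ :=
  sInf (permissibleTimes p ħ f)

/-- The times at which some quantum state with the prescribed moments has root fidelity `f` with
its initial state. -/
def evolutionTimes (ħ f : ℝ) : Set ℝ :=
  {τ | 0 ≤ τ ∧ ∃ S : QuantumSystem.{0}, S.HasExampleMoments ħ ∧ S.rootFidelity ħ τ = f}

/-- The minimum evolution time to root fidelity `f` over the states with the prescribed moments. -/
noncomputable def minEvolutionTime (ħ f : ℝ) : ℝ :=
  sInf (evolutionTimes ħ f)

/-! Write `cos x = Φ(-x²)` with the entire function `Φ(z) = ∑ z ^ m / (2m)!`; `coshSqrt k` is the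
`k`-th derivative of `Φ`. In the variable `z = -x²` the conditions on `p` become Hermite
interpolation of `Φ` at `0`, `-v₂`, `-(121/25)v₂`, `-v₁`, `-(121/25)v₁` with multiplicities 2, 2, 4,
4, 6, where `v₁ = τ₁²` and `v₂ = τ₂²`: 18 conditions for a polynomial `P` of degree at most 17. All
multiplicities are even, so the nodal polynomial is nonnegative, and the error formula `Φ - P =
Φ⁽¹⁸⁾(ξ)/18! · ∏ (z - zᵢ)` gives `p ≤ cos` wherever `Φ⁽¹⁸⁾ > 0`, in particular for `x² ≤ 507`
(`examplePoly_le_cos_of_sq_le`). For larger `x²` one has `p ≤ -1` (`examplePoly_le_neg_one`).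

The speed limit follows by averaging `p ≤ cos` over the energy distribution: the root fidelity is at
least the real part of the overlap, which is the mean of `cos(Eτ/ħ)`
(`QuantumSystem.qslBound_le_rootFidelity`). For the example state the overlap is real, and the bound
`R(τ) = (7 + 4p(τ) + 4p(11τ/5))/15` lies below it. They agree at `τ₁` and `τ₂`, because these times
and their multiples by `11/5` are nodes. At `τ₂` the overlap is stationary, and the difference has a
minimum there, so `R` is stationary too (`derivative_boundPoly_eq_zero`).

What remains is the global shape of `R`, a polynomial in `τ²`. Its coefficients are enclosed
rigorously (`interpolant_coeff_mem`): reducing each monomial of the series of `Φ` modulo the nodal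
polynomial writes the coefficients of `P` as rapidly convergent series, and these are evaluated in
integer interval arithmetic from 120 decimals of `v₁` and `v₂`. Sign tests on integer polynomials
then give the shape (`boundSigns`, `BoundSigns.exists_shape`). The statements on minimum times and
on the jump are soft consequences of this shape and of tightness (`TightBound`). -/

/-! ### The entire function `Φ` with `cos x = Φ(-x²)`, and its derivatives -/

/-- The coefficients `m! / (2m)!` of the exponential generating function of `z ↦ cosh √z`. -/
noncomputable def coshSqrtCoeff (m : ℕ) : ℝ := (m.factorial : ℝ) / ((2 * m).factorial : ℝ)

theorem coshSqrtCoeff_pos (m : ℕ) : 0 < coshSqrtCoeff m := by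
  unfold coshSqrtCoeff; positivity

theorem coshSqrtCoeff_le_one (m : ℕ) : coshSqrtCoeff m ≤ 1 := by
  unfold coshSqrtCoeff
  rw [div_le_one (by positivity)]
  exact_mod_cast Nat.factorial_le (by omega)

theorem coshSqrtCoeff_succ (m : ℕ) :
    coshSqrtCoeff (m + 1) = coshSqrtCoeff m / (2 * (2 * m + 1)) := by
  unfold coshSqrtCoeff
  rw [show 2 * (m + 1) = 2 * m + 1 + 1 by ring, Nat.factorial_succ, Nat.factorial_succ (2 * m + 1),
    Nat.factorial_succ (2 * m)]
  push_cast
  have : ((2 * m).factorial : ℝ) ≠ 0 := by positivity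
  field_simp
  ring

/-- The `k`-th derivative of the entire function `z ↦ ∑ z ^ m / (2m)!`. -/
noncomputable def coshSqrt (k : ℕ) (z : ℝ) : ℝ :=
  ∑' m : ℕ, coshSqrtCoeff (m + k) * (z ^ m / m.factorial)

theorem summable_coshSqrt (k : ℕ) (z : ℝ) :
    Summable fun m : ℕ => coshSqrtCoeff (m + k) * (z ^ m / m.factorial) := by
  refine Summable.of_norm_bounded (Real.summable_pow_div_factorial |z|) fun m => ?_
  rw [norm_mul, norm_div, norm_pow, Real.norm_eq_abs, Real.norm_eq_abs, Real.norm_eq_abs,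
    abs_of_pos (coshSqrtCoeff_pos _), Nat.abs_cast]
  exact mul_le_of_le_one_left (by positivity) (coshSqrtCoeff_le_one _)

theorem hasSum_coshSqrt (k : ℕ) (z : ℝ) :
    HasSum (fun m : ℕ => coshSqrtCoeff (m + k) * (z ^ m / m.factorial)) (coshSqrt k z) :=
  (summable_coshSqrt k z).hasSum

/-- The coefficients are at most 1, so on each ball the differentiated exponential series dominates
and termwise differentiation is allowed. -/
theorem hasDerivAt_coshSqrt (k : ℕ) (z : ℝ) :
    HasDerivAt (coshSqrt k) (coshSqrt (k + 1) z) z := by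
  set R : ℝ := |z| + 1 with hRdef
  have hR : 0 < R := by positivity
  have hz : z ∈ Metric.ball (0 : ℝ) R := by simp [hRdef]
  have hu : Summable fun m : ℕ => m * R ^ (m - 1) / m.factorial := by
    rw [← summable_nat_add_iff 1]
    refine (Real.summable_pow_div_factorial R).congr fun m => ?_
    rw [Nat.factorial_succ, Nat.add_sub_cancel]
    push_cast
    field_simp
  have hbound : ∀ (m : ℕ), ∀ y ∈ Metric.ball (0 : ℝ) R,
      ‖coshSqrtCoeff (m + k) * (m * y ^ (m - 1) / m.factorial)‖ ≤
        m * R ^ (m - 1) / m.factorial := by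
    intro m y hy
    rw [mem_ball_zero_iff, Real.norm_eq_abs] at hy
    rw [norm_mul, norm_div, norm_mul, norm_pow, Real.norm_eq_abs, Real.norm_eq_abs,
      Real.norm_eq_abs, Real.norm_eq_abs, abs_of_pos (coshSqrtCoeff_pos _), Nat.abs_cast,
      Nat.abs_cast]
    refine (mul_le_of_le_one_left (by positivity) (coshSqrtCoeff_le_one _)).trans ?_
    gcongr
  have key : HasDerivAt (fun y => ∑' m : ℕ, coshSqrtCoeff (m + k) * (y ^ m / m.factorial))
      (∑' m : ℕ, coshSqrtCoeff (m + k) * (m * z ^ (m - 1) / m.factorial)) z :=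
    hasDerivAt_tsum_of_isPreconnected
      (g := fun (m : ℕ) (y : ℝ) => coshSqrtCoeff (m + k) * (y ^ m / m.factorial))
      (g' := fun (m : ℕ) (y : ℝ) => coshSqrtCoeff (m + k) * (m * y ^ (m - 1) / m.factorial))
      hu Metric.isOpen_ball (convex_ball 0 R).isPreconnected
      (fun m y _ => ((hasDerivAt_pow m y).div_const _).const_mul _) hbound hz
      (summable_coshSqrt k z) hz
  have hs : Summable fun m : ℕ => coshSqrtCoeff (m + k) * (m * z ^ (m - 1) / m.factorial) :=
    Summable.of_norm_bounded hu fun m => hbound m z hz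
  have heq : ∑' m : ℕ, coshSqrtCoeff (m + k) * (m * z ^ (m - 1) / m.factorial) =
      coshSqrt (k + 1) z := by
    rw [hs.tsum_eq_zero_add, coshSqrt]
    simp only [Nat.cast_zero, zero_mul, zero_div, mul_zero, zero_add]
    refine tsum_congr fun m => ?_
    rw [Nat.factorial_succ, Nat.add_sub_cancel, show m + 1 + k = m + (k + 1) by ring]
    push_cast
    field_simp
  rw [← heq]
  exact key

theorem cos_eq_coshSqrt (x : ℝ) : Real.cos x = coshSqrt 0 (-x ^ 2) := by
  refine (Real.hasSum_cos x).unique ((hasSum_coshSqrt 0 (-x ^ 2)).congr_fun fun m => ?_)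
  rw [add_zero, coshSqrtCoeff, neg_pow (x ^ 2), ← pow_mul]
  field_simp

/-- In this form the `k`-th derivative at `z` acts on the power series one monomial at a time, so
that monomials can later be replaced by their remainders. -/
theorem hasSum_iterate_derivative_X_pow (k : ℕ) (z : ℝ) :
    HasSum (fun m : ℕ => (1 / ((2 * m).factorial : ℝ)) *
      (Polynomial.derivative^[k] (Polynomial.X ^ m : Polynomial ℝ)).eval z) (coshSqrt k z) := by
  have h0 : ∑ m ∈ Finset.range k, (1 / ((2 * m).factorial : ℝ)) *
      (Polynomial.derivative^[k] (Polynomial.X ^ m : Polynomial ℝ)).eval z = 0 := by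
    refine Finset.sum_eq_zero fun m hm => ?_
    rw [Polynomial.iterate_derivative_X_pow_eq_smul,
      Nat.descFactorial_of_lt (Finset.mem_range.1 hm)]
    simp
  rw [← hasSum_nat_add_iff' k, h0, sub_zero]
  refine (hasSum_coshSqrt k z).congr_fun fun m => ?_
  have hf : (((m + k).descFactorial k : ℕ) : ℝ) = (m + k).factorial / m.factorial := by
    rw [eq_div_iff (by positivity)]
    have := Nat.factorial_mul_descFactorial (Nat.le_add_left k m)
    rw [Nat.add_sub_cancel] at this
    exact_mod_cast (mul_comm _ _).trans this
  rw [Polynomial.iterate_derivative_X_pow_eq_smul, hf, Polynomial.eval_smul, Polynomial.eval_pow,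
    Polynomial.eval_X, Nat.add_sub_cancel, coshSqrtCoeff, smul_eq_mul]
  field_simp

/-- The ratio of consecutive terms is `u / (2(2(m + k) + 1)(m + 1))`, which for `m ≥ 12` is at most
`510 / 650`. -/
theorem coshSqrt_term_antitone {u : ℝ} (h0 : 0 ≤ u) (h1 : u ≤ 510) (k : ℕ) {m : ℕ} (hm : 12 ≤ m) :
    coshSqrtCoeff (m + 1 + k) * (u ^ (m + 1) / (m + 1).factorial) ≤
      coshSqrtCoeff (m + k) * (u ^ m / m.factorial) := by
  rw [show m + 1 + k = m + k + 1 by ring, coshSqrtCoeff_succ, Nat.factorial_succ, pow_succ]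
  push_cast
  have hc := coshSqrtCoeff_pos (m + k)
  have hm' : (12 : ℝ) ≤ m := by exact_mod_cast hm
  have hk : (0 : ℝ) ≤ k := by positivity
  have h2 : u / (2 * (2 * (m + k) + 1) * (m + 1)) ≤ 1 := by
    rw [div_le_one (by positivity)]
    nlinarith [mul_nonneg hk (by positivity : (0 : ℝ) ≤ m)]
  calc coshSqrtCoeff (m + k) / (2 * (2 * (m + k) + 1)) * (u ^ m * u / ((m + 1) * m.factorial))
      = coshSqrtCoeff (m + k) * (u ^ m / m.factorial) *
          (u / (2 * (2 * (m + k) + 1) * (m + 1))) := by field_simp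
    _ ≤ _ := mul_le_of_le_one_right (by positivity) h2

/-- The first `n` terms of the alternating series of `coshSqrt k (-u)`. -/
noncomputable def coshSqrtPartial (k n : ℕ) (u : ℝ) : ℝ :=
  ∑ m ∈ Finset.range n, (-1) ^ m * (coshSqrtCoeff (m + k) * (u ^ m / m.factorial))

/-- Leibniz's criterion, applied after the first 12 terms. As 12 is even, the sign pattern of the
tail is that of the whole series. -/
theorem coshSqrtPartial_bounds {u : ℝ} (h0 : 0 ≤ u) (h1 : u ≤ 510) (k n : ℕ) :
    coshSqrtPartial k (12 + 2 * n) u ≤ coshSqrt k (-u) ∧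
      coshSqrt k (-u) ≤ coshSqrtPartial k (12 + (2 * n + 1)) u := by
  set a : ℕ → ℝ := fun m => coshSqrtCoeff (m + k) * (u ^ m / m.factorial) with ha
  have hs : HasSum (fun m => (-1) ^ m * a m) (coshSqrt k (-u)) := by
    refine (hasSum_coshSqrt k (-u)).congr_fun fun m => ?_
    rw [ha, neg_pow]
    ring
  have hsum : ∀ n, coshSqrtPartial k (12 + n) u =
      ∑ m ∈ Finset.range 12, (-1) ^ m * a m + ∑ m ∈ Finset.range n, (-1) ^ m * a (m + 12) := by
    intro n
    rw [coshSqrtPartial, Finset.sum_range_add]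
    congr 1
    refine Finset.sum_congr rfl fun m _ => ?_
    rw [pow_add, add_comm 12 m]; norm_num [ha]
  have ht : Tendsto (fun n => ∑ m ∈ Finset.range n, (-1) ^ m * a (m + 12)) atTop
      (𝓝 (coshSqrt k (-u) - ∑ m ∈ Finset.range 12, (-1) ^ m * a m)) := by
    have := ((hasSum_nat_add_iff' 12).2 hs).tendsto_sum_nat
    refine this.congr fun n => Finset.sum_congr rfl fun m _ => ?_
    rw [pow_add]; norm_num
  have hanti : Antitone fun m => a (m + 12) :=
    antitone_nat_of_succ_le fun m => by
      have := coshSqrt_term_antitone h0 h1 k (m := m + 12) (by omega)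
      simpa [ha, add_right_comm] using this
  have l1 := hanti.alternating_series_le_tendsto ht n
  have l2 := hanti.tendsto_le_alternating_series ht n
  rw [hsum, hsum]
  constructor <;> linarith

/-! ### Rolle's theorem with multiplicities -/

/-- Rolle's theorem with multiplicities, for a monotone enumeration `l 0 ≤ … ≤ l n` of zeros. -/
theorem exists_eq_zero_of_monotone_zeros (n : ℕ) :
    ∀ (F : ℕ → ℝ → ℝ) (_ : ∀ k x, HasDerivAt (F k) (F (k + 1) x) x) (l : ℕ → ℝ)
      (_ : ∀ i < n, l i ≤ l (i + 1))
      (_ : ∀ i ≤ n, ∀ j ≤ i, l (i - j) = l i → F j (l i) = 0),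
      ∃ ξ ∈ Icc (l 0) (l n), F n ξ = 0 := by
  induction n with
  | zero =>
    intro F _ l _ hz
    exact ⟨l 0, ⟨le_rfl, le_rfl⟩, hz 0 le_rfl 0 le_rfl rfl⟩
  | succ n ih =>
    intro F hF l hl hz
    have hmono : ∀ i j, i ≤ j → j ≤ n + 1 → l i ≤ l j := by
      intro i j hij
      induction j, hij using Nat.le_induction with
      | base => intro _; exact le_rfl
      | succ j _ ih' => intro hj; exact (ih' (by omega)).trans (hl j (by omega))
    -- One zero of `F 1` for each pair of neighbours: a Rolle point strictly inside a proper gap, or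
    -- the common point of a repeated zero. Strictness ensures that zeros coincide afterwards only
    -- where they coincided before.
    have hex : ∀ i, ∃ ξ, i ≤ n → l i ≤ ξ ∧ ξ ≤ l (i + 1) ∧ F 1 ξ = 0 ∧
        (l i < l (i + 1) → l i < ξ ∧ ξ < l (i + 1)) := by
      intro i
      by_cases hi : i ≤ n
      · rcases (hl i (by omega)).lt_or_eq with h | h
        · obtain ⟨ξ, hξ, h0⟩ := exists_hasDerivAt_eq_zero (f := F 0) (f' := F 1) h
            (fun x _ => (hF 0 x).continuousAt.continuousWithinAt)
            ((hz i (by omega) 0 (by omega) rfl).trans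
              (hz (i + 1) (by omega) 0 (by omega) rfl).symm) (fun x _ => hF 0 x)
          exact ⟨ξ, fun _ => ⟨hξ.1.le, hξ.2.le, h0, fun _ => hξ⟩⟩
        · refine ⟨l i, fun _ => ⟨le_rfl, h.le, ?_, fun h' => absurd h h'.ne⟩⟩
          rw [h]
          exact hz (i + 1) (by omega) 1 (by omega) (by simpa using h)
      · exact ⟨0, fun h => absurd h hi⟩
    choose l' hl' using hex
    obtain ⟨ξ, hξ, h0⟩ := ih (fun k => F (k + 1)) (fun k x => hF (k + 1) x) l'
      (fun i hi => ((hl' i (by omega)).2.1).trans (hl' (i + 1) (by omega)).1) (by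
        intro i hi j hj hij
        rcases Nat.eq_zero_or_pos j with rfl | hj0
        · exact (hl' i hi).2.2.1
        · have a1 := hl' (i - j) (by omega)
          have a2 := hl' i hi
          have b1 : l' (i - j) ≤ l (i - j + 1) := a1.2.1
          have b2 : l (i - j + 1) ≤ l i := hmono _ _ (by omega) (by omega)
          have b3 : l i ≤ l' i := a2.1
          -- `l' (i - j) ≤ l (i - j + 1) ≤ l i ≤ l' i` has equal ends. A proper gap at either end
          -- would put the Rolle point strictly inside it, so `l` is constant from `i - j` to `i +
          -- 1`, one repetition more than for `l'`.
          have e1 : l i = l' i := le_antisymm b3 (hij ▸ b1.trans b2)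
          have e2 : l' (i - j) = l (i - j + 1) := le_antisymm b1 (by rw [hij]; exact b2.trans b3)
          have e3 : l i = l (i + 1) := by
            by_contra hne
            exact absurd e1 (a2.2.2.2 ((hl i (by omega)).lt_of_ne hne)).1.ne
          have e4 : l (i - j) = l (i - j + 1) := by
            by_contra hne
            exact absurd e2 (a1.2.2.2 ((hl _ (by omega)).lt_of_ne hne)).2.ne
          have := hz (i + 1) (by omega) (j + 1) (by omega) (by
            rw [Nat.add_sub_add_right, e4, ← e2, hij, ← e1, e3])
          rwa [← e3, e1] at this)
    refine ⟨ξ, ⟨(hl' 0 (by omega)).1.trans hξ.1, hξ.2.trans (hl' n le_rfl).2.1⟩, h0⟩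

/-- Rolle's theorem with multiplicities. -/
theorem exists_eq_zero_of_count_zeros (F : ℕ → ℝ → ℝ)
    (hF : ∀ k x, HasDerivAt (F k) (F (k + 1) x) x) (n : ℕ) (s : Multiset ℝ)
    (hs : s.card = n + 1) (hz : ∀ a, ∀ j < s.count a, F j a = 0) {A B : ℝ}
    (hAB : ∀ a ∈ s, a ∈ Icc A B) : ∃ ξ ∈ Icc A B, F n ξ = 0 := by
  set L : List ℝ := s.sort (· ≤ ·) with hL
  have hlen : L.length = n + 1 := by rw [hL, Multiset.length_sort, hs]
  have hsorted : L.SortedLE := by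
    rw [hL]; exact (Multiset.pairwise_sort s (· ≤ ·)).sortedLE
  have hmem : ∀ a ∈ L, a ∈ Icc A B := fun a ha => hAB a ((Multiset.mem_sort (· ≤ ·)).1 ha)
  have hcount : ∀ a, L.count a = s.count a := fun a => by
    rw [← Multiset.coe_count, hL, Multiset.sort_eq]
  have hle : ∀ i j (hij : i ≤ j) (hj : j < L.length), L[i] ≤ L[j] := fun i j hij hj =>
    hsorted.getElem_le_getElem_of_le hij
  obtain ⟨ξ, hξ, h0⟩ := exists_eq_zero_of_monotone_zeros n F hF (fun i => L.getD i 0)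
    (fun i hi => by
      rw [List.getD_eq_getElem _ _ (by omega), List.getD_eq_getElem _ _ (by omega)]
      exact hle _ _ (by omega) (by omega))
    (fun i hi j hj hij => by
      rw [List.getD_eq_getElem _ _ (by omega), List.getD_eq_getElem _ _ (by omega)] at hij
      rw [List.getD_eq_getElem _ _ (by omega)]
      refine hz _ _ ?_
      -- In a sorted list equal entries at positions `i - j` and `i` force a constant block of
      -- length `j + 1`, so the multiplicity is at least `j + 1`.
      have hsub : (L.drop (i - j)).take (j + 1) = List.replicate (j + 1) L[i] := by
        refine List.eq_replicate_iff.2 ⟨by simp; omega, fun b hb => ?_⟩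
        obtain ⟨k, hk, rfl⟩ := List.getElem_of_mem hb
        rw [List.length_take, List.length_drop] at hk
        rw [List.getElem_take, List.getElem_drop]
        refine le_antisymm (hle _ _ (by omega) (by omega)) ?_
        rw [← hij]
        exact hle _ _ (by omega) (by omega)
      have hc := ((List.take_sublist (j + 1) _).trans (List.drop_sublist (i - j) L)).count_le L[i]
      rw [hsub, List.count_replicate_self, hcount] at hc
      exact hc)
  rw [List.getD_eq_getElem _ _ (by omega), List.getD_eq_getElem _ _ (by omega)] at hξ
  exact ⟨ξ, ⟨(hmem _ (List.getElem_mem _)).1.trans hξ.1,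
    hξ.2.trans (hmem _ (List.getElem_mem _)).2⟩, h0⟩

/-! ### Remainders modulo the nodal polynomial, and the interpolant as a convergent series -/

open Polynomial in
/-- Up to sign, the coefficients of the remainder of `X ^ (n + 15)` modulo a monic polynomial
`X ^ 16 + ∑ i < 16, E i X ^ i`. -/
def remainderCoeff (E : ℕ → ℝ) : ℕ → ℕ → ℝ
  | 0, i => if i = 15 then 1 else 0
  | n + 1, 0 => E 0 * remainderCoeff E n 15
  | n + 1, i + 1 => E (i + 1) * remainderCoeff E n 15 - remainderCoeff E n i

open Polynomial in
-- Multiply the previous remainder by `X` and eliminate `X ^ 16` with `W`. Pulling out the sign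
-- `(-1) ^ n` matters because the roots of the intended `W` are negative: up to sign the top
-- coefficient is then a complete homogeneous polynomial in nonnegative numbers.
theorem dvd_X_pow_sub_remainder (W : ℝ[X])
    (hW : W = X ^ 16 + ∑ i ∈ Finset.range 16, C (W.coeff i) * X ^ i) (n : ℕ) :
    W ∣ X ^ (n + 15) -
      C ((-1) ^ n) * ∑ i ∈ Finset.range 16, C (remainderCoeff W.coeff n i) * X ^ i := by
  induction n with
  | zero =>
    simp [remainderCoeff]
  | succ n ih =>
    set T := remainderCoeff W.coeff n with hT
    have h1 : ∑ i ∈ Finset.range 16, C (remainderCoeff W.coeff (n + 1) i) * X ^ i =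
        C (T 15) * ∑ i ∈ Finset.range 16, C (W.coeff i) * X ^ i -
          X * ∑ i ∈ Finset.range 15, C (T i) * X ^ i := by
      rw [Finset.sum_range_succ', Finset.sum_range_succ' (fun i => C (W.coeff i) * X ^ i),
        Finset.mul_sum, mul_add, Finset.mul_sum]
      simp only [remainderCoeff, ← hT]
      rw [add_sub_right_comm, ← Finset.sum_sub_distrib]
      congr 1
      · refine Finset.sum_congr rfl fun i _ => ?_
        simp only [C_sub, C_mul]
        ring
      · simp only [C_mul]
        ring
    have h2 : X ^ (n + 1 + 15) - C ((-1) ^ (n + 1)) *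
        ∑ i ∈ Finset.range 16, C (remainderCoeff W.coeff (n + 1) i) * X ^ i =
        X * (X ^ (n + 15) - C ((-1) ^ n) * ∑ i ∈ Finset.range 16, C (T i) * X ^ i) +
          C ((-1) ^ n) * C (T 15) * W := by
      rw [h1]
      conv_rhs => rw [hW, Finset.sum_range_succ (fun i => C (T i) * X ^ i)]
      simp only [pow_succ (-1 : ℝ), C_mul, C_neg, C_1]
      ring
    rw [h2]
    exact dvd_add (ih.mul_left _) (dvd_mul_left _ _)

/-- The hypothesis on `ρ` says that one step of the recursion multiplies the weighted norm `∑ |Tᵢ| ρ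
^ i` by at most `ρ`. -/
theorem sum_abs_remainderCoeff_le {E : ℕ → ℝ} (hE : ∀ i, 0 ≤ E i) {ρ : ℝ} (hρ : 0 < ρ)
    (h : ∑ i ∈ Finset.range 16, E i * ρ ^ i ≤ ρ ^ 16) (n : ℕ) :
    ∑ i ∈ Finset.range 16, |remainderCoeff E n i| * ρ ^ i ≤ ρ ^ (n + 15) := by
  induction n with
  | zero => simp [remainderCoeff, Finset.sum_range_succ]
  | succ n ih =>
    set T := remainderCoeff E n with hT
    calc ∑ i ∈ Finset.range 16, |remainderCoeff E (n + 1) i| * ρ ^ i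
        ≤ |T 15| * ∑ i ∈ Finset.range 16, E i * ρ ^ i +
            ρ * ∑ i ∈ Finset.range 15, |T i| * ρ ^ i := by
          rw [Finset.sum_range_succ', Finset.sum_range_succ' (fun i => E i * ρ ^ i), mul_add,
            Finset.mul_sum, Finset.mul_sum, add_right_comm, ← Finset.sum_add_distrib]
          refine add_le_add (Finset.sum_le_sum fun i _ => ?_) ?_
          · simp only [remainderCoeff, ← hT]
            have := abs_sub (E (i + 1) * T 15) (T i)
            rw [abs_mul, abs_of_nonneg (hE (i + 1))] at this
            calc _ ≤ (E (i + 1) * |T 15| + |T i|) * ρ ^ (i + 1) := by gcongr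
              _ = _ := by ring
          · simp only [remainderCoeff, ← hT]
            rw [abs_mul, abs_of_nonneg (hE 0)]
            exact le_of_eq (by ring)
      _ ≤ |T 15| * ρ ^ 16 + ρ * ∑ i ∈ Finset.range 15, |T i| * ρ ^ i := by gcongr
      _ = ρ * ∑ i ∈ Finset.range 16, |T i| * ρ ^ i := by
          rw [Finset.sum_range_succ _ 15]; ring
      _ ≤ ρ * ρ ^ (n + 15) := by gcongr
      _ = ρ ^ (n + 1 + 15) := by ring

theorem abs_remainderCoeff_le {E : ℕ → ℝ} (hE : ∀ i, 0 ≤ E i) {ρ : ℝ} (hρ : 0 < ρ)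
    (h : ∑ i ∈ Finset.range 16, E i * ρ ^ i ≤ ρ ^ 16) (n : ℕ) {i : ℕ} (hi : i < 16) :
    |remainderCoeff E n i| ≤ ρ ^ (n + 15 - i) := by
  have h1 := sum_abs_remainderCoeff_le hE hρ h n
  have h2 : |remainderCoeff E n i| * ρ ^ i ≤ ρ ^ (n + 15) :=
    (Finset.single_le_sum (f := fun i => |remainderCoeff E n i| * ρ ^ i)
      (fun j _ => by positivity) (Finset.mem_range.2 hi)).trans h1
  rw [show n + 15 = n + 15 - i + i by omega, pow_add] at h2
  exact le_of_mul_le_mul_right h2 (by positivity)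

/-- The terms of the series of the coefficients of the interpolant. -/
noncomputable def remainderTerm (E : ℕ → ℝ) (i n : ℕ) : ℝ :=
  (-1) ^ n * remainderCoeff E n i / ((34 + 2 * n).factorial : ℝ)

/-- From index `N` on, consecutive terms have ratio at most `1/2`. This gives both convergence and
an explicit tail bound for the coefficients of the interpolant. -/
theorem pow_div_factorial_le_geometric {ρ : ℝ} (hρ : 0 < ρ) {N : ℕ}
    (hN : 2 * ρ ≤ (2 * N + 35) * (2 * N + 36)) {e : ℕ} (n : ℕ) :
    ρ ^ (n + N + e) / ((34 + 2 * (n + N)).factorial : ℝ) ≤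
      ρ ^ (N + e) / ((34 + 2 * N).factorial : ℝ) * (1 / 2) ^ n := by
  induction n with
  | zero => simp
  | succ n ih =>
    have h1 : ((34 + 2 * (n + 1 + N)).factorial : ℝ) =
        (2 * (n + N) + 36) * ((2 * (n + N) + 35) * ((34 + 2 * (n + N)).factorial : ℝ)) := by
      rw [show 34 + 2 * (n + 1 + N) = 34 + 2 * (n + N) + 1 + 1 by ring, Nat.factorial_succ,
        Nat.factorial_succ]
      push_cast
      ring
    have h2 : ρ / ((2 * (n + N) + 36) * (2 * (n + N) + 35)) ≤ (1 / 2 : ℝ) := by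
      rw [div_le_iff₀ (by positivity)]
      have hn : (0 : ℝ) ≤ n := by positivity
      have hN : (0 : ℝ) ≤ N := by positivity
      nlinarith [mul_nonneg hn hN]
    calc ρ ^ (n + 1 + N + e) / ((34 + 2 * (n + 1 + N)).factorial : ℝ)
        = ρ ^ (n + N + e) / ((34 + 2 * (n + N)).factorial : ℝ) *
            (ρ / ((2 * (n + N) + 36) * (2 * (n + N) + 35))) := by
          rw [h1, show n + 1 + N + e = n + N + e + 1 by ring, pow_succ]
          field_simp
      _ ≤ ρ ^ (N + e) / ((34 + 2 * N).factorial : ℝ) * (1 / 2) ^ n * (1 / 2) := by gcongr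
      _ = _ := by ring

theorem norm_remainderTerm_le {E : ℕ → ℝ} (hE : ∀ i, 0 ≤ E i) {ρ : ℝ} (hρ : 0 < ρ)
    (h : ∑ i ∈ Finset.range 16, E i * ρ ^ i ≤ ρ ^ 16) {N : ℕ}
    (hN : 2 * ρ ≤ (2 * N + 35) * (2 * N + 36)) {i : ℕ} (hi : i < 16) (n : ℕ) :
    ‖remainderTerm E i (n + N)‖ ≤
      ρ ^ (N + (15 - i)) / ((34 + 2 * N).factorial : ℝ) * (1 / 2) ^ n := by
  refine le_trans ?_ (pow_div_factorial_le_geometric hρ hN n)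
  rw [remainderTerm, norm_div, norm_mul, norm_pow, norm_neg, norm_one, one_pow, one_mul,
    Real.norm_eq_abs, Real.norm_eq_abs, Nat.abs_cast,
    show n + N + (15 - i) = n + N + 15 - i by omega]
  gcongr
  exact abs_remainderCoeff_le hE hρ h _ hi

theorem summable_remainderTerm {E : ℕ → ℝ} (hE : ∀ i, 0 ≤ E i) {ρ : ℝ} (hρ : 0 < ρ)
    (h : ∑ i ∈ Finset.range 16, E i * ρ ^ i ≤ ρ ^ 16) {N : ℕ}
    (hN : 2 * ρ ≤ (2 * N + 35) * (2 * N + 36)) {i : ℕ} (hi : i < 16) :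
    Summable (remainderTerm E i) := by
  rw [← summable_nat_add_iff N]
  exact Summable.of_norm_bounded (summable_geometric_two.mul_left _)
    (norm_remainderTerm_le hE hρ h hN hi)

theorem abs_tsum_remainderTerm_sub_le {E : ℕ → ℝ} (hE : ∀ i, 0 ≤ E i) {ρ : ℝ} (hρ : 0 < ρ)
    (h : ∑ i ∈ Finset.range 16, E i * ρ ^ i ≤ ρ ^ 16) {N : ℕ}
    (hN : 2 * ρ ≤ (2 * N + 35) * (2 * N + 36)) {i : ℕ} (hi : i < 16) :
    |∑' n, remainderTerm E i n - ∑ n ∈ Finset.range N, remainderTerm E i n| ≤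
      2 * ρ ^ (N + (15 - i)) / ((34 + 2 * N).factorial : ℝ) := by
  have hs := summable_remainderTerm hE hρ h hN hi
  rw [← hs.sum_add_tsum_nat_add N, add_sub_cancel_left, ← Real.norm_eq_abs]
  have := tsum_of_norm_bounded (hasSum_geometric_two.mul_left _)
    (norm_remainderTerm_le hE hρ h hN hi)
  exact this.trans (le_of_eq (by ring))

open Polynomial in
/-- The interpolant, in the variable `z = -x ^ 2`, of `∑ z ^ m / (2m)!` at the roots of
`X ^ 2 * W`. -/
noncomputable def coshSqrtInterpolant (W : ℝ[X]) : ℝ[X] :=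
  ∑ k ∈ Finset.range 17, C (1 / ((2 * k).factorial : ℝ)) * X ^ k +
    ∑ i ∈ Finset.range 16, C (∑' n, remainderTerm W.coeff i n) * X ^ (i + 2)

open Polynomial in
theorem eval_iterate_derivative_eq_zero_of_dvd {q : ℝ[X]} {z : ℝ} {r j : ℕ}
    (hr : (X - C z) ^ r ∣ q) (hj : j < r) : (derivative^[j] q).eval z = 0 := by
  obtain ⟨s, hs⟩ := pow_sub_dvd_iterate_derivative_of_pow_dvd j hr
  have h0 : r - j ≠ 0 := by omega
  rw [hs, eval_mul, eval_pow, eval_sub, eval_X, eval_C, sub_self, zero_pow h0, zero_mul]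

open Polynomial in
-- The functional "`j`-th derivative at `z`" vanishes on multiples of `(X - z) ^ r` for `j < r`,
-- hence on multiples of `X ^ 2 * W`. It therefore does not distinguish a monomial from its
-- remainder.
theorem eval_iterate_derivative_X_pow_eq_sum {W : ℝ[X]}
    (hW : W = X ^ 16 + ∑ i ∈ Finset.range 16, C (W.coeff i) * X ^ i) {z : ℝ} {r : ℕ}
    (hr : (X - C z) ^ r ∣ X ^ 2 * W) {j : ℕ} (hj : j < r) (n : ℕ) :
    (derivative^[j] (X ^ (n + 17) : ℝ[X])).eval z =
      ∑ i ∈ Finset.range 16, (-1) ^ n * remainderCoeff W.coeff n i *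
        (derivative^[j] (X ^ (i + 2) : ℝ[X])).eval z := by
  have hX : (X : ℝ[X]) ^ (n + 17) = X ^ 2 * X ^ (n + 15) := by
    rw [← pow_add]; congr 1; omega
  have hS : ∑ i ∈ Finset.range 16, C ((-1) ^ n * remainderCoeff W.coeff n i) * X ^ (i + 2) =
      X ^ 2 * (C ((-1) ^ n) * ∑ i ∈ Finset.range 16, C (remainderCoeff W.coeff n i) * X ^ i) := by
    rw [Finset.mul_sum, Finset.mul_sum]
    refine Finset.sum_congr rfl fun i _ => ?_
    rw [C_mul, pow_add]; ring
  have hd : (X - C z) ^ r ∣ X ^ (n + 17) -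
      ∑ i ∈ Finset.range 16, C ((-1) ^ n * remainderCoeff W.coeff n i) * X ^ (i + 2) := by
    rw [hX, hS, ← mul_sub]
    exact hr.trans (mul_dvd_mul_left (X ^ 2) (dvd_X_pow_sub_remainder W hW n))
  have h0 := eval_iterate_derivative_eq_zero_of_dvd hd hj
  rw [iterate_derivative_sub, eval_sub, sub_eq_zero] at h0
  rw [h0, iterate_derivative_sum, eval_finsetSum]
  refine Finset.sum_congr rfl fun i _ => ?_
  rw [iterate_derivative_C_mul, eval_mul, eval_C]

open Polynomial in
-- The monomials of degree at most 16 stay as they are; each `X ^ (n + 17)` is replaced by its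
-- remainder, which is `X ^ 17` itself for `n = 0`. Collecting equal powers gives the series that
-- define the coefficients.
theorem coshSqrt_eq_eval_interpolant {W : ℝ[X]}
    (hW : W = X ^ 16 + ∑ i ∈ Finset.range 16, C (W.coeff i) * X ^ i)
    (hs : ∀ i < 16, Summable (remainderTerm W.coeff i)) {z : ℝ} {r : ℕ}
    (hr : (X - C z) ^ r ∣ X ^ 2 * W) {j : ℕ} (hj : j < r) :
    coshSqrt j z = (derivative^[j] (coshSqrtInterpolant W)).eval z := by
  have h1 := (hasSum_nat_add_iff' 17).2 (hasSum_iterate_derivative_X_pow j z)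
  have h3 : HasSum (fun n : ℕ => (1 / ((2 * (n + 17)).factorial : ℝ)) *
      (derivative^[j] (X ^ (n + 17) : ℝ[X])).eval z)
      (∑ i ∈ Finset.range 16, (∑' n, remainderTerm W.coeff i n) *
        (derivative^[j] (X ^ (i + 2) : ℝ[X])).eval z) := by
    refine (hasSum_sum fun i hi =>
      ((hs i (Finset.mem_range.1 hi)).hasSum.mul_right _)).congr_fun fun n => ?_
    rw [eval_iterate_derivative_X_pow_eq_sum hW hr hj, Finset.mul_sum]
    refine Finset.sum_congr rfl fun i _ => ?_
    rw [remainderTerm, show 34 + 2 * n = 2 * (n + 17) by omega]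
    ring
  have h4 := h1.unique h3
  rw [sub_eq_iff_eq_add] at h4
  rw [h4, coshSqrtInterpolant, iterate_map_add, iterate_derivative_sum,
    iterate_derivative_sum, eval_add, eval_finsetSum, eval_finsetSum, add_comm]
  congr 1 <;> refine Finset.sum_congr rfl fun i _ => ?_ <;>
    rw [iterate_derivative_C_mul, eval_mul, eval_C]

/-! ### The sign of the Hermite interpolation error -/

open Polynomial in
theorem hasDerivAt_eval_iterate_derivative (P : ℝ[X]) (k : ℕ) (x : ℝ) :
    HasDerivAt (fun y => (derivative^[k] P).eval y) ((derivative^[k + 1] P).eval x) x := by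
  rw [Function.iterate_succ_apply']
  exact Polynomial.hasDerivAt _ _

open Polynomial in
theorem eval_iterate_derivative_of_monic {N : ℝ[X]} (hN : N.Monic) (x : ℝ) :
    (derivative^[N.natDegree] N).eval x = (N.natDegree.factorial : ℝ) := by
  have h : (derivative^[N.natDegree] N).natDegree ≤ 0 := by
    have := natDegree_iterate_derivative N N.natDegree
    omega
  rw [eq_C_of_natDegree_le_zero h, eval_C, coeff_iterate_derivative, zero_add,
    hN.coeff_natDegree, Nat.descFactorial_self]
  simp

open Polynomial in
/-- A polynomial that interpolates `F 0` at a multiset of nodes lies below `F 0` wherever the nodal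
polynomial is nonnegative, if the next derivative of `F 0` is positive. -/
theorem eval_le_of_interpolates (F : ℕ → ℝ → ℝ) (hF : ∀ k x, HasDerivAt (F k) (F (k + 1) x) x)
    (P : ℝ[X]) (s : Multiset ℝ) (hdeg : P.natDegree < s.card)
    (hz : ∀ a, ∀ j < s.count a, F j a = (derivative^[j] P).eval a) {A B : ℝ}
    (hAB : ∀ a ∈ s, a ∈ Icc A B) (hpos : ∀ x ∈ Icc A B, 0 < F s.card x) {x : ℝ}
    (hx : x ∈ Icc A B) (hs : 0 ≤ (s.map fun a => x - a).prod) : P.eval x ≤ F 0 x := by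
  by_cases hxs : x ∈ s
  · exact (hz x 0 (Multiset.count_pos.2 hxs)).ge
  set N : ℝ[X] := (s.map fun a => X - C a).prod with hN
  have hNm : N.Monic := monic_multiset_prod_of_monic _ _ fun a _ => monic_X_sub_C a
  have hNd : N.natDegree = s.card := natDegree_multiset_prod_X_sub_C_eq_card s
  have hNx : N.eval x = (s.map fun a => x - a).prod := by
    rw [hN, eval_multiset_prod, Multiset.map_map]
    simp
  have hNx0 : N.eval x ≠ 0 := by
    rw [hNx]
    refine fun h => hxs ?_
    obtain ⟨a, ha, h0⟩ := Multiset.mem_map.1 (Multiset.prod_eq_zero_iff.1 h)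
    rwa [sub_eq_zero.1 h0]
  -- With this `K` the function `F 0 - P - K N` vanishes at `x` as well as at the nodes. That is one
  -- zero more than the degree of `N`, and Rolle yields `ξ` with `F s.card ξ = K * s.card !`.
  set K : ℝ := (F 0 x - P.eval x) / N.eval x with hK
  set G : ℕ → ℝ → ℝ := fun k y =>
    F k y - (derivative^[k] P).eval y - K * (derivative^[k] N).eval y with hG
  have hGd : ∀ k y, HasDerivAt (G k) (G (k + 1) y) y := fun k y =>
    ((hF k y).sub (hasDerivAt_eval_iterate_derivative P k y)).sub
      ((hasDerivAt_eval_iterate_derivative N k y).const_mul K)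
  have hcard : (x ::ₘ s).card = s.card + 1 := Multiset.card_cons _ _
  obtain ⟨ξ, hξ, h0⟩ := exists_eq_zero_of_count_zeros G hGd s.card (x ::ₘ s) hcard (by
      intro a j hj
      by_cases hax : a = x
      · subst hax
        rw [Multiset.count_cons_self, Multiset.count_eq_zero_of_notMem hxs] at hj
        obtain rfl : j = 0 := by omega
        simp only [hG, Function.iterate_zero_apply, hK]
        rw [div_mul_cancel₀ _ hNx0, sub_self]
      · rw [Multiset.count_cons_of_ne hax] at hj
        have hdvd : (X - C a) ^ s.count a ∣ N := by
          have := pow_rootMultiplicity_dvd N a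
          rwa [← count_roots, hN, roots_multiset_prod_X_sub_C] at this
        simp only [hG]
        rw [hz a j hj, eval_iterate_derivative_eq_zero_of_dvd hdvd hj]
        ring) (A := A) (B := B) (by
      intro a ha
      rcases Multiset.mem_cons.1 ha with rfl | ha
      exacts [hx, hAB a ha])
  have hP0 : derivative^[s.card] P = 0 := iterate_derivative_eq_zero hdeg
  have hN0 := eval_iterate_derivative_of_monic hNm ξ
  rw [hNd] at hN0
  simp only [hG] at h0
  rw [hP0, hN0, eval_zero, sub_zero, sub_eq_zero] at h0
  have hKpos : 0 < K := by
    have := hpos ξ hξ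
    rw [h0] at this
    exact pos_of_mul_pos_left this (by positivity)
  have : F 0 x - P.eval x = K * N.eval x := by rw [hK, div_mul_cancel₀ _ hNx0]
  have h2 : 0 ≤ K * N.eval x := mul_nonneg hKpos.le (by rwa [hNx])
  linarith

/-! ### Positivity tests for polynomials with integer coefficients -/

/-- The value at `x` of the polynomial with the integer coefficients `l`, the lowest first. -/
noncomputable def hornerEval (l : List ℤ) (x : ℝ) : ℝ := l.foldr (fun a r => a + x * r) 0

@[simp] theorem hornerEval_nil (x : ℝ) : hornerEval [] x = 0 := rfl

@[simp] theorem hornerEval_cons (a : ℤ) (l : List ℤ) (x : ℝ) :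
    hornerEval (a :: l) x = a + x * hornerEval l x := rfl

/-- The coefficients of `c + (X + a) * l`. -/
def shiftStep (a : ℤ) : ℤ → List ℤ → List ℤ
  | c, [] => [c]
  | c, r :: l => (c + a * r) :: shiftStep a r l

theorem hornerEval_shiftStep (a c : ℤ) (l : List ℤ) (x : ℝ) :
    hornerEval (shiftStep a c l) x = c + (x + a) * hornerEval l x := by
  induction l generalizing c with
  | nil => simp [shiftStep]
  | cons r l ih => simp [shiftStep, ih]; ring

/-- The coefficients of the polynomial composed with `X + a`. -/
def taylorShift (a : ℤ) (l : List ℤ) : List ℤ := l.foldr (shiftStep a) []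

theorem hornerEval_taylorShift (a : ℤ) (l : List ℤ) (x : ℝ) :
    hornerEval (taylorShift a l) x = hornerEval l (x + a) := by
  induction l with
  | nil => simp [taylorShift]
  | cons r l ih =>
    rw [taylorShift, List.foldr_cons, ← taylorShift, hornerEval_shiftStep, ih, hornerEval_cons]

/-- A lower bound for the polynomial on `[0, h]`. -/
def lowerBoundOn (h : ℤ) (l : List ℤ) : ℤ := l.foldr (fun a r => a + h * min 0 r) 0

/-- Horner's scheme in interval arithmetic: if the inner value is at least `r`, its product with `x
∈ [0, h]` is at least `h * min 0 r`. -/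
theorem lowerBoundOn_le (h : ℤ) (l : List ℤ) {x : ℝ} (h0 : 0 ≤ x) (h1 : x ≤ h) :
    (lowerBoundOn h l : ℝ) ≤ hornerEval l x := by
  induction l with
  | nil => simp [lowerBoundOn]
  | cons a l ih =>
    rw [lowerBoundOn, List.foldr_cons, ← lowerBoundOn, hornerEval_cons]
    push_cast
    have h2 : min 0 (lowerBoundOn h l : ℝ) ≤ hornerEval l x := (min_le_right _ _).trans ih
    have h3 : min 0 (lowerBoundOn h l : ℝ) ≤ 0 := min_le_left _ _
    have h4 : x * min 0 (lowerBoundOn h l : ℝ) ≤ x * hornerEval l x :=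
      mul_le_mul_of_nonneg_left h2 h0
    have h5 : (h : ℝ) * min 0 (lowerBoundOn h l : ℝ) ≤ x * min 0 (lowerBoundOn h l : ℝ) :=
      mul_le_mul_of_nonpos_right h1 h3
    linarith

/-- A test that the polynomial is positive between `a` and the last of the points that follow. -/
def isPosOn (l : List ℤ) : ℤ → List ℤ → Bool
  | _, [] => true
  | a, b :: t => decide (0 < lowerBoundOn (b - a) (taylorShift a l)) && isPosOn l b t

theorem hornerEval_pos_of_isPosOn {l : List ℤ} {a b : ℤ} {t : List ℤ}
    (h : isPosOn l a (b :: t) = true) {x : ℝ} (h0 : (a : ℝ) ≤ x)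
    (h1 : x ≤ ((b :: t).getLast (List.cons_ne_nil _ _) : ℤ)) : 0 < hornerEval l x := by
  induction t generalizing a b with
  | nil =>
    simp only [isPosOn, Bool.and_true, decide_eq_true_eq] at h
    rw [List.getLast_singleton] at h1
    have h2 := lowerBoundOn_le (b - a) (taylorShift a l) (x := x - a) (by linarith)
      (by push_cast; linarith)
    rw [hornerEval_taylorShift, sub_add_cancel] at h2
    exact lt_of_lt_of_le (by exact_mod_cast h) h2
  | cons c t ih =>
    rw [isPosOn, Bool.and_eq_true, decide_eq_true_eq] at h
    rcases le_total x b with hb | hb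
    · have h2 := lowerBoundOn_le (b - a) (taylorShift a l) (x := x - a) (by linarith)
        (by push_cast; linarith)
      rw [hornerEval_taylorShift, sub_add_cancel] at h2
      exact lt_of_lt_of_le (by exact_mod_cast h.1) h2
    · rw [List.getLast_cons (List.cons_ne_nil _ _)] at h1
      exact ih h.2 hb h1

theorem hornerEval_eq_sum (l : List ℤ) (x : ℝ) {n : ℕ} (hn : l.length ≤ n) :
    hornerEval l x = ∑ i ∈ Finset.range n, (l.getD i 0 : ℝ) * x ^ i := by
  induction l generalizing n with
  | nil => simp
  | cons a l ih =>
    obtain ⟨n, rfl⟩ : ∃ m, n = m + 1 := ⟨n - 1, by simp at hn; omega⟩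
    rw [hornerEval_cons, ih (n := n) (by simpa using hn), Finset.sum_range_succ', Finset.mul_sum,
      add_comm]
    congr 1
    · refine Finset.sum_congr rfl fun i _ => ?_
      rw [List.getD_cons_succ, pow_succ]; ring
    · simp

open Polynomial in
theorem hornerEval_le_eval {l : List ℤ} {K : ℝ} {q : ℝ[X]}
    (h : ∀ k, (l.getD k 0 : ℝ) ≤ K * q.coeff k) {x : ℝ} (hx : 0 ≤ x) :
    hornerEval l x ≤ K * q.eval x := by
  rw [hornerEval_eq_sum l x (le_max_left l.length (q.natDegree + 1)),
    eval_eq_sum_range' (lt_of_lt_of_le (Nat.lt_succ_self _) (le_max_right l.length _)),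
    Finset.mul_sum]
  refine Finset.sum_le_sum fun i _ => ?_
  rw [← mul_assoc]
  exact mul_le_mul_of_nonneg_right (h i) (by positivity)

/-! ### Positivity of the eighteenth derivative -/

/-- Rounded coefficients of the alternating series of `10 ^ 200 * coshSqrt 18 (-u)`. -/
def coshSqrtEighteenCoeff (m : ℕ) : ℤ :=
  (10 ^ 200 * ((-1) ^ m * (m + 18).factorial)) / (m.factorial * (2 * (m + 18)).factorial : ℕ)

/-- An even number of terms of the alternating series is a lower bound; here `24 = 12 + 2 * 6` terms
suffice. This polynomial is tested after its coefficients are rounded down. -/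
theorem coshSqrt_eighteen_pos {u : ℝ} (h0 : 0 ≤ u) (h1 : u ≤ 507) : 0 < coshSqrt 18 (-u) := by
  have h2 := (coshSqrtPartial_bounds h0 (h1.trans (by norm_num)) 18 6).1
  have h3 : isPosOn ((List.range 24).map coshSqrtEighteenCoeff) 0
      -- Subdivision points of `[0, 507]`, close enough together for the Horner bound to be positive
      -- on each piece.
      [73, 143, 208, 269, 325, 376, 421, 459, 488, 506, 507] = true := by
    decide +kernel
  have h4 := hornerEval_pos_of_isPosOn h3 (x := u) (by simpa using h0) (by simpa using h1)
  rw [hornerEval_eq_sum _ u (n := 24) (by simp)] at h4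
  have h5 : ∑ i ∈ Finset.range 24,
      ((((List.range 24).map coshSqrtEighteenCoeff).getD i 0 : ℤ) : ℝ) * u ^ i ≤
        10 ^ 200 * coshSqrtPartial 18 24 u := by
    rw [coshSqrtPartial, Finset.mul_sum]
    refine Finset.sum_le_sum fun m hm => ?_
    have hm' : m < ((List.range 24).map coshSqrtEighteenCoeff).length := by
      simpa using Finset.mem_range.1 hm
    rw [List.getD_eq_getElem _ _ hm', List.getElem_map, List.getElem_range]
    have h6 : (coshSqrtEighteenCoeff m : ℝ) ≤ 10 ^ 200 * ((-1) ^ m * ((m + 18).factorial : ℝ)) /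
        (m.factorial * (2 * (m + 18)).factorial : ℝ) := by
      rw [le_div_iff₀ (by positivity)]
      have := Int.ediv_mul_le (10 ^ 200 * ((-1) ^ m * ((m + 18).factorial : ℤ)))
        (b := ((m.factorial * (2 * (m + 18)).factorial : ℕ) : ℤ)) (by positivity)
      unfold coshSqrtEighteenCoeff
      exact_mod_cast this
    refine (mul_le_mul_of_nonneg_right h6 (by positivity)).trans (le_of_eq ?_)
    rw [coshSqrtCoeff]
    field_simp
  have h7 : 0 < (10 : ℝ) ^ 200 * coshSqrtPartial 18 24 u := lt_of_lt_of_le h4 h5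
  exact lt_of_lt_of_le (pos_of_mul_pos_right h7 (by positivity)) h2

/-! ### The nodal polynomial of the example -/

open Polynomial in
/-- The nodal polynomial, in the variable `z = -x ^ 2`, of the nonzero nodes. -/
noncomputable def exampleNodal (v₁ v₂ : ℝ) : ℝ[X] :=
  (X + C v₂) ^ 2 * (X + C (121 / 25 * v₂)) ^ 4 * (X + C v₁) ^ 4 * (X + C (121 / 25 * v₁)) ^ 6

/-- Bounds for the squares of the nodes `τ₁` and `τ₂`. -/
structure NodeBounds (v₁ v₂ : ℝ) : Prop where
  lower₁ : 93.95 ≤ v₁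
  upper₁ : v₁ ≤ 93.951
  lower₂ : 16.888 ≤ v₂
  upper₂ : v₂ ≤ 16.889

open Polynomial in
theorem exampleNodal_monic (v₁ v₂ : ℝ) : (exampleNodal v₁ v₂).Monic := by
  unfold exampleNodal
  exact ((((monic_X_add_C _).pow 2).mul ((monic_X_add_C _).pow 4)).mul
    ((monic_X_add_C _).pow 4)).mul ((monic_X_add_C _).pow 6)

open Polynomial in
theorem natDegree_exampleNodal (v₁ v₂ : ℝ) : (exampleNodal v₁ v₂).natDegree = 16 := by
  unfold exampleNodal
  rw [(((monic_X_add_C _).pow 2).mul ((monic_X_add_C _).pow 4)).mul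
    ((monic_X_add_C _).pow 4) |>.natDegree_mul ((monic_X_add_C _).pow 6),
    ((monic_X_add_C _).pow 2).mul ((monic_X_add_C _).pow 4)
      |>.natDegree_mul ((monic_X_add_C _).pow 4),
    ((monic_X_add_C _).pow 2).natDegree_mul ((monic_X_add_C _).pow 4)]
  simp only [(monic_X_add_C _).natDegree_pow, natDegree_X_add_C]

open Polynomial in
theorem exampleNodal_eq (v₁ v₂ : ℝ) :
    exampleNodal v₁ v₂ =
      X ^ 16 + ∑ i ∈ Finset.range 16, C ((exampleNodal v₁ v₂).coeff i) * X ^ i := by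
  have := (exampleNodal_monic v₁ v₂).as_sum
  rwa [natDegree_exampleNodal] at this

open Polynomial in
theorem coeff_mul_nonneg {p q : ℝ[X]} (hp : ∀ i, 0 ≤ p.coeff i) (hq : ∀ i, 0 ≤ q.coeff i) (i : ℕ) :
    0 ≤ (p * q).coeff i := by
  rw [coeff_mul]
  exact Finset.sum_nonneg fun x _ => mul_nonneg (hp _) (hq _)

open Polynomial in
theorem coeff_X_add_C_pow_nonneg {v : ℝ} (hv : 0 ≤ v) (n i : ℕ) :
    0 ≤ ((X + C v) ^ n : ℝ[X]).coeff i := by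
  rw [coeff_X_add_C_pow]
  positivity

theorem exampleNodal_coeff_nonneg {v₁ v₂ : ℝ} (h₁ : 0 ≤ v₁) (h₂ : 0 ≤ v₂) (i : ℕ) :
    0 ≤ (exampleNodal v₁ v₂).coeff i := by
  unfold exampleNodal
  exact coeff_mul_nonneg (coeff_mul_nonneg (coeff_mul_nonneg (coeff_X_add_C_pow_nonneg h₂ 2)
    (coeff_X_add_C_pow_nonneg (by positivity) 4)) (coeff_X_add_C_pow_nonneg h₁ 4))
    (coeff_X_add_C_pow_nonneg (by positivity) 6) i

open Polynomial in
-- The claim amounts to `W(4900) ≤ 2 * 4900 ^ 16`, that is, `∏ (1 + yᵢ / 4900) ≤ 2` over the negated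
-- roots `yᵢ`; the constant 4900 is chosen for this.
theorem sum_exampleNodal_coeff_le {v₁ v₂ : ℝ} (h : NodeBounds v₁ v₂) :
    ∑ i ∈ Finset.range 16, (exampleNodal v₁ v₂).coeff i * 4900 ^ i ≤ 4900 ^ 16 := by
  have h1 : (exampleNodal v₁ v₂).eval 4900 =
      4900 ^ 16 + ∑ i ∈ Finset.range 16, (exampleNodal v₁ v₂).coeff i * 4900 ^ i := by
    conv_lhs => rw [exampleNodal_eq]
    simp [eval_finsetSum]
  have h2 : (exampleNodal v₁ v₂).eval 4900 ≤ 2 * 4900 ^ 16 := by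
    obtain ⟨a, b, c, d⟩ := h
    have e1 : (0 : ℝ) ≤ v₁ := by linarith
    have e2 : (0 : ℝ) ≤ v₂ := by linarith
    simp only [exampleNodal, eval_mul, eval_pow, eval_add, eval_X, eval_C]
    calc (4900 + v₂) ^ 2 * (4900 + 121 / 25 * v₂) ^ 4 * (4900 + v₁) ^ 4 *
          (4900 + 121 / 25 * v₁) ^ 6
        ≤ (4900 + 17) ^ 2 * (4900 + 82) ^ 4 * (4900 + 94) ^ 4 * (4900 + 455) ^ 6 := by
          gcongr <;> linarith
      _ ≤ _ := by norm_num
  linarith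

theorem summable_exampleNodal_remainderTerm {v₁ v₂ : ℝ} (h : NodeBounds v₁ v₂) {i : ℕ}
    (hi : i < 16) : Summable (remainderTerm (exampleNodal v₁ v₂).coeff i) :=
  summable_remainderTerm (N := 95)
    (exampleNodal_coeff_nonneg (by linarith [h.lower₁]) (by linarith [h.lower₂]))
    (by norm_num) (sum_exampleNodal_coeff_le h) (by norm_num) hi

theorem coshSqrtInterpolant_coeff (W : Polynomial ℝ) (k : ℕ) :
    (coshSqrtInterpolant W).coeff k =
      (if k < 17 then 1 / ((2 * k).factorial : ℝ) else 0) +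
        if 2 ≤ k ∧ k < 18 then ∑' n, remainderTerm W.coeff (k - 2) n else 0 := by
  rw [coshSqrtInterpolant, Polynomial.coeff_add, Polynomial.finsetSum_coeff,
    Polynomial.finsetSum_coeff]
  simp only [Polynomial.coeff_C_mul, Polynomial.coeff_X_pow, mul_ite, mul_one, mul_zero]
  congr 1
  · rw [Finset.sum_ite_eq]; simp
  · split_ifs with h
    · rw [Finset.sum_eq_single (k - 2)]
      · rw [if_pos (by omega)]
      · intro b _ hb
        rw [if_neg (by omega)]
      · intro hb
        exact absurd (Finset.mem_range.2 (by omega)) hb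
    · refine Finset.sum_eq_zero fun i hi => ?_
      rw [Finset.mem_range] at hi
      rw [if_neg (by omega)]

theorem natDegree_coshSqrtInterpolant_le (W : Polynomial ℝ) :
    (coshSqrtInterpolant W).natDegree ≤ 17 := by
  rw [Polynomial.natDegree_le_iff_coeff_eq_zero]
  intro k hk
  rw [coshSqrtInterpolant_coeff, if_neg (by omega), if_neg (by omega), add_zero]

/-! ### From interpolation in `z = -x²` to interpolation in `x` -/

open Polynomial in
/-- The composition `P (-X ^ 2)` for a polynomial `P` of degree at most `17`. -/
noncomputable def compNegSq (P : ℝ[X]) : ℝ[X] :=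
  ∑ k ∈ Finset.range 18, C ((-1) ^ k * P.coeff k) * X ^ (2 * k)

theorem compNegSq_coeff_even (P : Polynomial ℝ) {k : ℕ} (hk : k < 18) :
    (compNegSq P).coeff (2 * k) = (-1) ^ k * P.coeff k := by
  rw [compNegSq, Polynomial.finsetSum_coeff, Finset.sum_eq_single k]
  · rw [Polynomial.coeff_C_mul_X_pow, if_pos rfl]
  · intro b _ hb
    rw [Polynomial.coeff_C_mul_X_pow, if_neg (by omega)]
  · intro h
    exact absurd (Finset.mem_range.2 hk) h

theorem compNegSq_coeff_odd (P : Polynomial ℝ) (k : ℕ) : (compNegSq P).coeff (2 * k + 1) = 0 := by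
  rw [compNegSq, Polynomial.finsetSum_coeff]
  refine Finset.sum_eq_zero fun b _ => ?_
  rw [Polynomial.coeff_C_mul_X_pow, if_neg (by omega)]

theorem natDegree_compNegSq_le (P : Polynomial ℝ) : (compNegSq P).natDegree ≤ 34 := by
  refine Polynomial.natDegree_sum_le_of_forall_le _ _ fun k hk => ?_
  rw [Finset.mem_range] at hk
  exact (Polynomial.natDegree_C_mul_X_pow_le _ _).trans (by omega)

theorem eval_compNegSq {P : Polynomial ℝ} (hP : P.natDegree ≤ 17) (x : ℝ) :
    (compNegSq P).eval x = P.eval (-x ^ 2) := by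
  rw [compNegSq, Polynomial.eval_finsetSum, Polynomial.eval_eq_sum_range' (n := 18) (by omega)]
  refine Finset.sum_congr rfl fun k _ => ?_
  rw [Polynomial.eval_mul, Polynomial.eval_C, Polynomial.eval_pow, Polynomial.eval_X,
    neg_pow (x ^ 2), ← pow_mul]
  ring

open Polynomial in
/-- The polynomials `A j i` with `(d/dx)^j F(-x^2) = ∑ i ≤ j, F^(i)(-x^2) A j i (x)`. -/
noncomputable def chainCoeff : ℕ → ℕ → ℝ[X]
  | 0, i => if i = 0 then 1 else 0
  | j + 1, 0 => derivative (chainCoeff j 0)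
  | j + 1, i + 1 => derivative (chainCoeff j (i + 1)) - 2 * X * chainCoeff j i

theorem chainCoeff_eq_zero {j i : ℕ} (h : j < i) : chainCoeff j i = 0 := by
  induction j generalizing i with
  | zero => rw [chainCoeff, if_neg (by omega)]
  | succ j ih =>
    obtain ⟨i, rfl⟩ : ∃ k, i = k + 1 := ⟨i - 1, by omega⟩
    rw [chainCoeff, ih (by omega), ih (by omega)]
    simp

/-- The explicit coefficients are immaterial; what counts is that the `j`-th derivative of `F(-x²)`
involves only derivatives of `F` of order at most `j`. -/
theorem iterated_chain_eq_sum {F d : ℕ → ℝ → ℝ} (hF : ∀ k x, HasDerivAt (F k) (F (k + 1) x) x)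
    (hd : ∀ k x, HasDerivAt (d k) (d (k + 1) x) x) (h0 : ∀ x, d 0 x = F 0 (-x ^ 2)) (j : ℕ) :
    ∀ x, d j x = ∑ i ∈ Finset.range (j + 1), F i (-x ^ 2) * (chainCoeff j i).eval x := by
  induction j with
  | zero => intro x; simp [h0, chainCoeff]
  | succ j ih =>
    intro x
    have h1 : HasDerivAt (fun y : ℝ => -y ^ 2) (-(2 * x)) x := by
      simpa using (hasDerivAt_pow 2 x).fun_neg
    have h2 : HasDerivAt
        (fun y => ∑ i ∈ Finset.range (j + 1), F i (-y ^ 2) * (chainCoeff j i).eval y)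
        (∑ i ∈ Finset.range (j + 1), (F (i + 1) (-x ^ 2) * (-(2 * x)) * (chainCoeff j i).eval x +
          F i (-x ^ 2) * (chainCoeff j i).derivative.eval x)) x :=
      HasDerivAt.fun_sum fun i _ =>
        ((hF i (-x ^ 2)).comp x h1).mul ((chainCoeff j i).hasDerivAt x)
    rw [← funext ih] at h2
    rw [(hd j x).unique h2, Finset.sum_range_succ' _ (j + 1), Finset.sum_add_distrib]
    have h3 : ∑ i ∈ Finset.range (j + 1), F i (-x ^ 2) * (chainCoeff j i).derivative.eval x =
        ∑ i ∈ Finset.range (j + 1),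
          F (i + 1) (-x ^ 2) * (chainCoeff j (i + 1)).derivative.eval x +
          F 0 (-x ^ 2) * (chainCoeff j 0).derivative.eval x := by
      rw [← Finset.sum_range_succ'
        (fun i => F i (-x ^ 2) * (chainCoeff j i).derivative.eval x) (j + 1),
        Finset.sum_range_succ _ (j + 1), chainCoeff_eq_zero (Nat.lt_succ_self j)]
      simp
    rw [h3, ← add_assoc, ← Finset.sum_add_distrib]
    congr 1
    refine Finset.sum_congr rfl fun i _ => ?_
    simp only [chainCoeff, Polynomial.eval_sub, Polynomial.eval_mul, Polynomial.eval_X,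
      Polynomial.eval_ofNat]
    ring

theorem hasDerivAt_iteratedDeriv_cos (k : ℕ) (x : ℝ) :
    HasDerivAt (iteratedDeriv k Real.cos) (iteratedDeriv (k + 1) Real.cos x) x := by
  rw [iteratedDeriv_succ]
  exact (Real.differentiable_iteratedDeriv_cos k x).hasDerivAt

open Polynomial in
-- Apply the chain rule to `P - Φ`: if this vanishes to order `r` at `-a²`, its composition with
-- `-x²` vanishes to order `r` at `a`.
theorem agreesWithCos_compNegSq {P : ℝ[X]} (hP : P.natDegree ≤ 17) {a : ℝ} {r : ℕ}
    (h : ∀ j < r, coshSqrt j (-a ^ 2) = (derivative^[j] P).eval (-a ^ 2)) :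
    AgreesWithCos (compNegSq P) a r := by
  intro j hj
  have key := iterated_chain_eq_sum (F := fun k z => (derivative^[k] P).eval z - coshSqrt k z)
    (d := fun k x => (derivative^[k] (compNegSq P)).eval x - iteratedDeriv k Real.cos x)
    (fun k x => (hasDerivAt_eval_iterate_derivative P k x).sub (hasDerivAt_coshSqrt k x))
    (fun k x => (hasDerivAt_eval_iterate_derivative _ k x).sub (hasDerivAt_iteratedDeriv_cos k x))
    (fun x => by
      simp only [Function.iterate_zero_apply, iteratedDeriv_zero]
      rw [eval_compNegSq hP, cos_eq_coshSqrt]) j a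
  rw [← sub_eq_zero, key]
  refine Finset.sum_eq_zero fun i hi => ?_
  rw [Finset.mem_range] at hi
  rw [h i (by omega), sub_self, zero_mul]

/-! ### Uniqueness of the interpolant -/

open Polynomial in
theorem X_sub_C_pow_dvd_of_eval_iterate_derivative_eq_zero {q : ℝ[X]} {x : ℝ} {m : ℕ}
    (h : ∀ j < m, (derivative^[j] q).eval x = 0) : (X - C x) ^ m ∣ q := by
  rcases eq_or_ne q 0 with rfl | hq
  · exact dvd_zero _
  cases m with
  | zero => simp
  | succ m =>
    rw [← le_rootMultiplicity_iff hq]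
    exact (lt_rootMultiplicity_iff_isRoot_iterate_derivative hq).2 fun j hj => h j (by omega)

open Polynomial in
theorem eq_zero_of_pow_dvd {n : ℕ} {x : Fin n → ℝ} (hx : Function.Injective x) (m : Fin n → ℕ)
    {q : ℝ[X]} (h : ∀ i, (X - C (x i)) ^ m i ∣ q) (hq : q.natDegree < ∑ i, m i) : q = 0 := by
  by_contra hne
  have hcop : ∀ i j, i ≠ j → IsCoprime ((X - C (x i)) ^ m i) ((X - C (x j)) ^ m j) :=
    fun i j hij => IsCoprime.pow (pairwise_coprime_X_sub_C hx hij)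
  have hprod : ∏ i, (X - C (x i)) ^ m i ∣ q :=
    Finset.prod_dvd_of_coprime (fun i _ j _ hij => hcop i j hij) fun i _ => h i
  have hdeg : (∏ i, (X - C (x i)) ^ m i).natDegree = ∑ i, m i := by
    rw [natDegree_prod_of_monic _ _ fun i _ => (monic_X_sub_C (x i)).pow (m i)]
    exact Finset.sum_congr rfl fun i _ => by
      rw [(monic_X_sub_C (x i)).natDegree_pow, natDegree_X_sub_C, mul_one]
  have h1 := natDegree_le_of_dvd hprod hne
  omega

/-- The nodes of the interpolation. -/
noncomputable def exampleNodes (τ₁ τ₂ : ℝ) : Fin 9 → ℝ :=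
  ![-(11 * τ₁ / 5), -τ₁, -(11 * τ₂ / 5), -τ₂, 0, τ₂, 11 * τ₂ / 5, τ₁, 11 * τ₁ / 5]

theorem exampleNodes_strictMono {τ₁ τ₂ : ℝ} (h₂ : 0 < τ₂) (h₁₂ : 11 * τ₂ / 5 < τ₁) :
    StrictMono (exampleNodes τ₁ τ₂) := by
  rw [Fin.strictMono_iff_lt_succ]
  have a1 : -(11 * τ₁ / 5) < -τ₁ := by linarith
  have a2 : -τ₁ < -(11 * τ₂ / 5) := by linarith
  have a3 : -(11 * τ₂ / 5) < -τ₂ := by linarith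
  have a4 : -τ₂ < 0 := by linarith
  have a5 : τ₂ < 11 * τ₂ / 5 := by linarith
  have a6 : τ₁ < 11 * τ₁ / 5 := by linarith
  intro i
  fin_cases i
  exacts [a1, a2, a3, a4, h₂, a5, h₁₂, a6]

open Polynomial in
-- The nodes are distinct, so the difference of two interpolants is divisible by a product of degree
-- 35, while its degree is at most 34.
theorem IsExampleInterpolant.unique {τ₁ τ₂ : ℝ} (h₂ : 0 < τ₂) (h₁₂ : 11 * τ₂ / 5 < τ₁) {p q : ℝ[X]}
    (hp : IsExampleInterpolant τ₁ τ₂ p) (hq : IsExampleInterpolant τ₁ τ₂ q) : q = p := by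
  have hdvd : ∀ {x : ℝ} {m : ℕ}, AgreesWithCos p x m → AgreesWithCos q x m →
      (X - C x) ^ m ∣ q - p := fun h h' =>
    X_sub_C_pow_dvd_of_eval_iterate_derivative_eq_zero fun j hj => by
      rw [iterate_derivative_sub, eval_sub, h j hj, h' j hj, sub_self]
  obtain ⟨hpd, p0, p1, p2, p3, p4, p5, p6, p7, p8⟩ := hp
  obtain ⟨hqd, q0, q1, q2, q3, q4, q5, q6, q7, q8⟩ := hq
  have hall : ∀ i, (X - C (exampleNodes τ₁ τ₂ i)) ^ (![6, 4, 4, 2, 3, 2, 4, 4, 6] : Fin 9 → ℕ) i ∣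
      q - p := by
    intro i
    fin_cases i
    exacts [hdvd p6 q6, hdvd p2 q2, hdvd p8 q8, hdvd p4 q4, hdvd p0 q0, hdvd p3 q3, hdvd p7 q7,
      hdvd p1 q1, hdvd p5 q5]
  have h3 := natDegree_sub_le q p
  have h4 : ∑ i, (![6, 4, 4, 2, 3, 2, 4, 4, 6] : Fin 9 → ℕ) i = 35 := by decide
  exact sub_eq_zero.1 (eq_zero_of_pow_dvd (exampleNodes_strictMono h₂ h₁₂).injective _ hall
    (by rw [h4]; omega))

/-! ### The interpolant of the example, and its position below the cosine for `x² ≤ 507` -/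

/-- The interpolant of `cos`. -/
noncomputable def examplePoly (v₁ v₂ : ℝ) : Polynomial ℝ :=
  compNegSq (coshSqrtInterpolant (exampleNodal v₁ v₂))

open Polynomial in
theorem coshSqrt_eq_of_dvd {v₁ v₂ : ℝ} (h : NodeBounds v₁ v₂) {z : ℝ} {r : ℕ}
    (hr : (X - C z) ^ r ∣ X ^ 2 * exampleNodal v₁ v₂) {j : ℕ} (hj : j < r) :
    coshSqrt j z =
      (derivative^[j] (coshSqrtInterpolant (exampleNodal v₁ v₂))).eval z :=
  coshSqrt_eq_eval_interpolant (exampleNodal_eq v₁ v₂)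
    (fun _ hi => summable_exampleNodal_remainderTerm h hi) hr hj

theorem examplePoly_coeff_zero (v₁ v₂ : ℝ) : (examplePoly v₁ v₂).coeff 0 = 1 := by
  have := compNegSq_coeff_even (coshSqrtInterpolant (exampleNodal v₁ v₂)) (k := 0) (by omega)
  rw [mul_zero] at this
  rw [examplePoly, this, coshSqrtInterpolant_coeff]
  simp

theorem examplePoly_coeff_two (v₁ v₂ : ℝ) : (examplePoly v₁ v₂).coeff 2 = -(1 / 2) := by
  have := compNegSq_coeff_even (coshSqrtInterpolant (exampleNodal v₁ v₂)) (k := 1) (by omega)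
  rw [mul_one] at this
  rw [examplePoly, this, coshSqrtInterpolant_coeff]
  simp

/-- The double node `z = 0` fixes the coefficients of `1` and `x ^ 2`; the coefficient of `x`
vanishes by evenness. -/
theorem agreesWithCos_examplePoly_zero (v₁ v₂ : ℝ) : AgreesWithCos (examplePoly v₁ v₂) 0 3 := by
  intro j hj
  have h1 : (examplePoly v₁ v₂).coeff 1 = 0 := compNegSq_coeff_odd _ 0
  rw [← Polynomial.coeff_zero_eq_eval_zero, Polynomial.coeff_iterate_derivative, zero_add]
  interval_cases j
  · simp [examplePoly_coeff_zero]
  · simp [h1]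
  · rw [examplePoly_coeff_two, show (2 : ℕ) = 2 * 1 by rfl, Real.iteratedDeriv_even_cos]
    simp [Nat.descFactorial]

open Polynomial in
theorem isExampleInterpolant_examplePoly {v₁ v₂ τ₁ τ₂ : ℝ} (h : NodeBounds v₁ v₂)
    (h₁ : τ₁ ^ 2 = v₁) (h₂ : τ₂ ^ 2 = v₂) :
    IsExampleInterpolant τ₁ τ₂ (examplePoly v₁ v₂) := by
  have key : ∀ {a z : ℝ} {r : ℕ}, a ^ 2 = z → (X + C z) ^ r ∣ X ^ 2 * exampleNodal v₁ v₂ →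
      AgreesWithCos (examplePoly v₁ v₂) a r := by
    intro a z r ha hr
    refine agreesWithCos_compNegSq (natDegree_coshSqrtInterpolant_le _) fun j hj => ?_
    rw [ha]
    refine coshSqrt_eq_of_dvd h (r := r) ?_ hj
    rwa [C_neg, sub_neg_eq_add]
  have d1 : (X + C v₂) ^ 2 ∣ X ^ 2 * exampleNodal v₁ v₂ :=
    ⟨X ^ 2 * (X + C (121 / 25 * v₂)) ^ 4 * (X + C v₁) ^ 4 * (X + C (121 / 25 * v₁)) ^ 6, by
      rw [exampleNodal]; generalize X + C v₂ = a, X + C (121 / 25 * v₂) = b, X + C v₁ = c,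
        X + C (121 / 25 * v₁) = d; ring⟩
  have d2 : (X + C (121 / 25 * v₂)) ^ 4 ∣ X ^ 2 * exampleNodal v₁ v₂ :=
    ⟨X ^ 2 * (X + C v₂) ^ 2 * (X + C v₁) ^ 4 * (X + C (121 / 25 * v₁)) ^ 6, by
      rw [exampleNodal]; generalize X + C v₂ = a, X + C (121 / 25 * v₂) = b, X + C v₁ = c,
        X + C (121 / 25 * v₁) = d; ring⟩
  have d3 : (X + C v₁) ^ 4 ∣ X ^ 2 * exampleNodal v₁ v₂ :=
    ⟨X ^ 2 * (X + C v₂) ^ 2 * (X + C (121 / 25 * v₂)) ^ 4 * (X + C (121 / 25 * v₁)) ^ 6, by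
      rw [exampleNodal]; generalize X + C v₂ = a, X + C (121 / 25 * v₂) = b, X + C v₁ = c,
        X + C (121 / 25 * v₁) = d; ring⟩
  have d4 : (X + C (121 / 25 * v₁)) ^ 6 ∣ X ^ 2 * exampleNodal v₁ v₂ :=
    ⟨X ^ 2 * (X + C v₂) ^ 2 * (X + C (121 / 25 * v₂)) ^ 4 * (X + C v₁) ^ 4, by
      rw [exampleNodal]; generalize X + C v₂ = a, X + C (121 / 25 * v₂) = b, X + C v₁ = c,
        X + C (121 / 25 * v₁) = d; ring⟩
  exact ⟨natDegree_compNegSq_le _, agreesWithCos_examplePoly_zero v₁ v₂,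
    key h₁ d3, key (by rw [neg_sq, h₁]) d3, key h₂ d1, key (by rw [neg_sq, h₂]) d1,
    key (by rw [← h₁]; ring) d4, key (by rw [← h₁]; ring) d4,
    key (by rw [← h₂]; ring) d2, key (by rw [← h₂]; ring) d2⟩

open Polynomial in
-- The error formula on `[-507, 0]`, an interval that contains all nodes and on which the eighteenth
-- derivative of `Φ` is positive.
theorem examplePoly_le_cos_of_sq_le {v₁ v₂ : ℝ} (h : NodeBounds v₁ v₂) {x : ℝ}
    (hx : x ^ 2 ≤ 507) : (examplePoly v₁ v₂).eval x ≤ Real.cos x := by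
  set s : Multiset ℝ := Multiset.replicate 2 0 + Multiset.replicate 2 (-v₂) +
    Multiset.replicate 4 (-(121 / 25 * v₂)) + Multiset.replicate 4 (-v₁) +
    Multiset.replicate 6 (-(121 / 25 * v₁)) with hs
  have hcard : s.card = 18 := by simp [hs]
  have hnod : (s.map fun a => X - C a).prod = X ^ 2 * exampleNodal v₁ v₂ := by
    simp only [hs, Multiset.map_add, Multiset.map_replicate, Multiset.prod_add,
      Multiset.prod_replicate, C_neg, sub_neg_eq_add, C_0, sub_zero, exampleNodal, mul_assoc]
  rw [examplePoly, eval_compNegSq (natDegree_coshSqrtInterpolant_le _), cos_eq_coshSqrt]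
  obtain ⟨l1, u1, l2, u2⟩ := id h
  refine eval_le_of_interpolates coshSqrt hasDerivAt_coshSqrt _ s
    (by rw [hcard]; exact Nat.lt_succ_of_le (natDegree_coshSqrtInterpolant_le _))
    (fun a j hj => coshSqrt_eq_of_dvd h (r := s.count a) ?_ hj) (A := -507) (B := 0) ?_ ?_
    ⟨by linarith, by nlinarith⟩ ?_
  · have := pow_rootMultiplicity_dvd (s.map fun a => X - C a).prod a
    rwa [← count_roots, roots_multiset_prod_X_sub_C, hnod] at this
  · intro a ha
    simp only [hs, Multiset.mem_add, Multiset.mem_replicate] at ha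
    rcases ha with (((⟨-, rfl⟩ | ⟨-, rfl⟩) | ⟨-, rfl⟩) | ⟨-, rfl⟩) | ⟨-, rfl⟩ <;>
      constructor <;> linarith
  · intro z hz
    rw [hcard, ← neg_neg z]
    exact coshSqrt_eighteen_pos (by linarith [hz.2]) (by linarith [hz.1])
  -- Every multiplicity is even, so the nodal product is a product of even powers.
  · simp only [hs, Multiset.map_add, Multiset.map_replicate, Multiset.prod_add,
      Multiset.prod_replicate]
    positivity

/-! ### Integer enclosures of the coefficients of the interpolant -/

/-- The continuation `k` applied to `n`, in a form that makes a lazy evaluator compute `n`. -/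
def forceNat {α : Sort*} (n : ℕ) (k : ℕ → α) : α :=
  match n with
  | 0 => k 0
  | m + 1 => k (m + 1)

theorem forceNat_eq {α : Sort*} (n : ℕ) (k : ℕ → α) : forceNat n k = k n := by
  cases n <;> rfl

/-- The continuation `k` applied to `n`, in a form that makes a lazy evaluator compute `n`. -/
def forceInt {α : Sort*} (n : ℤ) (k : ℤ → α) : α :=
  match n with
  | .ofNat m => forceNat m fun m' => k (.ofNat m')
  | .negSucc m => forceNat m fun m' => k (.negSucc m')

theorem forceInt_eq {α : Sort*} (n : ℤ) (k : ℤ → α) : forceInt n k = k n := by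
  cases n <;> simp [forceInt, forceNat_eq]

/-- The continuation `k` applied to `l`, in a form that makes a lazy evaluator compute `l`. -/
def forceList {α : Sort*} : List ℤ → (List ℤ → α) → α
  | [], k => k []
  | a :: l, k => forceInt a fun a' => forceList l fun l' => k (a' :: l')

theorem forceList_eq {α : Sort*} (l : List ℤ) (k : List ℤ → α) : forceList l k = k l := by
  induction l generalizing k with
  | nil => rfl
  | cons a l ih => simp [forceList, forceInt_eq, ih]

theorem getD_shiftStep (a c : ℤ) (l : List ℤ) (k : ℕ) :
    (shiftStep a c l).getD k 0 = (if k = 0 then c else l.getD (k - 1) 0) + a * l.getD k 0 := by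
  induction l generalizing c k with
  | nil => cases k <;> simp [shiftStep]
  | cons r l ih =>
    cases k with
    | zero => simp [shiftStep]
    | succ k =>
      rw [shiftStep, List.getD_cons_succ, ih, List.getD_cons_succ]
      cases k <;> simp

/-- The coefficients of the product of the polynomials `X + a`. -/
def nodalList : List ℤ → List ℤ
  | [] => [1]
  | a :: l => shiftStep a 0 (nodalList l)

open Polynomial in
/-- The product of the polynomials `X + C y`. -/
noncomputable def nodalPoly (ys : List ℝ) : ℝ[X] := (ys.map fun y => X + C y).prod

theorem nodalPoly_coeff_cons (y : ℝ) (ys : List ℝ) (k : ℕ) :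
    (nodalPoly (y :: ys)).coeff k =
      (if k = 0 then 0 else (nodalPoly ys).coeff (k - 1)) + y * (nodalPoly ys).coeff k := by
  rw [nodalPoly, List.map_cons, List.prod_cons, ← nodalPoly, add_mul, Polynomial.coeff_add,
    Polynomial.coeff_C_mul]
  congr 1
  cases k <;> simp

theorem nodalPoly_coeff_nonneg {ys : List ℝ} (h : ∀ y ∈ ys, 0 ≤ y) (k : ℕ) :
    0 ≤ (nodalPoly ys).coeff k := by
  induction ys generalizing k with
  | nil => simp [nodalPoly, Polynomial.coeff_one]; split_ifs <;> norm_num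
  | cons y ys ih =>
    have h1 := ih fun z hz => h z (by simp [hz])
    rw [nodalPoly_coeff_cons]
    have h2 := mul_nonneg (h y (by simp)) (h1 k)
    split_ifs
    · linarith
    · linarith [h1 (k - 1)]

/-- The coefficients of `∏ (X + y)` are polynomials in the `y` with nonnegative coefficients, so
they are monotone in nonnegative `y`. -/
theorem getD_nodalList_le {as : List ℤ} {ys : List ℝ}
    (h : List.Forall₂ (fun (a : ℤ) (y : ℝ) => 0 ≤ a ∧ (a : ℝ) ≤ y) as ys) (k : ℕ) :
    ((nodalList as).getD k 0 : ℝ) ≤ (nodalPoly ys).coeff k := by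
  induction h generalizing k with
  | nil => cases k <;> simp [nodalList, nodalPoly, Polynomial.coeff_one]
  | @cons a y as ys hay has ih =>
    have hys : ∀ z ∈ ys, 0 ≤ z := by
      intro z hz
      obtain ⟨i, hi, rfl⟩ := List.getElem_of_mem hz
      have := has.get (i := i) (by rw [has.length_eq]; exact hi) hi
      simp only [List.get_eq_getElem] at this
      exact le_trans (by exact_mod_cast this.1) this.2
    have ha : (0 : ℝ) ≤ a := by exact_mod_cast hay.1
    have h1 := nodalPoly_coeff_nonneg hys k
    rw [nodalList, getD_shiftStep, nodalPoly_coeff_cons]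
    push_cast
    have h2 : (a : ℝ) * ((nodalList as).getD k 0 : ℤ) ≤ y * (nodalPoly ys).coeff k :=
      (mul_le_mul_of_nonneg_left (ih k) ha).trans (mul_le_mul_of_nonneg_right hay.2 h1)
    refine add_le_add ?_ h2
    split_ifs
    · simp
    · exact ih _

theorem le_getD_nodalList {bs : List ℤ} {ys : List ℝ}
    (h : List.Forall₂ (fun (b : ℤ) (y : ℝ) => 0 ≤ y ∧ y ≤ b) bs ys) (k : ℕ) :
    (nodalPoly ys).coeff k ≤ ((nodalList bs).getD k 0 : ℝ) := by
  induction h generalizing k with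
  | nil => cases k <;> simp [nodalList, nodalPoly, Polynomial.coeff_one]
  | @cons b y bs ys hay has ih =>
    have hys : ∀ z ∈ ys, 0 ≤ z := by
      intro z hz
      obtain ⟨i, hi, rfl⟩ := List.getElem_of_mem hz
      have := has.get (i := i) (by rw [has.length_eq]; exact hi) hi
      simp only [List.get_eq_getElem] at this
      exact this.1
    have hb : (0 : ℝ) ≤ b := hay.1.trans hay.2
    have h1 := nodalPoly_coeff_nonneg hys k
    rw [nodalList, getD_shiftStep, nodalPoly_coeff_cons]
    push_cast
    have h2 : y * (nodalPoly ys).coeff k ≤ (b : ℝ) * ((nodalList bs).getD k 0 : ℤ) :=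
      (mul_le_mul_of_nonneg_right hay.2 h1).trans (mul_le_mul_of_nonneg_left (ih k) hb)
    refine add_le_add ?_ h2
    split_ifs
    · simp
    · exact ih _

open Polynomial in
-- Homogeneity: scaling the roots by `D` multiplies the coefficient of `X ^ i` by a power of `D`,
-- which clears the denominators of the approximate nodes.
theorem nodalPoly_map_mul_comp (D : ℝ) (ys : List ℝ) :
    (nodalPoly (ys.map (D * ·))).comp (C D * X) = C (D ^ ys.length) * nodalPoly ys := by
  induction ys with
  | nil => simp [nodalPoly]
  | cons y ys ih =>
    have h : nodalPoly ((y :: ys).map (D * ·)) =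
        (X + C (D * y)) * nodalPoly (ys.map (D * ·)) := by
      simp [nodalPoly]
    have h' : nodalPoly (y :: ys) = (X + C y) * nodalPoly ys := by simp [nodalPoly]
    rw [h, h', mul_comp, ih, List.length_cons, pow_succ, add_comp, X_comp, C_comp, C_mul, C_mul]
    ring

theorem nodalPoly_map_mul_coeff {D : ℝ} (hD : 0 < D) (ys : List ℝ) {i : ℕ} (hi : i ≤ ys.length) :
    (nodalPoly (ys.map (D * ·))).coeff i = D ^ (ys.length - i) * (nodalPoly ys).coeff i := by
  have h := congrArg (fun p => Polynomial.coeff p i) (nodalPoly_map_mul_comp D ys)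
  simp only [Polynomial.comp_C_mul_X_coeff, Polynomial.coeff_C_mul] at h
  have h1 : D ^ ys.length = D ^ (ys.length - i) * D ^ i := by
    rw [← pow_add, Nat.sub_add_cancel hi]
  rw [h1] at h
  have h0 : D ^ i ≠ 0 := by positivity
  refine mul_right_cancel₀ h0 (h.trans ?_)
  ring

/-- One step of the recursion of the remainders. -/
def remainderStep (E : List ℤ) (top : ℤ) (prev : List ℤ) : List ℤ :=
  List.zipWith (fun e p => e * top - p) E (0 :: prev)

/-- One step of the alternating sums of the remainders. -/
def accumulateStep (f : ℤ) (B T : List ℤ) : List ℤ :=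
  List.zipWith (fun b t => -(f * (b + t))) B T

/-- The recursion of the enclosures `lo`, `hi` of the scaled remainders and `bl`, `bh` of their
alternating sums; the test `check` is applied to the final sums. -/
def encloseLoop (El Eh : List ℤ) (D : ℤ) (check : List ℤ → List ℤ → Bool) :
    ℕ → ℤ → List ℤ → List ℤ → List ℤ → List ℤ → Bool
  | 0, _, _, _, bl, bh => check bl bh
  | fuel + 1, n, lo, hi, bl, bh =>
    decide (0 ≤ lo.getD 15 0) &&
    forceInt (D * ((35 + 2 * n) * (36 + 2 * n))) fun f =>
    forceList (accumulateStep f bh hi) fun bl' =>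
    forceList (accumulateStep f bl lo) fun bh' =>
    forceList (remainderStep El (lo.getD 15 0) hi) fun lo' =>
    forceList (remainderStep Eh (hi.getD 15 0) lo) fun hi' =>
    forceInt (n + 1) fun n' =>
    encloseLoop El Eh D check fuel n' lo' hi' bl' bh'

/-- The list `l` of length `16` lies below the function `x`. -/
def ListBelow (l : List ℤ) (x : ℕ → ℝ) : Prop :=
  l.length = 16 ∧ ∀ i < 16, (l.getD i 0 : ℝ) ≤ x i

/-- The list `l` of length `16` lies above the function `x`. -/
def ListAbove (l : List ℤ) (x : ℕ → ℝ) : Prop :=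
  l.length = 16 ∧ ∀ i < 16, x i ≤ (l.getD i 0 : ℝ)

theorem getD_zipWith {α : Type*} {f : ℤ → ℤ → α} {d : α} {l l' : List ℤ} {i : ℕ}
    (h : i < l.length) (h' : i < l'.length) :
    (List.zipWith f l l').getD i d = f (l.getD i 0) (l'.getD i 0) := by
  rw [List.getD_eq_getElem _ _ (by simp; omega), List.getD_eq_getElem _ _ h,
    List.getD_eq_getElem _ _ h', List.getElem_zipWith]

/-- The remainders scaled by powers of `D`. -/
noncomputable def scaledRemainder (E : ℕ → ℝ) (D : ℝ) (n i : ℕ) : ℝ :=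
  D ^ (n + 15 - i) * remainderCoeff E n i

/-- The alternating sums of remainders scaled by powers of `D`. -/
noncomputable def scaledSum (E : ℕ → ℝ) (D : ℝ) (n i : ℕ) : ℝ :=
  (-1) ^ n * (D ^ (n + 15 - i) * ((34 + 2 * n).factorial : ℝ) *
    ∑ m ∈ Finset.range n, remainderTerm E i m)

/-- The power of `D` is the homogeneous weight of the remainder coefficient, so the recursion
contains `E i` only as `D ^ (16 - i) * E i`, which integers enclose. No rounding is needed in the
loop. -/
theorem scaledRemainder_succ (E : ℕ → ℝ) (D : ℝ) (n : ℕ) {i : ℕ} (hi : i < 16) :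
    scaledRemainder E D (n + 1) i =
      D ^ (16 - i) * E i * scaledRemainder E D n 15 -
        if i = 0 then 0 else scaledRemainder E D n (i - 1) := by
  cases i with
  | zero =>
    simp only [scaledRemainder, remainderCoeff, if_true]
    rw [show n + 1 + 15 - 0 = (16 - 0) + (n + 15 - 15) by omega, pow_add]
    ring
  | succ i =>
    simp only [scaledRemainder, remainderCoeff, Nat.add_sub_cancel, if_neg (Nat.succ_ne_zero i)]
    rw [show n + 15 - i = (16 - (i + 1)) + n by omega,
      show n + 1 + 15 - (i + 1) = (16 - (i + 1)) + n by omega, pow_add]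
    ring

/-- The factor `D ^ (n + 15 - i) * (34 + 2n)!` makes this recursion free of divisions. The sign
`(-1) ^ n` makes the new term enter with the same sign at every step, at the cost of exchanging
lower and upper bounds. -/
theorem scaledSum_succ (E : ℕ → ℝ) (D : ℝ) (n : ℕ) {i : ℕ} (hi : i < 16) :
    scaledSum E D (n + 1) i =
      -(D * ((35 + 2 * n) * (36 + 2 * n)) * (scaledSum E D n i + scaledRemainder E D n i)) := by
  simp only [scaledSum, scaledRemainder]
  rw [Finset.sum_range_succ, remainderTerm, show 34 + 2 * (n + 1) = 34 + 2 * n + 1 + 1 by ring,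
    Nat.factorial_succ, Nat.factorial_succ, show n + 1 + 15 - i = n + 15 - i + 1 by omega]
  have h : ((34 + 2 * n).factorial : ℝ) ≠ 0 := by positivity
  have h2 : (-1 : ℝ) ^ (n * 2) = 1 := by rw [mul_comm, pow_mul]; norm_num
  push_cast
  field_simp
  ring_nf
  rw [h2]
  ring

/-- Multiplying lower bounds requires `0 ≤ top`, which the loop tests at each step. The subtracted
entry is bounded from above, hence the list `hi`. -/
theorem remainderStep_below {El hi : List ℤ} {top : ℤ} {E : ℕ → ℝ} {D : ℝ} {n : ℕ}
    (hEl : ListBelow El fun i => D ^ (16 - i) * E i) (hEl0 : ∀ i < 16, 0 ≤ El.getD i 0)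
    (hhi : ListAbove hi (scaledRemainder E D n)) (h0 : 0 ≤ top)
    (htop : (top : ℝ) ≤ scaledRemainder E D n 15) :
    ListBelow (remainderStep El top hi) (scaledRemainder E D (n + 1)) := by
  refine ⟨by simp [remainderStep, hEl.1, hhi.1], fun i hi' => ?_⟩
  rw [remainderStep, getD_zipWith (by rw [hEl.1]; exact hi') (by simp [hhi.1]; omega),
    scaledRemainder_succ _ _ _ hi']
  have h1 : (0 : ℝ) ≤ El.getD i 0 := by exact_mod_cast hEl0 i hi'
  have h2 : (0 : ℝ) ≤ top := by exact_mod_cast h0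
  have h3 : (El.getD i 0 : ℝ) * top ≤ D ^ (16 - i) * E i * scaledRemainder E D n 15 :=
    mul_le_mul (hEl.2 i hi') htop h2 (h1.trans (hEl.2 i hi'))
  push_cast
  refine sub_le_sub h3 ?_
  cases i with
  | zero => simp
  | succ i => simpa using hhi.2 i (by omega)

theorem remainderStep_above {Eh lo : List ℤ} {top : ℤ} {E : ℕ → ℝ} {D : ℝ} {n : ℕ}
    (hEh : ListAbove Eh fun i => D ^ (16 - i) * E i) (hE : ∀ i < 16, 0 ≤ D ^ (16 - i) * E i)
    (hlo : ListBelow lo (scaledRemainder E D n)) (h0 : 0 ≤ scaledRemainder E D n 15)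
    (htop : scaledRemainder E D n 15 ≤ top) :
    ListAbove (remainderStep Eh top lo) (scaledRemainder E D (n + 1)) := by
  refine ⟨by simp [remainderStep, hEh.1, hlo.1], fun i hi' => ?_⟩
  rw [remainderStep, getD_zipWith (by rw [hEh.1]; exact hi') (by simp [hlo.1]; omega),
    scaledRemainder_succ _ _ _ hi']
  have h3 : D ^ (16 - i) * E i * scaledRemainder E D n 15 ≤ (Eh.getD i 0 : ℝ) * top :=
    mul_le_mul (hEh.2 i hi') htop h0 ((hE i hi').trans (hEh.2 i hi'))
  push_cast
  refine sub_le_sub h3 ?_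
  cases i with
  | zero => simp
  | succ i => simpa using hlo.2 i (by omega)

theorem encloseLoop_sound {El Eh : List ℤ} {D : ℤ} {check : List ℤ → List ℤ → Bool} {E : ℕ → ℝ}
    (hD : 0 < D) (hEl : ListBelow El fun i => (D : ℝ) ^ (16 - i) * E i)
    (hEl0 : ∀ i < 16, 0 ≤ El.getD i 0)
    (hEh : ListAbove Eh fun i => (D : ℝ) ^ (16 - i) * E i) (fuel : ℕ) :
    ∀ (n : ℕ) (lo hi bl bh : List ℤ), ListBelow lo (scaledRemainder E D n) →
      ListAbove hi (scaledRemainder E D n) → ListBelow bl (scaledSum E D n) →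
      ListAbove bh (scaledSum E D n) → encloseLoop El Eh D check fuel n lo hi bl bh = true →
      ∃ bl' bh', ListBelow bl' (scaledSum E D (n + fuel)) ∧
        ListAbove bh' (scaledSum E D (n + fuel)) ∧ check bl' bh' = true := by
  induction fuel with
  | zero => intro n lo hi bl bh _ _ h1 h2 h; exact ⟨bl, bh, h1, h2, h⟩
  | succ fuel ih =>
    intro n lo hi bl bh hlo hhi hbl hbh h
    rw [encloseLoop] at h
    simp only [forceInt_eq, forceList_eq, Bool.and_eq_true, decide_eq_true_eq] at h
    obtain ⟨h0, h⟩ := h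
    have hE : ∀ i < 16, 0 ≤ (D : ℝ) ^ (16 - i) * E i := fun i hi =>
      le_trans (by exact_mod_cast hEl0 i hi) (hEl.2 i hi)
    have hf : (0 : ℝ) ≤ D * ((35 + 2 * n) * (36 + 2 * n)) := by
      have : (0 : ℝ) < D := by exact_mod_cast hD
      positivity
    rw [show n + (fuel + 1) = n + 1 + fuel by ring]
    set f : ℤ := D * ((35 + 2 * n) * (36 + 2 * n)) with hfdef
    have hbl' : ListBelow (accumulateStep f bh hi) (scaledSum E D (n + 1)) := by
      refine ⟨by simp [accumulateStep, hbh.1, hhi.1], fun i hi' => ?_⟩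
      rw [accumulateStep, getD_zipWith (by rw [hbh.1]; exact hi') (by rw [hhi.1]; exact hi'),
        scaledSum_succ _ _ _ hi', hfdef]
      push_cast
      have := mul_le_mul_of_nonneg_left (add_le_add (hbh.2 i hi') (hhi.2 i hi')) hf
      linarith
    have hbh' : ListAbove (accumulateStep f bl lo) (scaledSum E D (n + 1)) := by
      refine ⟨by simp [accumulateStep, hbl.1, hlo.1], fun i hi' => ?_⟩
      rw [accumulateStep, getD_zipWith (by rw [hbl.1]; exact hi') (by rw [hlo.1]; exact hi'),
        scaledSum_succ _ _ _ hi', hfdef]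
      push_cast
      have := mul_le_mul_of_nonneg_left (add_le_add (hbl.2 i hi') (hlo.2 i hi')) hf
      linarith
    exact ih (n + 1) _ _ _ _
      (remainderStep_below hEl hEl0 hhi h0 (hlo.2 15 (by norm_num)))
      (remainderStep_above hEh hE hlo
        (le_trans (by exact_mod_cast h0) (hlo.2 15 (by norm_num))) (hhi.2 15 (by norm_num)))
      hbl' hbh' (by push_cast; exact h)

/-- The first `120` decimals of `τ₁ ^ 2`. -/
def nodeApprox₁ : ℤ :=
  93950641430974574276806385717371440848231191289158234670665949233118119567390273776234879526965238251302039136548564689154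

/-- The first `120` decimals of `τ₂ ^ 2`. -/
def nodeApprox₂ : ℤ :=
  16888381882531336028058562587504141773287035684026566062663432493188789881799928534763313585765865256709410806376415496365

/-- Enclosures of the squares of the nodes `τ₁` and `τ₂`. -/
structure NodeEnclosure (v₁ v₂ : ℝ) : Prop where
  lower₁ : (nodeApprox₁ : ℝ) ≤ 10 ^ 120 * v₁
  upper₁ : 10 ^ 120 * v₁ ≤ nodeApprox₁ + 1
  lower₂ : (nodeApprox₂ : ℝ) ≤ 10 ^ 120 * v₂
  upper₂ : 10 ^ 120 * v₂ ≤ nodeApprox₂ + 1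

theorem NodeEnclosure.nodeBounds {v₁ v₂ : ℝ} (h : NodeEnclosure v₁ v₂) : NodeBounds v₁ v₂ := by
  obtain ⟨a, b, c, d⟩ := h
  norm_num [nodeApprox₁, nodeApprox₂] at a b c d
  constructor <;> linarith

/-- Lower bounds for `10 ^ 70` times the coefficients of the interpolant. -/
def coeffLower : List ℤ :=
  [10000000000000000000000000000000000000000000000000000000000000000000000,
    5000000000000000000000000000000000000000000000000000000000000000000000,
    416666646582900158376853294828361661841810317652808549575434563982415,
    13888884389126678585014158941921285411474008755915459654379086798235,
    248015450193995353970039668256482839423548557364290625853099226616,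
    2755709621310580287230751222439244194876100605391054027805552154,
    20876006593405082977939832946416364539150470645216231777263392,
    114690179051946614101122457089746157782000978052544715011838,
    477664105388278448733506312247111752664051961027910954449,
    1558518816318999603697719345631441271342161883396467000,
    4080101336547538959649217233037743532992023987124599,
    8696830660035184518279346251163618673234420065166,
    15130604180048097849852268467213809173825900736,
    21173824531467864320036999624151488108989838,
    22953340044884790072695053964172914765534,
    17982194603707620022591231627528867468,
    8971465265971031315764450205674381,
    2119474452966077548760753925186]

/-- Upper bounds for `10 ^ 70` times the coefficients of the interpolant. -/
def coeffUpper : List ℤ :=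
  [10000000000000000000000000000000000000000000000000000000000000000000000,
    5000000000000000000000000000000000000000000000000000000000000000000000,
    416666646582900158376859260524416702777047886331605769415975372113220,
    13888884389126678585014160159410276236154669484217255005366952269283,
    248015450193995353970039668504949980408177263635372624904321239978,
    2755709621310580287230751222489951774668881974017805456183352565,
    20876006593405082977939832946426713024822466842895160640197638,
    114690179051946614101122457089748269717852405847989394371622,
    477664105388278448733506312247112183671368578945348644115,
    1558518816318999603697719345631441359302838744195944081,
    4080101336547538959649217233037743550943182530144901,
    8696830660035184518279346251163618676897921808640,
    15130604180048097849852268467213809174573554154,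
    21173824531467864320036999624151488109142421,
    22953340044884790072695053964172914765566,
    17982194603707620022591231627528867469,
    8971465265971031315764450205674382,
    2119474452966077548760753925187]

/-- The common denominator of the approximate nodes. -/
def commonDenom : ℤ := 25 * 10 ^ 120

/-- The scale of the enclosures of the coefficients. -/
def coeffScale : ℤ := 10 ^ 70

theorem cast_commonDenom : (commonDenom : ℝ) = 25 * 10 ^ 120 := by norm_num [commonDenom]

theorem commonDenom_pos : 0 < commonDenom := by decide

theorem cast_coeffScale : (coeffScale : ℝ) = 10 ^ 70 := by norm_num [coeffScale]

/-- The nonzero nodes, with multiplicities, times the common denominator `25 * 10 ^ 120`. -/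
def scaledNodes (n₁ n₂ : ℤ) : List ℤ :=
  List.replicate 2 (25 * n₂) ++ List.replicate 4 (121 * n₂) ++ List.replicate 4 (25 * n₁) ++
    List.replicate 6 (121 * n₁)

/-- The test that the enclosures of the alternating sums yield the enclosures of the coefficients. -/
def checkCoeffs (bl bh : List ℤ) : Bool :=
  (List.range 16).all fun i =>
    forceInt (commonDenom ^ (111 - i) * (226).factorial) fun den =>
    forceInt (2 * (4900 * commonDenom) ^ (111 - i)) fun tail =>
    forceInt ((2 * (i + 2)).factorial) fun fac =>
    decide (fac * (coeffLower.getD (i + 2) 0 * den + coeffScale * tail) ≤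
      coeffScale * ((if i < 15 then den else 0) + fac * bl.getD i 0)) &&
    decide (coeffScale * ((if i < 15 then den else 0) + fac * (bh.getD i 0 + tail)) ≤
      fac * (coeffUpper.getD (i + 2) 0 * den))

/-- The enclosure of the coefficients of the interpolant as a terminating computation. -/
def encloseCoeffs : Bool :=
  forceList ((nodalList (scaledNodes nodeApprox₁ nodeApprox₂)).take 16) fun El =>
  forceList ((nodalList (scaledNodes (nodeApprox₁ + 1) (nodeApprox₂ + 1))).take 16) fun Eh =>
  El.all (fun e => decide (0 ≤ e)) &&
  encloseLoop El Eh commonDenom checkCoeffs 96 0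
    [0, 0, 0, 0, 0, 0, 0, 0, 0, 0, 0, 0, 0, 0, 0, 1]
    [0, 0, 0, 0, 0, 0, 0, 0, 0, 0, 0, 0, 0, 0, 0, 1]
    [0, 0, 0, 0, 0, 0, 0, 0, 0, 0, 0, 0, 0, 0, 0, 0]
    [0, 0, 0, 0, 0, 0, 0, 0, 0, 0, 0, 0, 0, 0, 0, 0]

/-- The series are cut after 96 terms. The widths of the enclosures grow through the recursion; the
120 decimals of the nodes leave more than twenty digits in every coefficient. -/
theorem encloseCoeffs_eq_true : encloseCoeffs = true := by decide +kernel

/-- The nonzero nodes with multiplicities. -/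
noncomputable def nodeList (v₁ v₂ : ℝ) : List ℝ :=
  List.replicate 2 v₂ ++ List.replicate 4 (121 / 25 * v₂) ++ List.replicate 4 v₁ ++
    List.replicate 6 (121 / 25 * v₁)

theorem exampleNodal_eq_nodalPoly (v₁ v₂ : ℝ) :
    exampleNodal v₁ v₂ = nodalPoly (nodeList v₁ v₂) := by
  simp only [exampleNodal, nodalPoly, nodeList, List.map_append, List.map_replicate,
    List.prod_append, List.prod_replicate]

theorem forall₂_scaledNodes_lower {v₁ v₂ : ℝ} (h : NodeEnclosure v₁ v₂) :
    List.Forall₂ (fun (a : ℤ) (y : ℝ) => 0 ≤ a ∧ (a : ℝ) ≤ y)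
      (scaledNodes nodeApprox₁ nodeApprox₂)
      ((nodeList v₁ v₂).map ((commonDenom : ℝ) * ·)) := by
  obtain ⟨a, b, c, d⟩ := h
  have p1 : 0 ≤ nodeApprox₁ := by decide
  have p2 : 0 ≤ nodeApprox₂ := by decide
  have e1 : 0 ≤ 25 * nodeApprox₂ ∧ ((25 * nodeApprox₂ : ℤ) : ℝ) ≤ commonDenom * v₂ :=
    ⟨by positivity, by push_cast; rw [cast_commonDenom]; linarith⟩
  have e2 : 0 ≤ 121 * nodeApprox₂ ∧
      ((121 * nodeApprox₂ : ℤ) : ℝ) ≤ commonDenom * (121 / 25 * v₂) :=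
    ⟨by positivity, by push_cast; rw [cast_commonDenom]; linarith⟩
  have e3 : 0 ≤ 25 * nodeApprox₁ ∧ ((25 * nodeApprox₁ : ℤ) : ℝ) ≤ commonDenom * v₁ :=
    ⟨by positivity, by push_cast; rw [cast_commonDenom]; linarith⟩
  have e4 : 0 ≤ 121 * nodeApprox₁ ∧
      ((121 * nodeApprox₁ : ℤ) : ℝ) ≤ commonDenom * (121 / 25 * v₁) :=
    ⟨by positivity, by push_cast; rw [cast_commonDenom]; linarith⟩
  simp only [scaledNodes, nodeList, List.replicate, List.cons_append, List.nil_append,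
    List.map_cons, List.map_nil, List.forall₂_cons, List.Forall₂.nil, and_true]
  exact ⟨e1, e1, e2, e2, e2, e2, e3, e3, e3, e3, e4, e4, e4, e4, e4, e4⟩

theorem forall₂_scaledNodes_upper {v₁ v₂ : ℝ} (h : NodeEnclosure v₁ v₂) :
    List.Forall₂ (fun (b : ℤ) (y : ℝ) => 0 ≤ y ∧ y ≤ (b : ℝ))
      (scaledNodes (nodeApprox₁ + 1) (nodeApprox₂ + 1))
      ((nodeList v₁ v₂).map ((commonDenom : ℝ) * ·)) := by
  obtain ⟨p1, -, p2, -⟩ := h.nodeBounds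
  obtain ⟨a, b, c, d⟩ := h
  have q1 : 0 ≤ v₁ := by linarith
  have q2 : 0 ≤ v₂ := by linarith
  have q3 : (0 : ℝ) < commonDenom := by exact_mod_cast commonDenom_pos
  have e1 : 0 ≤ commonDenom * v₂ ∧
      commonDenom * v₂ ≤ ((25 * (nodeApprox₂ + 1) : ℤ) : ℝ) :=
    ⟨by positivity, by push_cast; rw [cast_commonDenom]; linarith⟩
  have e2 : 0 ≤ commonDenom * (121 / 25 * v₂) ∧
      commonDenom * (121 / 25 * v₂) ≤ ((121 * (nodeApprox₂ + 1) : ℤ) : ℝ) :=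
    ⟨by positivity, by push_cast; rw [cast_commonDenom]; linarith⟩
  have e3 : 0 ≤ commonDenom * v₁ ∧
      commonDenom * v₁ ≤ ((25 * (nodeApprox₁ + 1) : ℤ) : ℝ) :=
    ⟨by positivity, by push_cast; rw [cast_commonDenom]; linarith⟩
  have e4 : 0 ≤ commonDenom * (121 / 25 * v₁) ∧
      commonDenom * (121 / 25 * v₁) ≤ ((121 * (nodeApprox₁ + 1) : ℤ) : ℝ) :=
    ⟨by positivity, by push_cast; rw [cast_commonDenom]; linarith⟩
  simp only [scaledNodes, nodeList, List.replicate, List.cons_append, List.nil_append,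
    List.map_cons, List.map_nil, List.forall₂_cons, List.Forall₂.nil, and_true]
  exact ⟨e1, e1, e2, e2, e2, e2, e3, e3, e3, e3, e4, e4, e4, e4, e4, e4⟩

theorem scaled_exampleNodal_coeff (v₁ v₂ : ℝ) {i : ℕ} (hi : i < 16) :
    (commonDenom : ℝ) ^ (16 - i) * (exampleNodal v₁ v₂).coeff i =
      (nodalPoly ((nodeList v₁ v₂).map ((commonDenom : ℝ) * ·))).coeff i := by
  have hl : (nodeList v₁ v₂).length = 16 := by simp [nodeList]
  rw [nodalPoly_map_mul_coeff (by exact_mod_cast commonDenom_pos) _ (by omega), hl, exampleNodal_eq_nodalPoly]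

theorem getD_take {l : List ℤ} {n i : ℕ} (h : i < n) : (l.take n).getD i 0 = l.getD i 0 := by
  simp [List.getD_eq_getElem?_getD, h]

theorem length_shiftStep (a c : ℤ) (l : List ℤ) : (shiftStep a c l).length = l.length + 1 := by
  induction l generalizing c with
  | nil => rfl
  | cons r l ih => simp [shiftStep, ih]

theorem length_nodalList (l : List ℤ) : (nodalList l).length = l.length + 1 := by
  induction l with
  | nil => rfl
  | cons a l ih => simp [nodalList, length_shiftStep, ih]

theorem exists_enclosure_scaledSum {v₁ v₂ : ℝ} (h : NodeEnclosure v₁ v₂) :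
    ∃ bl bh, ListBelow bl (scaledSum (exampleNodal v₁ v₂).coeff commonDenom 96) ∧
      ListAbove bh (scaledSum (exampleNodal v₁ v₂).coeff commonDenom 96) ∧
      checkCoeffs bl bh = true := by
  have hc := encloseCoeffs_eq_true
  rw [encloseCoeffs, forceList_eq, forceList_eq, Bool.and_eq_true, List.all_eq_true] at hc
  obtain ⟨h0, hc⟩ := hc
  set El := (nodalList (scaledNodes nodeApprox₁ nodeApprox₂)).take 16 with hEl
  set Eh := (nodalList (scaledNodes (nodeApprox₁ + 1) (nodeApprox₂ + 1))).take 16 with hEh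
  have lEl : El.length = 16 := by simp [hEl, length_nodalList, scaledNodes]
  have lEh : Eh.length = 16 := by simp [hEh, length_nodalList, scaledNodes]
  have hstart : ∀ i < 16,
      ((([0, 0, 0, 0, 0, 0, 0, 0, 0, 0, 0, 0, 0, 0, 0, 1] : List ℤ).getD i 0 : ℤ) : ℝ) =
        scaledRemainder (exampleNodal v₁ v₂).coeff (commonDenom : ℝ) 0 i := by
    intro i hi
    interval_cases i <;> simp [scaledRemainder, remainderCoeff]
  have hstart' : ∀ i < 16,
      ((([0, 0, 0, 0, 0, 0, 0, 0, 0, 0, 0, 0, 0, 0, 0, 0] : List ℤ).getD i 0 : ℤ) : ℝ) =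
        scaledSum (exampleNodal v₁ v₂).coeff (commonDenom : ℝ) 0 i := by
    intro i hi
    interval_cases i <;> simp [scaledSum]
  have key := encloseLoop_sound (E := (exampleNodal v₁ v₂).coeff) (D := commonDenom)
    (El := El) (Eh := Eh) commonDenom_pos
    ⟨lEl, fun i hi => by
      have := getD_nodalList_le (forall₂_scaledNodes_lower h) i
      rw [← scaled_exampleNodal_coeff v₁ v₂ hi] at this
      rw [hEl, getD_take hi]
      exact this⟩
    (fun i hi => by
      rw [List.getD_eq_getElem _ _ (by omega)]
      exact of_decide_eq_true (h0 _ (List.getElem_mem _)))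
    ⟨lEh, fun i hi => by
      have := le_getD_nodalList (forall₂_scaledNodes_upper h) i
      rw [← scaled_exampleNodal_coeff v₁ v₂ hi] at this
      rw [hEh, getD_take hi]
      exact this⟩ 96 0 _ _ _ _
    ⟨rfl, fun i hi => (hstart i hi).le⟩ ⟨rfl, fun i hi => (hstart i hi).ge⟩
    ⟨rfl, fun i hi => (hstart' i hi).le⟩ ⟨rfl, fun i hi => (hstart' i hi).ge⟩ hc
  simpa using key

/-- The enclosed partial sum of 96 terms, the geometric tail bound with `ρ = 4900` and the monomial
kept from the series of `Φ` combine to the tabulated bounds; `checkCoeffs` is this inequality with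
denominators cleared. -/
theorem interpolant_coeff_mem {v₁ v₂ : ℝ} (h : NodeEnclosure v₁ v₂) {k : ℕ} (hk : k < 18) :
    (coeffLower.getD k 0 : ℝ) ≤
        coeffScale * (coshSqrtInterpolant (exampleNodal v₁ v₂)).coeff k ∧
      coeffScale * (coshSqrtInterpolant (exampleNodal v₁ v₂)).coeff k ≤
        (coeffUpper.getD k 0 : ℝ) := by
  rcases Nat.lt_or_ge k 2 with h2 | h2
  · rw [coshSqrtInterpolant_coeff]
    interval_cases k <;> norm_num [coeffLower, coeffUpper, cast_coeffScale]
  obtain ⟨i, rfl⟩ : ∃ i, k = i + 2 := ⟨k - 2, by omega⟩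
  have hi : i < 16 := by omega
  have hb := h.nodeBounds
  obtain ⟨bl, bh, hbl, hbh, hc⟩ := exists_enclosure_scaledSum h
  have hlo := hbl.2 i hi
  have hhi := hbh.2 i hi
  have htail := abs_tsum_remainderTerm_sub_le (N := 96)
    (exampleNodal_coeff_nonneg (by linarith [hb.lower₁]) (by linarith [hb.lower₂]))
    (by norm_num) (sum_exampleNodal_coeff_le hb) (by norm_num) hi
  rw [checkCoeffs, List.all_eq_true] at hc
  have hci := hc i (List.mem_range.2 hi)
  simp only [forceInt_eq, Bool.and_eq_true, decide_eq_true_eq] at hci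
  rw [coshSqrtInterpolant_coeff, if_pos (show 2 ≤ i + 2 ∧ i + 2 < 18 from ⟨h2, hk⟩), Nat.add_sub_cancel]
  rw [scaledSum, show (34 + 2 * 96 : ℕ) = 226 by norm_num, show 96 + 15 - i = 111 - i by omega] at hlo hhi
  rw [show (34 + 2 * 96 : ℕ) = 226 by norm_num, show 96 + (15 - i) = 111 - i by omega, abs_le] at htail
  obtain ⟨c1, c2⟩ := hci
  have c1' := (Int.cast_le (R := ℝ)).2 c1
  have c2' := (Int.cast_le (R := ℝ)).2 c2
  push_cast at c1' c2'
  clear c1 c2 hc hbl hbh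
  set s := ∑' n, remainderTerm (exampleNodal v₁ v₂).coeff i n
  set S := ∑ m ∈ Finset.range 96, remainderTerm (exampleNodal v₁ v₂).coeff i m
  have hF0 : 0 < (226).factorial := Nat.factorial_pos _
  have hfac : (0 : ℝ) < ((2 * (i + 2)).factorial : ℝ) := by positivity
  have hD : (0 : ℝ) < commonDenom := by exact_mod_cast commonDenom_pos
  have hS : (0 : ℝ) < coeffScale := by rw [cast_coeffScale]; positivity
  have hP : (0 : ℝ) < (commonDenom : ℝ) ^ (111 - i) := by positivity
  rw [mul_pow (4900 : ℝ)] at c1' c2'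
  generalize (226).factorial = F at *
  have hF : (0 : ℝ) < F := Nat.cast_pos.2 hF0
  generalize (2 * (i + 2)).factorial = fac at *
  -- The monomial `X ^ (i + 2)` of the series of `Φ` is kept only for `i + 2 ≤ 16`; in degree 17 the
  -- remainder series supplies everything.
  have hδ : (if i + 2 < 17 then 1 / (fac : ℝ) else 0) * fac = if i < 15 then 1 else 0 := by
    by_cases hi15 : i < 15
    · rw [if_pos hi15, if_pos (by omega)]; field_simp
    · rw [if_neg hi15, if_neg (by omega), zero_mul]
  have hδ' : (if i < 15 then (commonDenom : ℝ) ^ (111 - i) * F else 0) =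
      (if i + 2 < 17 then 1 / (fac : ℝ) else 0) * fac * ((commonDenom : ℝ) ^ (111 - i) * F) := by
    rw [hδ]; split_ifs <;> simp
  rw [hδ'] at c1' c2'
  generalize (commonDenom : ℝ) ^ (111 - i) = P at *
  generalize (4900 : ℝ) ^ (111 - i) = T at *
  generalize (if i + 2 < 17 then 1 / (fac : ℝ) else 0) = δ at *
  -- With powers and factorials as positive parameters, the claim is linear in the full sum `s` and
  -- the partial sum `S` once multiplied by this denominator.
  have hpos : (0 : ℝ) < fac * (P * F) := by positivity
  have t1 : -(2 * T * P) ≤ (s - S) * (P * F) := by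
    have := mul_le_mul_of_nonneg_right htail.1 (by positivity : 0 ≤ P * F)
    refine le_trans (le_of_eq ?_) this
    field_simp
  have t2 : (s - S) * (P * F) ≤ 2 * T * P := by
    have := mul_le_mul_of_nonneg_right htail.2 (by positivity : 0 ≤ P * F)
    refine this.trans (le_of_eq ?_)
    field_simp
  rw [Even.neg_one_pow (by decide), one_mul] at hlo hhi
  have hSf : (0 : ℝ) ≤ coeffScale * fac := by positivity
  have m1 := mul_le_mul_of_nonneg_left t1 hSf
  have m2 := mul_le_mul_of_nonneg_left t2 hSf
  have m3 := mul_le_mul_of_nonneg_left hlo hSf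
  have m4 := mul_le_mul_of_nonneg_left hhi hSf
  constructor
  · refine le_of_mul_le_mul_right ?_ hpos
    linarith
  · refine le_of_mul_le_mul_right ?_ hpos
    linarith

/-! ### Location of the squared nodes to 120 decimals -/

/-- Alternating sums of `(α Y₁ ^ m + β Y₂ ^ m) / (D ^ m (2m + r)!)`, scaled to integers. -/
def alternatingSum (α β Y₁ Y₂ D : ℤ) (r : ℕ) : ℕ → ℤ
  | 0 => 0
  | n + 1 => -(D * ((2 * n + 1 + r) * (2 * n + 2 + r)) *
      (alternatingSum α β Y₁ Y₂ D r n + (α * Y₁ ^ n + β * Y₂ ^ n)))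

theorem alternatingSum_eq (α β Y₁ Y₂ : ℤ) {D : ℤ} (hD : 0 < D) (r n : ℕ) :
    (alternatingSum α β Y₁ Y₂ D r n : ℝ) = (-1) ^ n * ((D : ℝ) ^ n * ((2 * n + r).factorial : ℝ)) *
      ∑ m ∈ Finset.range n, (-1) ^ m * (α * ((Y₁ : ℝ) / D) ^ m + β * ((Y₂ : ℝ) / D) ^ m) /
        ((2 * m + r).factorial : ℝ) := by
  have hD' : (D : ℝ) ≠ 0 := by exact_mod_cast hD.ne'
  induction n with
  | zero => simp [alternatingSum]
  | succ n ih =>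
    have h : ((2 * n + r).factorial : ℝ) ≠ 0 := by positivity
    have h2 : (-1 : ℝ) ^ (n * 2) = 1 := by rw [mul_comm, pow_mul]; norm_num
    rw [alternatingSum, Finset.sum_range_succ, show 2 * (n + 1) + r = 2 * n + r + 1 + 1 by ring,
      Nat.factorial_succ, Nat.factorial_succ]
    push_cast
    rw [ih, div_pow, div_pow]
    generalize (∑ m ∈ Finset.range n, (-1 : ℝ) ^ m * (α * ((Y₁ : ℝ) / D) ^ m +
      β * ((Y₂ : ℝ) / D) ^ m) / ((2 * m + r).factorial : ℝ)) = S
    generalize ((2 * n + r).factorial : ℝ) = F at *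
    field_simp
    ring_nf
    rw [h2]
    ring

theorem alternatingSum_zero_eq (α β Y₁ Y₂ : ℤ) {D : ℤ} (hD : 0 < D) (n : ℕ) :
    (alternatingSum α β Y₁ Y₂ D 0 n : ℝ) = (-1) ^ n * ((D : ℝ) ^ n * ((2 * n).factorial : ℝ)) *
      (α * coshSqrtPartial 0 n (Y₁ / D) + β * coshSqrtPartial 0 n (Y₂ / D)) := by
  rw [alternatingSum_eq α β Y₁ Y₂ hD, coshSqrtPartial, coshSqrtPartial,
    Finset.mul_sum _ _ (α : ℝ), Finset.mul_sum _ _ (β : ℝ), ← Finset.sum_add_distrib, add_zero]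
  congr 1
  refine Finset.sum_congr rfl fun m _ => ?_
  rw [add_zero, add_zero, coshSqrtCoeff]
  field_simp

/-- The factor 2 comes from `(m + 1)! / (2m + 2)! = m! / (2 (2m + 1)!)`. -/
theorem alternatingSum_one_eq (α β Y₁ Y₂ : ℤ) {D : ℤ} (hD : 0 < D) (n : ℕ) :
    (alternatingSum α β Y₁ Y₂ D 1 n : ℝ) =
      (-1) ^ n * ((D : ℝ) ^ n * ((2 * n + 1).factorial : ℝ)) *
      (2 * (α * coshSqrtPartial 1 n (Y₁ / D) + β * coshSqrtPartial 1 n (Y₂ / D))) := by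
  rw [alternatingSum_eq α β Y₁ Y₂ hD, coshSqrtPartial, coshSqrtPartial,
    Finset.mul_sum _ _ (α : ℝ), Finset.mul_sum _ _ (β : ℝ), ← Finset.sum_add_distrib, Finset.mul_sum _ _ (2 : ℝ)]
  congr 1
  refine Finset.sum_congr rfl fun m _ => ?_
  have h : coshSqrtCoeff (m + 1) = (m.factorial : ℝ) / (2 * ((2 * m + 1).factorial : ℝ)) := by
    rw [coshSqrtCoeff, show 2 * (m + 1) = 2 * m + 1 + 1 by ring, Nat.factorial_succ m,
      Nat.factorial_succ (2 * m + 1)]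
    push_cast
    field_simp
    ring
  rw [h]
  field_simp

/-- `15` times the overlap of the example state, as a function of `v = τ ^ 2`. -/
noncomputable def overlapFun (v : ℝ) : ℝ :=
  7 + 4 * (coshSqrt 0 (-v) + coshSqrt 0 (-(121 / 25 * v)))

/-- A positive multiple of the derivative of `-overlapFun`. -/
noncomputable def overlapSlope (v : ℝ) : ℝ :=
  25 * coshSqrt 1 (-v) + 121 * coshSqrt 1 (-(121 / 25 * v))

theorem continuous_coshSqrt (k : ℕ) : Continuous (coshSqrt k) :=
  continuous_iff_continuousAt.2 fun x => (hasDerivAt_coshSqrt k x).continuousAt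

theorem continuous_overlapFun : Continuous overlapFun := by
  have := continuous_coshSqrt 0
  unfold overlapFun
  fun_prop

theorem continuous_overlapSlope : Continuous overlapSlope := by
  have := continuous_coshSqrt 1
  unfold overlapSlope
  fun_prop

theorem scaled_node_bounds {N : ℤ} (h0 : 0 ≤ N) (h1 : N ≤ 100 * 10 ^ 120) {v : ℝ}
    (hv : (N : ℝ) = 10 ^ 120 * v) :
    ((25 * N : ℤ) : ℝ) / commonDenom = v ∧ ((121 * N : ℤ) : ℝ) / commonDenom = 121 / 25 * v ∧
      0 ≤ v ∧ v ≤ 510 ∧ 0 ≤ 121 / 25 * v ∧ 121 / 25 * v ≤ 510 := by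
  have e0 : (0 : ℝ) ≤ N := by exact_mod_cast h0
  have e1 : (N : ℝ) ≤ 100 * 10 ^ 120 := by exact_mod_cast h1
  rw [hv] at e0 e1
  have hv0 : 0 ≤ v := nonneg_of_mul_nonneg_right e0 (by positivity)
  have hv1 : v ≤ 100 := by linarith
  refine ⟨?_, ?_, hv0, by linarith, by linarith, by linarith⟩ <;>
  · push_cast
    rw [cast_commonDenom, hv]
    field_simp
    try norm_num

theorem overlapFun_pos {N : ℤ} (h0 : 0 ≤ N) (h1 : N ≤ 100 * 10 ^ 120) {v : ℝ}
    (hv : (N : ℝ) = 10 ^ 120 * v)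
    (hc : 0 < 7 * (commonDenom ^ 120 * (2 * 120).factorial) +
      4 * alternatingSum 1 1 (25 * N) (121 * N) commonDenom 0 120) : 0 < overlapFun v := by
  obtain ⟨e1, e2, a1, a2, a3, a4⟩ := scaled_node_bounds h0 h1 hv
  have hD : (0 : ℝ) < commonDenom := by exact_mod_cast commonDenom_pos
  -- `12 + 2 * 54 = 120` terms bound from below; upper bounds use 121 terms.
  have b1 := (coshSqrtPartial_bounds a1 a2 0 54).1
  have b2 := (coshSqrtPartial_bounds a3 a4 0 54).1
  have hc' := (Int.cast_lt (R := ℝ)).2 hc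
  push_cast [alternatingSum_zero_eq 1 1 _ _ commonDenom_pos] at hc' e1 e2
  rw [e1, e2, Even.neg_one_pow (by decide)] at hc'
  have hK : (0 : ℝ) < (commonDenom : ℝ) ^ 120 * ((2 * 120).factorial : ℝ) :=
    mul_pos (pow_pos hD _) (Nat.cast_pos.2 (Nat.factorial_pos _))
  generalize (commonDenom : ℝ) ^ 120 * ((2 * 120).factorial : ℝ) = K at *
  have h2 : 0 < K * (7 + 4 * (coshSqrtPartial 0 120 v + coshSqrtPartial 0 120 (121 / 25 * v))) := by
    linarith
  have h3 := pos_of_mul_pos_right h2 hK.le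
  norm_num only at b1 b2
  rw [overlapFun]
  linarith

theorem overlapFun_neg {N : ℤ} (h0 : 0 ≤ N) (h1 : N ≤ 100 * 10 ^ 120) {v : ℝ}
    (hv : (N : ℝ) = 10 ^ 120 * v)
    (hc : 7 * (commonDenom ^ 121 * (2 * 121).factorial) <
      4 * alternatingSum 1 1 (25 * N) (121 * N) commonDenom 0 121) : overlapFun v < 0 := by
  obtain ⟨e1, e2, a1, a2, a3, a4⟩ := scaled_node_bounds h0 h1 hv
  have hD : (0 : ℝ) < commonDenom := by exact_mod_cast commonDenom_pos
  have b1 := (coshSqrtPartial_bounds a1 a2 0 54).2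
  have b2 := (coshSqrtPartial_bounds a3 a4 0 54).2
  have hc' := (Int.cast_lt (R := ℝ)).2 hc
  push_cast [alternatingSum_zero_eq 1 1 _ _ commonDenom_pos] at hc' e1 e2
  rw [e1, e2, Odd.neg_one_pow (by decide)] at hc'
  have hK : (0 : ℝ) < (commonDenom : ℝ) ^ 121 * ((2 * 121).factorial : ℝ) :=
    mul_pos (pow_pos hD _) (Nat.cast_pos.2 (Nat.factorial_pos _))
  generalize (commonDenom : ℝ) ^ 121 * ((2 * 121).factorial : ℝ) = K at *
  have h2 : 0 < K * -(7 + 4 * (coshSqrtPartial 0 121 v + coshSqrtPartial 0 121 (121 / 25 * v))) := by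
    linarith
  have h3 := pos_of_mul_pos_right h2 hK.le
  norm_num only at b1 b2
  rw [overlapFun]
  linarith

theorem overlapSlope_pos {N : ℤ} (h0 : 0 ≤ N) (h1 : N ≤ 100 * 10 ^ 120) {v : ℝ}
    (hv : (N : ℝ) = 10 ^ 120 * v)
    (hc : 0 < alternatingSum 25 121 (25 * N) (121 * N) commonDenom 1 120) :
    0 < overlapSlope v := by
  obtain ⟨e1, e2, a1, a2, a3, a4⟩ := scaled_node_bounds h0 h1 hv
  have hD : (0 : ℝ) < commonDenom := by exact_mod_cast commonDenom_pos
  have b1 := (coshSqrtPartial_bounds a1 a2 1 54).1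
  have b2 := (coshSqrtPartial_bounds a3 a4 1 54).1
  have hc' := (Int.cast_lt (R := ℝ)).2 hc
  push_cast [alternatingSum_one_eq 25 121 _ _ commonDenom_pos] at hc' e1 e2
  rw [e1, e2, Even.neg_one_pow (by decide)] at hc'
  have hK : (0 : ℝ) < (commonDenom : ℝ) ^ 120 * ((2 * 120 + 1).factorial : ℝ) :=
    mul_pos (pow_pos hD _) (Nat.cast_pos.2 (Nat.factorial_pos _))
  generalize (commonDenom : ℝ) ^ 120 * ((2 * 120 + 1).factorial : ℝ) = K at *
  rw [one_mul] at hc'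
  have h3 := pos_of_mul_pos_right hc' hK.le
  norm_num only at b1 b2
  rw [overlapSlope]
  linarith

theorem overlapSlope_neg {N : ℤ} (h0 : 0 ≤ N) (h1 : N ≤ 100 * 10 ^ 120) {v : ℝ}
    (hv : (N : ℝ) = 10 ^ 120 * v)
    (hc : 0 < alternatingSum 25 121 (25 * N) (121 * N) commonDenom 1 121) :
    overlapSlope v < 0 := by
  obtain ⟨e1, e2, a1, a2, a3, a4⟩ := scaled_node_bounds h0 h1 hv
  have hD : (0 : ℝ) < commonDenom := by exact_mod_cast commonDenom_pos
  have b1 := (coshSqrtPartial_bounds a1 a2 1 54).2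
  have b2 := (coshSqrtPartial_bounds a3 a4 1 54).2
  have hc' := (Int.cast_lt (R := ℝ)).2 hc
  push_cast [alternatingSum_one_eq 25 121 _ _ commonDenom_pos] at hc' e1 e2
  rw [e1, e2, Odd.neg_one_pow (by decide)] at hc'
  have hK : (0 : ℝ) < (commonDenom : ℝ) ^ 121 * ((2 * 121 + 1).factorial : ℝ) :=
    mul_pos (pow_pos hD _) (Nat.cast_pos.2 (Nat.factorial_pos _))
  generalize (commonDenom : ℝ) ^ 121 * ((2 * 121 + 1).factorial : ℝ) = K at *
  have h2 : 0 < K * -(2 * (25 * coshSqrtPartial 1 121 v +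
      121 * coshSqrtPartial 1 121 (121 / 25 * v))) := by
    linarith
  have h3 := pos_of_mul_pos_right h2 hK.le
  norm_num only at b1 b2
  rw [overlapSlope]
  linarith

/-- The overlap, and likewise its slope, changes sign between consecutive multiples of `10 ^
(-120)`; the intermediate value theorem gives the zeros. -/
theorem exists_nodes : ∃ v₁ v₂ : ℝ, NodeEnclosure v₁ v₂ ∧ overlapFun v₁ = 0 ∧
    overlapSlope v₂ = 0 := by
  have e : ∀ n : ℤ, (n : ℝ) = 10 ^ 120 * (n / 10 ^ 120) := fun n => by field_simp
  have e' : ∀ n : ℤ, ((n + 1 : ℤ) : ℝ) = 10 ^ 120 * (((n : ℝ) + 1) / 10 ^ 120) := fun n => by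
    push_cast; field_simp
  have p1 := overlapFun_pos (N := nodeApprox₁) (by decide) (by decide) (e _) (by decide +kernel)
  have p2 := overlapFun_neg (N := nodeApprox₁ + 1) (by decide) (by decide) (e' _)
    (by decide +kernel)
  have p3 := overlapSlope_pos (N := nodeApprox₂) (by decide) (by decide) (e _) (by decide +kernel)
  have p4 := overlapSlope_neg (N := nodeApprox₂ + 1) (by decide) (by decide) (e' _)
    (by decide +kernel)
  have hle : ∀ n : ℤ, (n : ℝ) / 10 ^ 120 ≤ ((n : ℝ) + 1) / 10 ^ 120 := fun n => by
    gcongr; linarith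
  obtain ⟨v₁, h₁, h₁'⟩ := intermediate_value_Icc' (hle nodeApprox₁)
    continuous_overlapFun.continuousOn ⟨p2.le, p1.le⟩
  obtain ⟨v₂, h₂, h₂'⟩ := intermediate_value_Icc' (hle nodeApprox₂)
    continuous_overlapSlope.continuousOn ⟨p4.le, p3.le⟩
  have hp : (0 : ℝ) < 10 ^ 120 := by positivity
  refine ⟨v₁, v₂, ⟨?_, ?_, ?_, ?_⟩, h₁', h₂'⟩
  · rw [mul_comm]; exact (div_le_iff₀ hp).1 h₁.1
  · rw [mul_comm]; exact (le_div_iff₀ hp).1 h₁.2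
  · rw [mul_comm]; exact (div_le_iff₀ hp).1 h₂.1
  · rw [mul_comm]; exact (le_div_iff₀ hp).1 h₂.2

/-! ### Signs of the bound as a polynomial in `w = 1000 τ²` -/

open Polynomial in
/-- The bound on the root fidelity for the moments of the example, as a polynomial in
`w = 1000 τ ^ 2`. -/
noncomputable def boundPoly (P : ℝ[X]) : ℝ[X] :=
  C (7 / 15) + ∑ k ∈ Finset.range 18,
    C ((-1) ^ k * P.coeff k * (4 * (1 + (121 / 25) ^ k) / 15) / 1000 ^ k) * X ^ k

theorem boundPoly_coeff (P : Polynomial ℝ) (k : ℕ) :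
    (boundPoly P).coeff k = (if k = 0 then 7 / 15 else 0) +
      if k < 18 then (-1) ^ k * P.coeff k * (4 * (1 + (121 / 25) ^ k) / 15) / 1000 ^ k else 0 := by
  rw [boundPoly, Polynomial.coeff_add, Polynomial.coeff_C, Polynomial.finsetSum_coeff]
  simp only [Polynomial.coeff_C_mul, Polynomial.coeff_X_pow, mul_ite, mul_one, mul_zero]
  rw [Finset.sum_ite_eq]
  simp

/-- The coefficients of the list `l`, with alternating signs and the entries of `l'` as the odd
ones, transformed as in `boundPoly` and scaled to integers. -/
def boundList (l l' : List ℤ) : List ℤ :=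
  (List.range 18).map fun k =>
    (if k % 2 = 0 then l.getD k 0 else -l'.getD k 0) *
      (4 * (25 ^ k + 121 ^ k) * 25 ^ (17 - k) * 1000 ^ (17 - k)) +
      if k = 0 then 7 * 25 ^ 17 * 1000 ^ 17 * coeffScale else 0

/-- The scale of `boundList`. -/
def boundScale : ℤ := 15 * 25 ^ 17 * 1000 ^ 17 * coeffScale

/-- The scaled coefficients of `q` lie above the entries of `l`. -/
def CoeffsAbove (K : ℝ) (q : Polynomial ℝ) (l : List ℤ) : Prop :=
  ∀ k, (l.getD k 0 : ℝ) ≤ K * q.coeff k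

theorem getD_map_range (f : ℕ → ℤ) (n k : ℕ) :
    ((List.range n).map f).getD k 0 = if k < n then f k else 0 := by
  split_ifs with h
  · rw [List.getD_eq_getElem _ _ (by simpa using h), List.getElem_map, List.getElem_range]
  · rw [List.getD_eq_default _ _ (by simpa using h)]

/-- Denominators are cleared: `15` from the weights, `25 ^ 17` from the powers of `121 / 25`, and
`1000 ^ 17` from the variable `w`. -/
theorem boundScale_mul_coeff (P : Polynomial ℝ) {k : ℕ} (hk : k < 18) :
    (boundScale : ℝ) * (boundPoly P).coeff k =
      (-1) ^ k * (coeffScale * P.coeff k) *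
        (4 * (25 ^ k + 121 ^ k) * 25 ^ (17 - k) * 1000 ^ (17 - k)) +
      (if k = 0 then 7 * 25 ^ 17 * 1000 ^ 17 * (coeffScale : ℝ) else 0 : ℝ) := by
  rw [boundPoly_coeff, if_pos hk, boundScale, mul_add]
  simp only [Int.cast_mul, Int.cast_pow, Int.cast_ofNat]
  have h1 : (25 : ℝ) ^ 17 = 25 ^ (17 - k) * 25 ^ k := by rw [← pow_add]; congr 1; omega
  have h2 : (1000 : ℝ) ^ 17 = 1000 ^ (17 - k) * 1000 ^ k := by rw [← pow_add]; congr 1; omega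
  have h3 : (15 * 25 ^ 17 * 1000 ^ 17 * coeffScale : ℝ) *
      ((-1) ^ k * P.coeff k * (4 * (1 + (121 / 25) ^ k) / 15) / 1000 ^ k) =
      (-1) ^ k * (coeffScale * P.coeff k) *
        (4 * (25 ^ k + 121 ^ k) * 25 ^ (17 - k) * 1000 ^ (17 - k)) := by
    rw [h1, h2, div_pow]
    field_simp
  rw [h3, add_comm]
  congr 1
  split_ifs
  · ring
  · ring

theorem coeffsAbove_boundList {P : Polynomial ℝ} {l l' : List ℤ}
    (h : ∀ k < 18, (l.getD k 0 : ℝ) ≤ coeffScale * P.coeff k)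
    (h' : ∀ k < 18, coeffScale * P.coeff k ≤ (l'.getD k 0 : ℝ)) :
    CoeffsAbove boundScale (boundPoly P) (boundList l l') := by
  intro k
  rw [boundList, getD_map_range]
  by_cases hk : k < 18
  · rw [if_pos hk, boundScale_mul_coeff P hk]
    push_cast
    have hpos : (0 : ℝ) ≤ 4 * (25 ^ k + 121 ^ k) * 25 ^ (17 - k) * 1000 ^ (17 - k) := by positivity
    refine add_le_add (mul_le_mul_of_nonneg_right ?_ hpos) (le_of_eq (by split_ifs <;> norm_num))
    rcases Nat.mod_two_eq_zero_or_one k with h2 | h2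
    · rw [if_pos h2, Even.neg_one_pow (Nat.even_iff.2 h2), one_mul]
      exact h k hk
    · rw [if_neg (by omega), Odd.neg_one_pow (Nat.odd_iff.2 h2), neg_one_mul]
      exact neg_le_neg (h' k hk)
  · rw [if_neg hk, boundPoly_coeff, if_neg hk, if_neg (by omega)]
    simp

theorem coeffsAbove_neg_boundList {P : Polynomial ℝ} {l l' : List ℤ}
    (h : ∀ k < 18, (l.getD k 0 : ℝ) ≤ coeffScale * P.coeff k)
    (h' : ∀ k < 18, coeffScale * P.coeff k ≤ (l'.getD k 0 : ℝ)) :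
    CoeffsAbove boundScale (-boundPoly P) ((boundList l' l).map Neg.neg) := by
  intro k
  rw [boundList, List.map_map, getD_map_range, Polynomial.coeff_neg, mul_neg]
  by_cases hk : k < 18
  · rw [if_pos hk, boundScale_mul_coeff P hk, Function.comp_apply]
    push_cast
    have hpos : (0 : ℝ) ≤ 4 * (25 ^ k + 121 ^ k) * 25 ^ (17 - k) * 1000 ^ (17 - k) := by positivity
    refine neg_le_neg
      (add_le_add (mul_le_mul_of_nonneg_right ?_ hpos) (le_of_eq (by split_ifs <;> norm_num)))
    rcases Nat.mod_two_eq_zero_or_one k with h2 | h2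
    · rw [if_pos h2, Even.neg_one_pow (Nat.even_iff.2 h2), one_mul]
      exact h' k hk
    · rw [if_neg (by omega), Odd.neg_one_pow (Nat.odd_iff.2 h2), neg_one_mul]
      exact neg_le_neg (h k hk)
  · rw [if_neg hk, boundPoly_coeff, if_neg hk, if_neg (by omega)]
    simp

/-- The coefficients of the derivative. -/
def derivList (l : List ℤ) : List ℤ :=
  (List.range (l.length - 1)).map fun k : ℕ => ((k : ℤ) + 1) * l.getD (k + 1) 0

theorem CoeffsAbove.derivative {K : ℝ} {q : Polynomial ℝ} {l : List ℤ} (h : CoeffsAbove K q l) :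
    CoeffsAbove K (Polynomial.derivative q) (derivList l) := by
  intro k
  have h1 : (derivList l).getD k 0 = ((k : ℤ) + 1) * l.getD (k + 1) 0 := by
    rw [derivList, getD_map_range]
    split_ifs with hk
    · rfl
    · rw [List.getD_eq_default _ _ (by omega), mul_zero]
  rw [h1, Polynomial.coeff_derivative]
  push_cast
  have := mul_le_mul_of_nonneg_right (h (k + 1)) (by positivity : (0 : ℝ) ≤ (k : ℝ) + 1)
  linarith

/-- The coefficients after subtraction of the constant `c`. -/
def subConstList (c : ℤ) : List ℤ → List ℤ
  | [] => [-c]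
  | a :: l => (a - c) :: l

open Polynomial in
theorem CoeffsAbove.sub_const {K : ℝ} {q : ℝ[X]} {l : List ℤ} (h : CoeffsAbove K q l) {c : ℤ}
    {x : ℝ} (hc : K * x = c) : CoeffsAbove K (q - C x) (subConstList c l) := by
  intro k
  have hk := h k
  rw [coeff_sub, coeff_C, mul_sub]
  cases l with
  | nil => cases k <;> simp [subConstList] at hk ⊢ <;> linarith
  | cons a l => cases k <;> simp [subConstList] at hk ⊢ <;> linarith

theorem CoeffsAbove.eval_pos {K : ℝ} {q : Polynomial ℝ} {l : List ℤ} (h : CoeffsAbove K q l)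
    (hK : 0 < K) {a b : ℤ} {t : List ℤ} (ha : 0 ≤ a) (hp : isPosOn l a (b :: t) = true) {x : ℝ}
    (h0 : (a : ℝ) ≤ x) (h1 : x ≤ ((b :: t).getLast (List.cons_ne_nil _ _) : ℤ)) :
    0 < q.eval x := by
  have h2 := hornerEval_pos_of_isPosOn hp h0 h1
  have h3 := hornerEval_le_eval h (x := x) (le_trans (by exact_mod_cast ha) h0)
  exact pos_of_mul_pos_right (h2.trans_le h3) hK.le

/-- The polynomial with coefficients `l` has a Taylor expansion at `a` with constant term at least
`c` and no negative coefficient of higher order. -/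
def isAboveFrom (l : List ℤ) (a c : ℤ) : Bool :=
  match taylorShift a l with
  | [] => false
  | b :: t => decide (c ≤ b) && t.all fun x => decide (0 ≤ x)

/-- A Taylor expansion at `a` whose higher coefficients are nonnegative is smallest on `[a, ∞)` at
`a`; this settles unbounded intervals. -/
theorem le_hornerEval_of_isAboveFrom {l : List ℤ} {a c : ℤ} (h : isAboveFrom l a c = true)
    {x : ℝ} (hx : (a : ℝ) ≤ x) : (c : ℝ) ≤ hornerEval l x := by
  have h1 := hornerEval_taylorShift a l (x - a)
  rw [sub_add_cancel] at h1
  rw [← h1]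
  unfold isAboveFrom at h
  split at h
  · simp at h
  · next b t ht =>
    rw [ht]
    simp only [Bool.and_eq_true, decide_eq_true_eq, List.all_eq_true] at h
    have h2 : 0 ≤ hornerEval t (x - a) := by
      have h3 := h.2
      clear ht h1 h
      induction t with
      | nil => simp
      | cons d t ih =>
        rw [hornerEval_cons]
        have h4 : (0 : ℝ) ≤ d := by exact_mod_cast h3 d (by simp)
        have := ih fun y hy => h3 y (by simp [hy])
        have := mul_nonneg (sub_nonneg.2 hx) this
        linarith
    rw [hornerEval_cons]
    have h4 : (c : ℝ) ≤ b := by exact_mod_cast h.1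
    have := mul_nonneg (sub_nonneg.2 hx) h2
    linarith

theorem CoeffsAbove.le_eval_of_isAboveFrom {K : ℝ} {q : Polynomial ℝ} {l : List ℤ}
    (h : CoeffsAbove K q l) {a c : ℤ} (ha : 0 ≤ a) (hl : isAboveFrom l a c = true) {x : ℝ}
    (hx : (a : ℝ) ≤ x) : (c : ℝ) ≤ K * q.eval x :=
  (le_hornerEval_of_isAboveFrom hl hx).trans
    (hornerEval_le_eval h (le_trans (by exact_mod_cast ha) hx))

/-- The scaled lower bounds for the coefficients of `boundPoly`. -/
def boundLower : List ℤ := boundList coeffLower coeffUpper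

/-- The scaled lower bounds for the coefficients of `-boundPoly`. -/
def negBoundLower : List ℤ := (boundList coeffUpper coeffLower).map Neg.neg

theorem boundScale_pos : (0 : ℝ) < boundScale := by
  have : 0 < boundScale := by decide
  exact_mod_cast this

/-- The sign properties of the bound as a function of `w = 1000 τ ^ 2`. -/
structure BoundSigns (q : Polynomial ℝ) : Prop where
  initial : ∀ w, 0 ≤ w → w ≤ 16000 → 0.0683 < q.eval w
  convex : ∀ w, 16000 ≤ w → w ≤ 18500 → 0 < q.derivative.derivative.eval w
  middle : ∀ w, 18500 ≤ w → w ≤ 88360 → 0.0683 < q.eval w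
  decreasing₁ : ∀ w, 88360 ≤ w → w ≤ 97000 → q.derivative.eval w < 0
  negative : ∀ w, 97000 ≤ w → w ≤ 102010 → q.eval w < 0
  increasing : ∀ w, 102010 ≤ w → w ≤ 103200 → 0 < q.derivative.eval w
  positive : ∀ w, 103200 ≤ w → w ≤ 104200 → 0 < q.eval w
  decreasing₂ : ∀ w, 104200 ≤ w → w ≤ 106090 → q.derivative.eval w < 0
  small : ∀ w, 102010 ≤ w → w ≤ 106090 → q.eval w < 0.06
  final : ∀ w, 106090 ≤ w → q.eval w < 0
  touch_lower : ∀ w, 16888 ≤ w → w ≤ 16889 → 0.068201 < q.eval w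
  touch_upper : ∀ w, 16888 ≤ w → w ≤ 16889 → q.eval w < 0.068202
  value₁ : 0.068202 < q.eval 90610
  value₂ : q.eval 90620 < 0.068201
  value₃ : q.eval 102790 < 0
  value₄ : 0 < q.eval 102800
  value₅ : 0 < q.eval 104992
  value₆ : q.eval 105000 < 0

open Polynomial in
theorem boundSigns {P : ℝ[X]}
    (h : ∀ k < 18, (coeffLower.getD k 0 : ℝ) ≤ coeffScale * P.coeff k)
    (h' : ∀ k < 18, coeffScale * P.coeff k ≤ (coeffUpper.getD k 0 : ℝ)) :
    BoundSigns (boundPoly P) := by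
  have hl : CoeffsAbove boundScale (boundPoly P) boundLower := coeffsAbove_boundList h h'
  have hu : CoeffsAbove boundScale (-boundPoly P) negBoundLower := coeffsAbove_neg_boundList h h'
  have hK := boundScale_pos
  have hud := hu.derivative
  -- `boundScale` is divisible by `10 ^ 6`, so thresholds with six decimals become integers after
  -- scaling.
  have hc : ∀ n : ℤ, (boundScale : ℝ) * (n / 1000000) = ((boundScale / 1000000 * n : ℤ) : ℝ) := by
    intro n
    have : boundScale = boundScale / 1000000 * 1000000 := by decide +kernel
    have h2 : (boundScale : ℝ) = ((boundScale / 1000000 : ℤ) : ℝ) * 1000000 := by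
      exact_mod_cast this
    push_cast
    rw [h2]
    field_simp
  have hneg : -boundPoly P - C (-68202 / 1000000 : ℝ) = -(boundPoly P - C (0.068202)) := by
    rw [show (-68202 / 1000000 : ℝ) = -0.068202 by norm_num, C_neg]; ring
  constructor
  · intro w h0 h1
    -- The touching value lies between `0.068201` and `0.068202`. The threshold `0.0683` leaves a
    -- margin; near `w₂ ≈ 16888.4`, where `R` comes closer to that value, convexity is used instead.
    have := (hl.sub_const (hc 68300)).eval_pos hK (a := 0) (b := 1160)
      (t := [2241, 4770, 9603, 13529, 15276, 16000]) (by norm_num) (by decide +kernel) (x := w)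
      (by simpa using h0) (by simpa using h1)
    rw [eval_sub, eval_C] at this
    norm_num at this ⊢
    linarith
  · intro w h0 h1
    exact hl.derivative.derivative.eval_pos hK (a := 16000) (b := 18500) (t := []) (by norm_num)
      (by decide +kernel) (by simpa using h0) (by simpa using h1)
  · intro w h0 h1
    have := (hl.sub_const (hc 68300)).eval_pos hK (a := 18500) (b := 31783)
      (t := [45436, 56034, 76012, 87238, 88360]) (by norm_num) (by decide +kernel) (x := w)
      (by simpa using h0) (by simpa using h1)
    rw [eval_sub, eval_C] at this
    norm_num at this ⊢
    linarith
  · intro w h0 h1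
    have := hud.eval_pos hK (a := 88360) (b := 96650) (t := [97000]) (by norm_num)
      (by decide +kernel) (x := w) (by simpa using h0) (by simpa using h1)
    rw [derivative_neg, eval_neg] at this
    linarith
  · intro w h0 h1
    have := hu.eval_pos hK (a := 97000) (b := 102010) (t := []) (by norm_num)
      (by decide +kernel) (x := w) (by simpa using h0) (by simpa using h1)
    rw [eval_neg] at this
    linarith
  · intro w h0 h1
    exact hl.derivative.eval_pos hK (a := 102010) (b := 103200) (t := []) (by norm_num)
      (by decide +kernel) (by simpa using h0) (by simpa using h1)
  · intro w h0 h1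
    exact hl.eval_pos hK (a := 103200) (b := 104200) (t := []) (by norm_num)
      (by decide +kernel) (by simpa using h0) (by simpa using h1)
  · intro w h0 h1
    have := hud.eval_pos hK (a := 104200) (b := 106090) (t := []) (by norm_num)
      (by decide +kernel) (x := w) (by simpa using h0) (by simpa using h1)
    rw [derivative_neg, eval_neg] at this
    linarith
  · intro w h0 h1
    have := (hu.sub_const (hc (-60000))).eval_pos hK (a := 102010) (b := 106090) (t := [])
      (by norm_num) (by decide +kernel) (x := w) (by simpa using h0) (by simpa using h1)
    rw [eval_sub, eval_C, eval_neg] at this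
    norm_num at this ⊢
    linarith
  · intro w h0
    have h2 := hu.le_eval_of_isAboveFrom (a := 106090) (c := 1) (by norm_num)
      (by decide +kernel) (x := w) (by simpa using h0)
    rw [eval_neg] at h2
    push_cast at h2
    by_contra! h3
    have := mul_nonneg hK.le h3
    linarith
  · intro w h0 h1
    have := (hl.sub_const (hc 68201)).eval_pos hK (a := 16888) (b := 16889) (t := [])
      (by norm_num) (by decide +kernel) (x := w) (by simpa using h0) (by simpa using h1)
    rw [eval_sub, eval_C] at this
    norm_num at this ⊢
    linarith
  · intro w h0 h1
    have := (hu.sub_const (hc (-68202))).eval_pos hK (a := 16888) (b := 16889) (t := [])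
      (by norm_num) (by decide +kernel) (x := w) (by simpa using h0) (by simpa using h1)
    rw [eval_sub, eval_C, eval_neg] at this
    norm_num at this ⊢
    linarith
  · have := (hl.sub_const (hc 68202)).eval_pos hK (a := 90610) (b := 90610) (t := [])
      (by norm_num) (by decide +kernel) (x := 90610) (by simp) (by simp)
    rw [eval_sub, eval_C] at this
    norm_num at this ⊢
    linarith
  · have := (hu.sub_const (hc (-68201))).eval_pos hK (a := 90620) (b := 90620) (t := [])
      (by norm_num) (by decide +kernel) (x := 90620) (by simp) (by simp)
    rw [eval_sub, eval_C, eval_neg] at this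
    norm_num at this ⊢
    linarith
  · have := hu.eval_pos hK (a := 102790) (b := 102790) (t := [])
      (by norm_num) (by decide +kernel) (x := 102790) (by simp) (by simp)
    rw [eval_neg] at this
    linarith
  · exact hl.eval_pos hK (a := 102800) (b := 102800) (t := [])
      (by norm_num) (by decide +kernel) (x := 102800) (by simp) (by simp)
  · exact hl.eval_pos hK (a := 104992) (b := 104992) (t := [])
      (by norm_num) (by decide +kernel) (x := 104992) (by simp) (by simp)
  · have := hu.eval_pos hK (a := 105000) (b := 105000) (t := [])
      (by norm_num) (by decide +kernel) (x := 105000) (by simp) (by simp)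
    rw [eval_neg] at this
    linarith

/-! ### The inequality `p ≤ cos` on the whole line, and the decimal coefficients -/

/-- The scaled lower bounds for the coefficients of `-P(-X)`, where `P` is the interpolant. -/
def negInterpolantLower : List ℤ :=
  (List.range 18).map fun k : ℕ => if k % 2 = 0 then -coeffUpper.getD k 0 else coeffLower.getD k 0

theorem cast_coeffScale_pos : (0 : ℝ) < coeffScale := by rw [cast_coeffScale]; positivity

theorem coeffsAbove_negInterpolantLower {v₁ v₂ : ℝ} (h : NodeEnclosure v₁ v₂) :
    CoeffsAbove coeffScale
      (-(coshSqrtInterpolant (exampleNodal v₁ v₂)).comp (Polynomial.C (-1) * Polynomial.X)) negInterpolantLower := by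
  intro k
  rw [negInterpolantLower, getD_map_range, Polynomial.coeff_neg,
    Polynomial.comp_C_mul_X_coeff]
  by_cases hk : k < 18
  · obtain ⟨h1, h2⟩ := interpolant_coeff_mem h hk
    rw [if_pos hk]
    rcases Nat.mod_two_eq_zero_or_one k with h3 | h3
    · rw [if_pos h3, Even.neg_one_pow (Nat.even_iff.2 h3)]
      push_cast
      linarith
    · rw [if_neg (by omega), Odd.neg_one_pow (Nat.odd_iff.2 h3)]
      linarith
  · rw [if_neg hk, Polynomial.coeff_eq_zero_of_natDegree_lt
      (lt_of_le_of_lt (natDegree_coshSqrtInterpolant_le _) (by omega))]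
    simp

/-- As a polynomial in `x²`, `-p` has a Taylor expansion at `506` with constant term at least 1 and
no negative higher coefficient. -/
theorem examplePoly_le_neg_one {v₁ v₂ x : ℝ} (h : NodeEnclosure v₁ v₂) (hx : 506 ≤ x ^ 2) :
    (examplePoly v₁ v₂).eval x ≤ -1 := by
  have h1 := (coeffsAbove_negInterpolantLower h).le_eval_of_isAboveFrom (a := 506)
    (c := coeffScale) (by norm_num) (by decide +kernel) (x := x ^ 2) (by simpa using hx)
  rw [Polynomial.eval_neg, Polynomial.eval_comp, Polynomial.eval_C_mul, Polynomial.eval_X,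
    neg_one_mul] at h1
  rw [examplePoly, eval_compNegSq (natDegree_coshSqrtInterpolant_le _)]
  have h2 := cast_coeffScale_pos
  by_contra! h3
  have := mul_pos h2 (by linarith : 0 < (coshSqrtInterpolant (exampleNodal v₁ v₂)).eval (-x ^ 2) + 1)
  linarith

theorem examplePoly_le_cos {v₁ v₂ : ℝ} (h : NodeEnclosure v₁ v₂) (x : ℝ) :
    (examplePoly v₁ v₂).eval x ≤ Real.cos x := by
  rcases le_total (x ^ 2) 507 with hx | hx
  · exact examplePoly_le_cos_of_sq_le h.nodeBounds hx
  · exact (examplePoly_le_neg_one h (by linarith)).trans (Real.neg_one_le_cos x)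

theorem examplePoly_coeff_mem {v₁ v₂ : ℝ} (h : NodeEnclosure v₁ v₂) {k : ℕ} (hk : k < 18) :
    (coeffLower.getD k 0 : ℝ) / 10 ^ 70 ≤ (-1) ^ k * (examplePoly v₁ v₂).coeff (2 * k) ∧
      (-1) ^ k * (examplePoly v₁ v₂).coeff (2 * k) ≤ (coeffUpper.getD k 0 : ℝ) / 10 ^ 70 := by
  obtain ⟨h1, h2⟩ := interpolant_coeff_mem h hk
  have h3 : (-1 : ℝ) ^ k * (examplePoly v₁ v₂).coeff (2 * k) =
      (coshSqrtInterpolant (exampleNodal v₁ v₂)).coeff k := by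
    rw [examplePoly, compNegSq_coeff_even _ hk, ← mul_assoc, ← mul_pow]
    norm_num
  rw [cast_coeffScale] at h1 h2
  rw [h3, div_le_iff₀ (by positivity), le_div_iff₀ (by positivity)]
  constructor <;> linarith

theorem hasExampleCoeffs_examplePoly {v₁ v₂ : ℝ} (h : NodeEnclosure v₁ v₂) :
    HasExampleCoeffs (examplePoly v₁ v₂) := by
  have key := fun (k : ℕ) (hk : k < 18) => examplePoly_coeff_mem h hk
  refine ⟨examplePoly_coeff_zero _ _, examplePoly_coeff_two _ _, ?_, ?_, ?_, ?_, ?_, ?_, ?_, ?_,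
    ?_, ?_, ?_, ?_, ?_, ?_, ?_, ?_⟩
  · have := key 2 (by norm_num)
    norm_num [coeffLower, coeffUpper] at this
    rw [abs_le]; norm_num; constructor <;> linarith
  · have := key 3 (by norm_num)
    norm_num [coeffLower, coeffUpper] at this
    rw [abs_le]; norm_num; constructor <;> linarith
  · have := key 4 (by norm_num)
    norm_num [coeffLower, coeffUpper] at this
    rw [abs_le]; norm_num; constructor <;> linarith
  · have := key 5 (by norm_num)
    norm_num [coeffLower, coeffUpper] at this
    rw [abs_le]; norm_num; constructor <;> linarith
  · have := key 6 (by norm_num)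
    norm_num [coeffLower, coeffUpper] at this
    rw [abs_le]; norm_num; constructor <;> linarith
  · have := key 7 (by norm_num)
    norm_num [coeffLower, coeffUpper] at this
    rw [abs_le]; norm_num; constructor <;> linarith
  · have := key 8 (by norm_num)
    norm_num [coeffLower, coeffUpper] at this
    rw [abs_le]; norm_num; constructor <;> linarith
  · have := key 9 (by norm_num)
    norm_num [coeffLower, coeffUpper] at this
    rw [abs_le]; norm_num; constructor <;> linarith
  · have := key 10 (by norm_num)
    norm_num [coeffLower, coeffUpper] at this
    rw [abs_le]; norm_num; constructor <;> linarith
  · have := key 11 (by norm_num)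
    norm_num [coeffLower, coeffUpper] at this
    rw [abs_le]; norm_num; constructor <;> linarith
  · have := key 12 (by norm_num)
    norm_num [coeffLower, coeffUpper] at this
    rw [abs_le]; norm_num; constructor <;> linarith
  · have := key 13 (by norm_num)
    norm_num [coeffLower, coeffUpper] at this
    rw [abs_le]; norm_num; constructor <;> linarith
  · have := key 14 (by norm_num)
    norm_num [coeffLower, coeffUpper] at this
    rw [abs_le]; norm_num; constructor <;> linarith
  · have := key 15 (by norm_num)
    norm_num [coeffLower, coeffUpper] at this
    rw [abs_le]; norm_num; constructor <;> linarith
  · have := key 16 (by norm_num)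
    norm_num [coeffLower, coeffUpper] at this
    rw [abs_le]; norm_num; constructor <;> linarith
  · have := key 17 (by norm_num)
    norm_num [coeffLower, coeffUpper] at this
    rw [abs_le]; norm_num; constructor <;> linarith

theorem natDegree_examplePoly {v₁ v₂ : ℝ} (h : NodeEnclosure v₁ v₂) :
    (examplePoly v₁ v₂).natDegree = 34 := by
  refine le_antisymm (natDegree_compNegSq_le _) (Polynomial.le_natDegree_of_ne_zero ?_)
  have h1 := (examplePoly_coeff_mem h (k := 17) (by norm_num)).1
  intro h2
  rw [h2] at h1
  norm_num [coeffLower] at h1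

/-! ### The speed limit for arbitrary states -/

namespace QuantumSystem

theorem hasSum_inner_evolve (S : QuantumSystem.{u}) (ħ τ : ℝ) :
    HasSum (fun j => ((‖S.amplitude j‖ ^ 2 : ℝ) : ℂ) *
      Complex.exp (((-(S.energy j * τ / ħ) : ℝ) : ℂ) * Complex.I)) (inner ℂ S.ψ (S.evolve ħ τ)) := by
  refine (S.basis.hasSum_inner_mul_inner S.ψ (S.evolve ħ τ)).congr_fun fun j => ?_
  have h1 : inner ℂ (S.basis j) (S.evolve ħ τ) =
      Complex.exp (((-(S.energy j * τ / ħ) : ℝ) : ℂ) * Complex.I) * S.amplitude j := by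
    rw [← S.basis.repr_apply_apply, evolve, LinearIsometryEquiv.apply_symm_apply]
  have h2 : inner ℂ S.ψ (S.basis j) = (starRingEnd ℂ) (S.amplitude j) := by
    rw [amplitude, S.basis.repr_apply_apply, inner_conj_symm]
  rw [h1, h2, Complex.ofReal_pow, ← Complex.conj_mul']
  ring

theorem hasSum_amplitude_sq (S : QuantumSystem.{u}) :
    HasSum (fun j => ‖S.amplitude j‖ ^ 2) 1 := by
  have h := S.basis.hasSum_inner_mul_inner S.ψ S.ψ
  rw [inner_self_eq_norm_sq_to_K, S.norm_ψ] at h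
  have h1 := Complex.hasSum_re h
  norm_num at h1
  refine h1.congr_fun fun j => ?_
  have h2 : inner ℂ S.ψ (S.basis j) = (starRingEnd ℂ) (S.amplitude j) := by
    rw [amplitude, S.basis.repr_apply_apply, inner_conj_symm]
  rw [h2, ← S.basis.repr_apply_apply, ← amplitude, Complex.conj_re, Complex.conj_im,
    ← Complex.normSq_eq_norm_sq, Complex.normSq_apply]
  ring

theorem rootFidelity_eq (S : QuantumSystem.{u}) (ħ τ : ℝ) :
    S.rootFidelity ħ τ = ‖inner ℂ S.ψ (S.evolve ħ τ)‖ :=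
  Real.sqrt_sq (norm_nonneg _)

/-- The modulus of the overlap is at least its real part `∑ |αⱼ|² cos(Eⱼτ/ħ)`. Replacing the cosine
by `p` gives a combination of moments, which are finite, so the sums may be exchanged. -/
theorem qslBound_le_rootFidelity (S : QuantumSystem.{u}) {p : Polynomial ℝ}
    (hp : ∀ x, p.eval x = p.coeff 0 + ∑ k ∈ Finset.Icc 1 17, p.coeff (2 * k) * x ^ (2 * k))
    (hcos : ∀ x, p.eval x ≤ Real.cos x)
    (hS : ∀ k ∈ Finset.Icc 1 17, S.FiniteAbsMoment (2 * k)) (ħ τ : ℝ) :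
    qslBound p ħ (fun k => S.absMoment (2 * k)) τ ≤ S.rootFidelity ħ τ := by
  have h1 : HasSum (fun j => ‖S.amplitude j‖ ^ 2 * Real.cos (S.energy j * τ / ħ))
      (inner ℂ S.ψ (S.evolve ħ τ)).re := by
    refine (Complex.hasSum_re (S.hasSum_inner_evolve ħ τ)).congr_fun fun j => ?_
    rw [Complex.re_ofReal_mul, Complex.exp_ofReal_mul_I_re, Real.cos_neg]
  have h2 : HasSum (fun j => ‖S.amplitude j‖ ^ 2 * p.eval (S.energy j * τ / ħ))
      (qslBound p ħ (fun k => S.absMoment (2 * k)) τ) := by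
    have h3 := (S.hasSum_amplitude_sq.mul_left (p.coeff 0)).add
      (hasSum_sum fun k hk => ((hS k hk).hasSum.mul_left (p.coeff (2 * k))).mul_right
        ((τ / ħ) ^ (2 * k)))
    rw [mul_one] at h3
    refine h3.congr_fun fun j => ?_
    rw [hp, mul_add, Finset.mul_sum]
    congr 1
    · ring
    · refine Finset.sum_congr rfl fun k _ => ?_
      rw [mul_div_assoc, mul_pow, (even_two_mul k).pow_abs]
      ring
  rw [rootFidelity_eq]
  exact (hasSum_le (fun j => mul_le_mul_of_nonneg_left (hcos _) (sq_nonneg _)) h2 h1).trans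
    (Complex.re_le_norm _)

theorem HasExampleMoments.qslBound_eq {S : QuantumSystem.{u}} {ħ : ℝ} (h : S.HasExampleMoments ħ)
    (p : Polynomial ℝ) (τ : ℝ) :
    qslBound p ħ (fun k => S.absMoment (2 * k)) τ = qslBound p ħ (exampleMoment ħ) τ := by
  rw [qslBound, qslBound]
  congr 1
  refine Finset.sum_congr rfl fun k hk => ?_
  rw [(h k hk).2]

end QuantumSystem

/-! ### The example state and its bound -/

/-- The overlap of the example state with itself after time `t`. -/
noncomputable def exampleOverlap (t : ℝ) : ℝ :=
  (7 + 4 * Real.cos t + 4 * Real.cos (11 * t / 5)) / 15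

theorem toHilbertBasis_basisFun_repr {n : ℕ} (x : EuclideanSpace ℂ (Fin n)) (j : Fin n) :
    (EuclideanSpace.basisFun (Fin n) ℂ).toHilbertBasis.repr x j = x j := by
  rw [HilbertBasis.repr_apply_apply, OrthonormalBasis.coe_toHilbertBasis,
    EuclideanSpace.basisFun_inner]

theorem norm_sq_exampleSystem_amplitude (ħ : ℝ) (j : Fin 5) :
    ‖(exampleSystem ħ).amplitude j‖ ^ 2 = ![7 / 15, 2 / 15, 2 / 15, 2 / 15, 2 / 15] j := by
  have h : (exampleSystem ħ).amplitude j =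
      (![((√7 / √15 : ℝ) : ℂ), ((√2 / √15 : ℝ) : ℂ), ((√2 / √15 : ℝ) : ℂ), ((√2 / √15 : ℝ) : ℂ),
        ((√2 / √15 : ℝ) : ℂ)] : Fin 5 → ℂ) j := by
    refine (toHilbertBasis_basisFun_repr _ _).trans ?_
    fin_cases j <;> rfl
  rw [h]
  fin_cases j <;> simp [div_pow]

theorem rootFidelity_exampleSystem {ħ : ℝ} (hħ : 0 < ħ) (τ : ℝ) :
    (exampleSystem ħ).rootFidelity ħ τ = |exampleOverlap τ| := by
  have h := (exampleSystem ħ).hasSum_inner_evolve ħ τ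
  have h2 := h.unique (hasSum_fintype (β := Fin 5) _)
  rw [QuantumSystem.rootFidelity_eq, h2, ← Real.norm_eq_abs, ← Complex.norm_real]
  congr 1
  have e : ∀ j : Fin 5, ‖(exampleSystem ħ).amplitude j‖ ^ 2 = _ :=
    norm_sq_exampleSystem_amplitude ħ
  have e' : ∀ j : Fin 5, (exampleSystem ħ).energy j * τ / ħ =
      ![0, -τ, τ, -(11 * τ / 5), 11 * τ / 5] j := by
    intro j
    fin_cases j <;> simp [exampleSystem] <;> field_simp
  simp only [e, e']
  simp [Fin.sum_univ_succ, exampleOverlap, Complex.cos]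
  ring_nf

theorem hasExampleMoments_exampleSystem (ħ : ℝ) : (exampleSystem ħ).HasExampleMoments ħ := by
  intro k hk
  have h := hasSum_fintype (β := Fin 5)
    (fun j => ‖(exampleSystem ħ).amplitude j‖ ^ 2 * |(exampleSystem ħ).energy j| ^ (2 * k))
  refine ⟨h.summable, h.tsum_eq.trans ?_⟩
  have e : ∀ j : Fin 5, ‖(exampleSystem ħ).amplitude j‖ ^ 2 = _ :=
    norm_sq_exampleSystem_amplitude ħ
  have hk0 : k ≠ 0 := by have := (Finset.mem_Icc.1 hk).1; omega
  simp only [e, (even_two_mul k).pow_abs]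
  simp [Fin.sum_univ_succ, exampleSystem, hk0, (even_two_mul k).neg_pow, exampleMoment]
  rw [show 11 * ħ / 5 = ħ * (11 / 5) by ring, mul_pow]
  ring

theorem range_eighteen_eq : Finset.range 18 = insert 0 (Finset.Icc 1 17) := by decide

theorem eval_compNegSq_eq_sum (P : Polynomial ℝ) (x : ℝ) :
    (compNegSq P).eval x = (compNegSq P).coeff 0 +
      ∑ k ∈ Finset.Icc 1 17, (compNegSq P).coeff (2 * k) * x ^ (2 * k) := by
  have h0 := compNegSq_coeff_even P (k := 0) (by omega)
  rw [mul_zero] at h0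
  conv_lhs => rw [compNegSq, Polynomial.eval_finsetSum, range_eighteen_eq,
    Finset.sum_insert (by simp)]
  congr 1
  · simp [h0]
  · refine Finset.sum_congr rfl fun k hk => ?_
    rw [Finset.mem_Icc] at hk
    rw [compNegSq_coeff_even P (by omega)]
    simp

/-- The formula `exampleMoment` would give `8/15` at `k = 0` instead of the total mass 1; the
constant `7/15` of `boundPoly` is the missing weight at energy 0. -/
theorem qslBound_compNegSq {P : Polynomial ℝ} (hP : P.coeff 0 = 1) {ħ : ℝ} (hħ : 0 < ħ) (τ : ℝ) :
    qslBound (compNegSq P) ħ (exampleMoment ħ) τ = (boundPoly P).eval (1000 * τ ^ 2) := by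
  have h0 := compNegSq_coeff_even P (k := 0) (by omega)
  rw [mul_zero, hP] at h0
  rw [qslBound, boundPoly, Polynomial.eval_add, Polynomial.eval_finsetSum, range_eighteen_eq,
    Finset.sum_insert (by simp), ← add_assoc, h0]
  congr 1
  · simp [hP]
    norm_num
  · refine Finset.sum_congr rfl fun k hk => ?_
    rw [Finset.mem_Icc] at hk
    rw [compNegSq_coeff_even P (by omega), Polynomial.eval_mul, Polynomial.eval_C,
      Polynomial.eval_pow, Polynomial.eval_X, exampleMoment, div_pow τ, mul_pow (1000 : ℝ),
      pow_mul (11 / 5 : ℝ), show (11 / 5 : ℝ) ^ 2 = 121 / 25 by norm_num, pow_mul τ]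
    field_simp

/-- The bound is the mean of `p` over the energy distribution of the example state, just as the
overlap is the mean of the cosine. -/
theorem eval_boundPoly (P : Polynomial ℝ) (τ : ℝ) :
    (boundPoly P).eval (1000 * τ ^ 2) =
      (7 + 4 * (compNegSq P).eval τ + 4 * (compNegSq P).eval (11 * τ / 5)) / 15 := by
  rw [boundPoly, compNegSq, Polynomial.eval_add, Polynomial.eval_finsetSum,
    Polynomial.eval_finsetSum, Polynomial.eval_finsetSum, Polynomial.eval_C, add_assoc, add_div,
    Finset.mul_sum, Finset.mul_sum, ← Finset.sum_add_distrib, Finset.sum_div]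
  congr 1
  refine Finset.sum_congr rfl fun k _ => ?_
  simp only [Polynomial.eval_mul, Polynomial.eval_C, Polynomial.eval_pow, Polynomial.eval_X]
  rw [show 11 * τ / 5 = 11 / 5 * τ by ring, mul_pow, mul_pow, pow_mul (11 / 5 : ℝ), pow_mul τ]
  norm_num
  field_simp

theorem exampleOverlap_eq (t : ℝ) : exampleOverlap t = overlapFun (t ^ 2) / 15 := by
  rw [exampleOverlap, overlapFun, cos_eq_coshSqrt, cos_eq_coshSqrt,
    show -(11 * t / 5) ^ 2 = -(121 / 25 * t ^ 2) by ring]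
  ring

theorem continuous_exampleOverlap : Continuous exampleOverlap := by
  unfold exampleOverlap
  fun_prop

theorem hasDerivAt_overlapFun (v : ℝ) :
    HasDerivAt overlapFun (-(4 / 25 * overlapSlope v)) v := by
  unfold overlapFun overlapSlope
  have h1 := (hasDerivAt_coshSqrt 0 (-v)).comp v (hasDerivAt_neg v)
  have h2 := (hasDerivAt_coshSqrt 0 (-(121 / 25 * v))).comp v
    ((hasDerivAt_id v).const_mul (121 / 25)).neg
  refine (((h1.add h2).const_mul 4).const_add 7).congr_deriv ?_
  ring

theorem hasDerivAt_exampleOverlap (t : ℝ) :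
    HasDerivAt exampleOverlap (-(4 / 25 * overlapSlope (t ^ 2)) * (2 * t) / 15) t := by
  have h := ((hasDerivAt_overlapFun (t ^ 2)).comp t (hasDerivAt_pow 2 t)).div_const 15
  have h2 : exampleOverlap = fun t => (overlapFun ∘ fun t => t ^ 2) t / 15 :=
    funext exampleOverlap_eq
  rw [h2]
  refine h.congr_deriv ?_
  norm_num

/-- The lower bound as a function of `τ`. -/
noncomputable def exampleBound (v₁ v₂ τ : ℝ) : ℝ :=
  (boundPoly (coshSqrtInterpolant (exampleNodal v₁ v₂))).eval (1000 * τ ^ 2)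

theorem qslBound_examplePoly (v₁ v₂ : ℝ) {ħ : ℝ} (hħ : 0 < ħ) (τ : ℝ) :
    qslBound (examplePoly v₁ v₂) ħ (exampleMoment ħ) τ = exampleBound v₁ v₂ τ := by
  refine qslBound_compNegSq ?_ hħ τ
  rw [coshSqrtInterpolant_coeff]
  simp

theorem exampleBound_le_exampleOverlap {v₁ v₂ : ℝ} (h : NodeEnclosure v₁ v₂) (τ : ℝ) :
    exampleBound v₁ v₂ τ ≤ exampleOverlap τ := by
  rw [exampleBound, eval_boundPoly, exampleOverlap]
  have h1 := examplePoly_le_cos h τ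
  have h2 := examplePoly_le_cos h (11 * τ / 5)
  rw [examplePoly] at h1 h2
  linarith

theorem AgreesWithCos.eval_eq {p : Polynomial ℝ} {x : ℝ} {m : ℕ} (h : AgreesWithCos p x m)
    (hm : 0 < m) : p.eval x = Real.cos x := by
  simpa using h 0 hm

theorem exampleBound_eq_exampleOverlap {v₁ v₂ τ : ℝ}
    (h1 : (examplePoly v₁ v₂).eval τ = Real.cos τ)
    (h2 : (examplePoly v₁ v₂).eval (11 * τ / 5) = Real.cos (11 * τ / 5)) :
    exampleBound v₁ v₂ τ = exampleOverlap τ := by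
  rw [exampleBound, eval_boundPoly, exampleOverlap, ← examplePoly, h1, h2]

/-- The difference of overlap and bound is nonnegative and vanishes at `τ`, so its derivative
vanishes there. The overlap is stationary at `τ`, hence so is the bound. -/
theorem derivative_boundPoly_eq_zero {v₁ v₂ τ : ℝ} (h : NodeEnclosure v₁ v₂) (hτ : 0 < τ)
    (he : exampleBound v₁ v₂ τ = exampleOverlap τ) (h0 : overlapSlope (τ ^ 2) = 0) :
    (boundPoly (coshSqrtInterpolant (exampleNodal v₁ v₂))).derivative.eval (1000 * τ ^ 2) = 0 := by
  have h1 := hasDerivAt_exampleOverlap τ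
  have h2 : HasDerivAt (exampleBound v₁ v₂) _ τ :=
    HasDerivAt.comp (h₂ := fun w => (boundPoly (coshSqrtInterpolant (exampleNodal v₁ v₂))).eval w) τ
      ((boundPoly (coshSqrtInterpolant (exampleNodal v₁ v₂))).hasDerivAt (1000 * τ ^ 2))
      ((hasDerivAt_pow 2 τ).const_mul 1000)
  have h3 : IsLocalMin (exampleOverlap - exampleBound v₁ v₂) τ :=
    Filter.Eventually.of_forall fun t => by
      have := exampleBound_le_exampleOverlap h t
      simp only [Pi.sub_apply, he, sub_self]
      linarith
  have h4 := h3.hasDerivAt_eq_zero (h1.sub h2)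
  rw [h0] at h4
  norm_num at h4
  exact h4.resolve_right hτ.ne'

/-! ### The sublevel sets of the bound -/

theorem strictMonoOn_eval_Icc {q : Polynomial ℝ} {a b : ℝ}
    (h : ∀ w, a ≤ w → w ≤ b → 0 < q.derivative.eval w) :
    StrictMonoOn (fun w => q.eval w) (Icc a b) := by
  refine strictMonoOn_of_deriv_pos (convex_Icc a b) q.continuous.continuousOn fun w hw => ?_
  rw [interior_Icc] at hw
  rw [q.deriv]
  exact h w hw.1.le hw.2.le

theorem strictAntiOn_eval_Icc {q : Polynomial ℝ} {a b : ℝ}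
    (h : ∀ w, a ≤ w → w ≤ b → q.derivative.eval w < 0) :
    StrictAntiOn (fun w => q.eval w) (Icc a b) := by
  refine strictAntiOn_of_deriv_neg (convex_Icc a b) q.continuous.continuousOn fun w hw => ?_
  rw [interior_Icc] at hw
  rw [q.deriv]
  exact h w hw.1.le hw.2.le

/-- A strictly convex polynomial exceeds its value at a critical point. -/
theorem eval_lt_eval_of_critical {q : Polynomial ℝ} {a b w₀ : ℝ}
    (h : ∀ w, a ≤ w → w ≤ b → 0 < q.derivative.derivative.eval w) (ha : a ≤ w₀) (hb : w₀ ≤ b)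
    (h0 : q.derivative.eval w₀ = 0) {w : ℝ} (hwa : a ≤ w) (hwb : w ≤ b) (hne : w ≠ w₀) :
    q.eval w₀ < q.eval w := by
  have hm := strictMonoOn_eval_Icc h
  rcases lt_or_gt_of_ne hne with hlt | hlt
  · obtain ⟨x, hx, hx'⟩ := exists_deriv_eq_slope (fun w => q.eval w) hlt q.continuous.continuousOn
      q.differentiable.differentiableOn
    have h1 := hm ⟨by linarith [hx.1], by linarith [hx.2]⟩ ⟨ha, hb⟩ hx.2
    rw [q.deriv, eq_div_iff (by linarith)] at hx'
    simp only [h0] at h1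
    nlinarith [mul_neg_of_neg_of_pos h1 (sub_pos.2 hlt)]
  · obtain ⟨x, hx, hx'⟩ := exists_deriv_eq_slope (fun w => q.eval w) hlt q.continuous.continuousOn
      q.differentiable.differentiableOn
    have h1 := hm ⟨ha, hb⟩ ⟨by linarith [hx.1], by linarith [hx.2]⟩ hx.1
    rw [q.deriv, eq_div_iff (by linarith)] at hx'
    simp only [h0] at h1
    nlinarith [mul_pos h1 (sub_pos.2 hlt)]

/-- The sublevel sets of the bound at the two critical root fidelities, as a function of `w`. -/
structure SublevelShape (R : ℝ → ℝ) (t₁ t₂ f₂ a b c : ℝ) : Prop where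
  above : ∀ t, 0 ≤ t → t < c → t ≠ t₂ → f₂ < R t
  eq_two : R t₂ = f₂
  eq_c : R c = f₂
  below : ∀ t, c < t → R t < f₂
  nonpos_iff : ∀ t, 0 ≤ t → (R t ≤ 0 ↔ (t₁ ≤ t ∧ t ≤ a) ∨ b ≤ t)

theorem BoundSigns.exists_shape {q : Polynomial ℝ} (h : BoundSigns q) {w₁ w₂ : ℝ}
    (h₁ : 93950 ≤ w₁ ∧ w₁ ≤ 93951) (h₂ : 16888 ≤ w₂ ∧ w₂ ≤ 16889) (e₁ : q.eval w₁ = 0)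
    (e₂ : q.derivative.eval w₂ = 0) :
    ∃ a b c : ℝ, (102790 ≤ a ∧ a ≤ 102800) ∧ (104992 ≤ b ∧ b ≤ 105000) ∧
      (90610 ≤ c ∧ c ≤ 90620) ∧
      SublevelShape (fun w => q.eval w) w₁ w₂ (q.eval w₂) a b c := by
  have tl := h.touch_lower w₂ h₂.1 h₂.2
  have tu := h.touch_upper w₂ h₂.1 h₂.2
  have v1 := h.value₁
  have v2 := h.value₂
  -- The crossing `c` is placed in a bracket on which the bound passes from above `0.068202` to
  -- below `0.068201`, values that enclose the level `q.eval w₂`.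
  obtain ⟨c, hc, ec⟩ := intermediate_value_Icc' (f := fun w => q.eval w) (by norm_num : (90610 : ℝ) ≤ 90620)
    q.continuous.continuousOn (show q.eval w₂ ∈ _ from ⟨by linarith, by linarith⟩)
  obtain ⟨a, ha, ea⟩ := intermediate_value_Icc (f := fun w => q.eval w)
    (by norm_num : (102790 : ℝ) ≤ 102800)
    q.continuous.continuousOn (show (0 : ℝ) ∈ _ from ⟨h.value₃.le, h.value₄.le⟩)
  obtain ⟨b, hb, eb⟩ := intermediate_value_Icc' (f := fun w => q.eval w)
    (by norm_num : (104992 : ℝ) ≤ 105000)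
    q.continuous.continuousOn (show (0 : ℝ) ∈ _ from ⟨h.value₆.le, h.value₅.le⟩)
  have d1 := strictAntiOn_eval_Icc h.decreasing₁
  have d2 := strictMonoOn_eval_Icc h.increasing
  have d3 := strictAntiOn_eval_Icc h.decreasing₂
  simp only at ec ea eb
  obtain ⟨hc1, hc2⟩ := hc
  obtain ⟨ha1, ha2⟩ := ha
  obtain ⟨hb1, hb2⟩ := hb
  obtain ⟨h11, h12⟩ := h₁
  obtain ⟨h21, h22⟩ := h₂
  have above : ∀ t, 0 ≤ t → t < c → t ≠ w₂ → q.eval w₂ < q.eval t := by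
    intro t ht htc hne
    -- Before `c` the bound either exceeds `0.0683`, or is strictly convex with critical point `w₂`,
    -- or decreases strictly to its value at `c`.
    rcases le_total t 16000 with h3 | h3
    · linarith [h.initial t ht h3]
    rcases le_total t 18500 with h4 | h4
    · exact eval_lt_eval_of_critical h.convex (by linarith) (by linarith) e₂ h3 h4 hne
    rcases le_total t 88360 with h5 | h5
    · linarith [h.middle t h4 h5]
    · rw [← ec]
      exact d1 ⟨h5, by linarith⟩ ⟨by linarith, by linarith⟩ htc
  refine ⟨a, b, c, ⟨ha1, ha2⟩, ⟨hb1, hb2⟩, ⟨hc1, hc2⟩, above, rfl, ec, ?_, ?_⟩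
  · intro t htc
    rcases le_total t 97000 with h3 | h3
    · rw [← ec]
      exact d1 ⟨by linarith, by linarith⟩ ⟨by linarith, h3⟩ htc
    rcases le_total t 102010 with h4 | h4
    · linarith [h.negative t h3 h4]
    rcases le_total t 106090 with h5 | h5
    · linarith [h.small t h4 h5]
    · linarith [h.final t h5]
  · intro t ht
    show q.eval t ≤ 0 ↔ _
    rcases lt_or_ge t c with h3 | h3
    · have : 0 < q.eval t := by
        by_cases hne : t = w₂
        · rw [hne]; linarith
        · linarith [above t ht h3 hne]
      exact iff_of_false (by linarith) (by rintro (⟨h4, -⟩ | h4) <;> linarith)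
    -- From `c` on, the bound decreases through its zero `w₁`, stays negative, increases through
    -- `a`, stays positive, decreases through `b`, and is negative thereafter.
    rcases le_total t 97000 with h4 | h4
    · have := d1.le_iff_ge (a := t) (b := w₁) ⟨by linarith, h4⟩ ⟨by linarith, by linarith⟩
      simp only [e₁] at this
      rw [this]
      exact ⟨fun h5 => Or.inl ⟨h5, by linarith⟩, by rintro (⟨h5, -⟩ | h5) <;> linarith⟩
    rcases le_total t 102010 with h5 | h5
    · exact iff_of_true (h.negative t h4 h5).le (Or.inl ⟨by linarith, by linarith⟩)
    rcases le_total t 103200 with h6 | h6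
    · have := d2.le_iff_le (a := t) (b := a) ⟨h5, h6⟩ ⟨by linarith, by linarith⟩
      simp only [ea] at this
      rw [this]
      exact ⟨fun h7 => Or.inl ⟨by linarith, h7⟩, by rintro (⟨-, h7⟩ | h7) <;> linarith⟩
    rcases le_total t 104200 with h7 | h7
    · exact iff_of_false (by linarith [h.positive t h6 h7])
        (by rintro (⟨-, h7⟩ | h7) <;> linarith)
    rcases le_total t 106090 with h8 | h8
    · have := d3.le_iff_ge (a := t) (b := b) ⟨h7, h8⟩ ⟨by linarith, by linarith⟩
      simp only [eb] at this
      rw [this]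
      exact ⟨fun h7 => Or.inr h7, by rintro (⟨-, h7⟩ | h7) <;> linarith⟩
    · exact iff_of_true (h.final t h8).le (Or.inr (by linarith))

theorem SublevelShape.comp_sq {R : ℝ → ℝ} {w₁ w₂ f₂ a b c : ℝ}
    (h : SublevelShape R w₁ w₂ f₂ a b c) (h₁ : 0 ≤ w₁) (h₂ : 0 ≤ w₂) (ha : 0 ≤ a) (hb : 0 ≤ b)
    (hc : 0 ≤ c) :
    SublevelShape (fun t => R (1000 * t ^ 2)) √(w₁ / 1000) √(w₂ / 1000) f₂ √(a / 1000)
      √(b / 1000) √(c / 1000) := by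
  have e : ∀ {w : ℝ}, 0 ≤ w → 1000 * √(w / 1000) ^ 2 = w := by
    intro w hw
    rw [Real.sq_sqrt (by positivity)]
    ring
  have l : ∀ {w t : ℝ}, 0 ≤ w → 0 ≤ t → (√(w / 1000) ≤ t ↔ w ≤ 1000 * t ^ 2) := by
    intro w t hw ht
    rw [Real.sqrt_le_left ht, div_le_iff₀ (by norm_num), mul_comm]
  have r : ∀ {w t : ℝ}, 0 ≤ w → 0 ≤ t → (t ≤ √(w / 1000) ↔ 1000 * t ^ 2 ≤ w) := by
    intro w t hw ht
    rw [Real.le_sqrt ht (by positivity), le_div_iff₀ (by norm_num), mul_comm]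
  refine ⟨fun t ht htc hne => h.above _ (by positivity) ?_ ?_, ?_, ?_, fun t htc => h.below _ ?_,
    fun t ht => ?_⟩
  · rw [← not_le, l hc ht] at htc
    exact not_le.1 htc
  · intro h3
    refine hne ?_
    rw [← h3, mul_div_cancel_left₀ _ (by norm_num), Real.sqrt_sq ht]
  · simp only [e h₂, h.eq_two]
  · simp only [e hc, h.eq_c]
  · have ht : 0 ≤ t := (Real.sqrt_nonneg _).trans htc.le
    rw [← not_le, r hc ht] at htc
    exact not_le.1 htc
  · rw [l h₁ ht, r ha ht, l hb ht]
    exact h.nonpos_iff _ (by positivity)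

/-! ### Consequences of a tight bound: least times, limits and the jump -/

/-- A lower bound `R` on the overlap `g`, tight at `t₁` and `t₂`, together with a set `T f` of times
for every root fidelity `f` that respects the bound and contains the times of the overlap. -/
structure TightBound (R g : ℝ → ℝ) (T : ℝ → Set ℝ) (t₁ t₂ f₂ a b c : ℝ) : Prop
    extends SublevelShape R t₁ t₂ f₂ a b c where
  continuous_bound : Continuous R
  continuous_overlap : Continuous g
  bound_le : ∀ t, R t ≤ g t
  overlap_zero : g 0 = 1
  overlap_one : g t₁ = 0
  overlap_two : g t₂ = f₂
  subset : ∀ f, T f ⊆ {t | 0 ≤ t ∧ R t ≤ f}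
  mem : ∀ t, 0 ≤ t → t ∈ T |g t|
  pos_two : 0 < t₂
  two_lt_c : t₂ < c
  c_lt_one : c < t₁
  one_lt_a : t₁ < a
  f₂_pos : 0 < f₂
  f₂_lt_one : f₂ < 1

namespace TightBound

variable {R g : ℝ → ℝ} {T : ℝ → Set ℝ} {t₁ t₂ f₂ a b c : ℝ}

theorem pos_one (h : TightBound R g T t₁ t₂ f₂ a b c) : 0 < t₁ :=
  h.pos_two.trans (h.two_lt_c.trans h.c_lt_one)

theorem bound_one (h : TightBound R g T t₁ t₂ f₂ a b c) : R t₁ ≤ 0 :=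
  (h.bound_le t₁).trans h.overlap_one.le

theorem isLeast_bound_zero (h : TightBound R g T t₁ t₂ f₂ a b c) (hb : t₁ ≤ b) :
    IsLeast {t | 0 ≤ t ∧ R t ≤ 0} t₁ := by
  refine ⟨⟨h.pos_one.le, h.bound_one⟩, fun t ht => ?_⟩
  rcases (h.nonpos_iff t ht.1).1 ht.2 with h1 | h1
  · exact h1.1
  · exact hb.trans h1

theorem isLeast_bound_two (h : TightBound R g T t₁ t₂ f₂ a b c) :
    IsLeast {t | 0 ≤ t ∧ R t ≤ f₂} t₂ := by
  refine ⟨⟨h.pos_two.le, h.eq_two.le⟩, fun t ht => ?_⟩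
  by_contra! h1
  exact (h.above t ht.1 (h1.trans h.two_lt_c) h1.ne).not_ge ht.2

theorem isLeast_zero (h : TightBound R g T t₁ t₂ f₂ a b c) (hb : t₁ ≤ b) : IsLeast (T 0) t₁ := by
  refine ⟨?_, fun t ht => (h.isLeast_bound_zero hb).2 (h.subset 0 ht)⟩
  have := h.mem t₁ h.pos_one.le
  rwa [h.overlap_one, abs_zero] at this

theorem isLeast_two (h : TightBound R g T t₁ t₂ f₂ a b c) : IsLeast (T f₂) t₂ := by
  refine ⟨?_, fun t ht => h.isLeast_bound_two.2 (h.subset f₂ ht)⟩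
  have := h.mem t₂ h.pos_two.le
  rwa [h.overlap_two, abs_of_pos h.f₂_pos] at this

/-- On `(0, c)` the overlap is at least `R`, which is at least `f₂`, and both are equal to `f₂` at
`t₂`. -/
theorem isLocalMin (h : TightBound R g T t₁ t₂ f₂ a b c) : IsLocalMin (fun t => |g t|) t₂ := by
  filter_upwards [Ioo_mem_nhds h.pos_two h.two_lt_c] with t ht
  rw [h.overlap_two, abs_of_pos h.f₂_pos]
  refine le_trans ?_ ((h.bound_le t).trans (le_abs_self _))
  by_cases hne : t = t₂
  · rw [hne, h.eq_two]
  · exact (h.above t ht.1.le ht.2 hne).le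

/-- The overlap is at least `R c = f₂` at `c` and is 0 at `t₁ > c`, so it takes the value `f₂` in
between. -/
theorem exists_ge_c (h : TightBound R g T t₁ t₂ f₂ a b c) : ∃ t, c ≤ t ∧ |g t| = f₂ := by
  obtain ⟨t, ht, e⟩ := intermediate_value_Icc' h.c_lt_one.le h.continuous_overlap.continuousOn
    (show f₂ ∈ _ from ⟨by rw [h.overlap_one]; exact h.f₂_pos.le, by
      rw [← h.eq_c]; exact h.bound_le c⟩)
  exact ⟨t, ht.1, by rw [e, abs_of_pos h.f₂_pos]⟩

theorem exists_mem_le_one (h : TightBound R g T t₁ t₂ f₂ a b c) {f : ℝ} (hf : f ∈ Icc (0 : ℝ) 1) :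
    ∃ t ∈ T f, t ≤ t₁ := by
  obtain ⟨t, ht, e⟩ := intermediate_value_Icc' h.pos_one.le h.continuous_overlap.continuousOn
    (show f ∈ _ from by rw [h.overlap_one, h.overlap_zero]; exact hf)
  have := h.mem t ht.1
  rw [e, abs_of_nonneg hf.1] at this
  exact ⟨t, this, ht.2⟩

theorem exists_mem_le_two (h : TightBound R g T t₁ t₂ f₂ a b c) {f : ℝ} (hf : f ∈ Icc f₂ 1) :
    ∃ t ∈ T f, t ≤ t₂ := by
  obtain ⟨t, ht, e⟩ := intermediate_value_Icc' h.pos_two.le h.continuous_overlap.continuousOn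
    (show f ∈ _ from by rw [h.overlap_two, h.overlap_zero]; exact hf)
  have := h.mem t ht.1
  rw [e, abs_of_nonneg (h.f₂_pos.le.trans hf.1)] at this
  exact ⟨t, this, ht.2⟩

theorem bddBelow_bound (R : ℝ → ℝ) (f : ℝ) : BddBelow {t | 0 ≤ t ∧ R t ≤ f} := ⟨0, fun _ ht => ht.1⟩

theorem bddBelow (h : TightBound R g T t₁ t₂ f₂ a b c) (f : ℝ) : BddBelow (T f) :=
  (bddBelow_bound R f).mono (h.subset f)

theorem sInf_bound_le (h : TightBound R g T t₁ t₂ f₂ a b c) {f : ℝ} (hf : f ∈ Icc (0 : ℝ) 1) :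
    sInf {t | 0 ≤ t ∧ R t ≤ f} ≤ sInf (T f) := by
  obtain ⟨t, ht, -⟩ := h.exists_mem_le_one hf
  exact csInf_le_csInf (bddBelow_bound R f) ⟨t, ht⟩ (h.subset f)

theorem sInf_le_one (h : TightBound R g T t₁ t₂ f₂ a b c) {f : ℝ} (hf : f ∈ Icc (0 : ℝ) 1) :
    sInf (T f) ≤ t₁ := by
  obtain ⟨t, ht, ht1⟩ := h.exists_mem_le_one hf
  exact (csInf_le (h.bddBelow f) ht).trans ht1

theorem sInf_le_two (h : TightBound R g T t₁ t₂ f₂ a b c) {f : ℝ} (hf : f ∈ Icc f₂ 1) :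
    sInf (T f) ≤ t₂ := by
  obtain ⟨t, ht, ht2⟩ := h.exists_mem_le_two hf
  exact (csInf_le (h.bddBelow f) ht).trans ht2

/-- The permissible set is closed, so it contains its infimum, where `R < f₂`. On `[0, c]` the bound
is at least `f₂`. -/
theorem c_lt_sInf_bound (h : TightBound R g T t₁ t₂ f₂ a b c) {f : ℝ} (hf : f ∈ Ico 0 f₂) :
    c < sInf {t | 0 ≤ t ∧ R t ≤ f} := by
  have hc : IsClosed {t | 0 ≤ t ∧ R t ≤ f} :=
    (isClosed_le continuous_const continuous_id).inter
      (isClosed_le h.continuous_bound continuous_const)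
  have hm := hc.csInf_mem ⟨t₁, h.pos_one.le, h.bound_one.trans hf.1⟩ (bddBelow_bound R f)
  by_contra! h1
  have h2 := hm.2.trans_lt hf.2
  rcases h1.lt_or_eq with h3 | h3
  · by_cases hne : sInf {t | 0 ≤ t ∧ R t ≤ f} = t₂
    · rw [hne, h.eq_two] at h2
      exact lt_irrefl _ h2
    · exact lt_asymm h2 (h.above _ hm.1 h3 hne)
  · rw [h3, h.eq_c] at h2
    exact lt_irrefl _ h2

theorem tendsto_left (h : TightBound R g T t₁ t₂ f₂ a b c) :
    Tendsto (fun f => sInf {t | 0 ≤ t ∧ R t ≤ f}) (𝓝[<] f₂) (𝓝 c) := by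
  refine tendsto_order.2 ⟨fun x hx => ?_, fun x hx => ?_⟩
  · filter_upwards [Ioo_mem_nhdsLT h.f₂_pos] with f hf
    exact hx.trans (h.c_lt_sInf_bound ⟨hf.1.le, hf.2⟩)
  · obtain ⟨y, hy1, hy2⟩ := exists_between hx
    -- Since `R y < f₂` for each `y > c`, the time `y` is permissible once `f` exceeds `R y`.
    filter_upwards [Ioo_mem_nhdsLT (h.below y hy1)] with f hf
    refine (csInf_le (bddBelow_bound R f) ⟨?_, hf.1.le⟩).trans_lt hy2
    exact (h.pos_two.trans (h.two_lt_c.trans hy1)).le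

/-- On a compact `[0, y]` with `y < t₂` the bound attains a minimum, which exceeds `f₂`; for `f`
below this minimum no time up to `y` is permissible. -/
theorem lt_sInf_bound (h : TightBound R g T t₁ t₂ f₂ a b c) {x : ℝ} (hx : x < t₂) :
    ∀ᶠ f in 𝓝[>] f₂, x < sInf {t | 0 ≤ t ∧ R t ≤ f} := by
  obtain ⟨y, hy1, hy2⟩ := exists_between (max_lt hx h.pos_two)
  have hy0 : 0 ≤ y := (le_max_right x 0).trans hy1.le
  obtain ⟨s, hs, hmin⟩ := isCompact_Icc.exists_isMinOn (nonempty_Icc.2 hy0)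
    h.continuous_bound.continuousOn
  have hs2 : s < t₂ := hs.2.trans_lt hy2
  have h1 := h.above s hs.1 (hs2.trans h.two_lt_c) hs2.ne
  filter_upwards [Ioo_mem_nhdsGT h1] with f hf
  refine ((le_max_left x 0).trans_lt hy1).trans_le (le_csInf ⟨t₂, h.pos_two.le, ?_⟩ fun t ht => ?_)
  · rw [h.eq_two]; exact hf.1.le
  · by_contra! h2
    exact (ht.2.trans_lt hf.2).not_ge (hmin ⟨ht.1, h2.le⟩)

theorem tendsto_right_of_le (h : TightBound R g T t₁ t₂ f₂ a b c) {F : ℝ → ℝ}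
    (h1 : ∀ f ∈ Icc f₂ 1, sInf {t | 0 ≤ t ∧ R t ≤ f} ≤ F f) (h2 : ∀ f ∈ Icc f₂ 1, F f ≤ t₂) :
    Tendsto F (𝓝[>] f₂) (𝓝 t₂) := by
  refine tendsto_order.2 ⟨fun x hx => ?_, fun x hx => ?_⟩
  · filter_upwards [h.lt_sInf_bound hx, Ioo_mem_nhdsGT h.f₂_lt_one] with f hf hf'
    exact hf.trans_le (h1 f ⟨hf'.1.le, hf'.2.le⟩)
  · filter_upwards [Ioo_mem_nhdsGT h.f₂_lt_one] with f hf'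
    exact (h2 f ⟨hf'.1.le, hf'.2.le⟩).trans_lt hx

theorem tendsto_right_bound (h : TightBound R g T t₁ t₂ f₂ a b c) :
    Tendsto (fun f => sInf {t | 0 ≤ t ∧ R t ≤ f}) (𝓝[>] f₂) (𝓝 t₂) :=
  h.tendsto_right_of_le (fun _ _ => le_rfl) fun _ hf =>
    (h.sInf_bound_le ⟨h.f₂_pos.le.trans hf.1, hf.2⟩).trans (h.sInf_le_two hf)

theorem tendsto_right (h : TightBound R g T t₁ t₂ f₂ a b c) :
    Tendsto (fun f => sInf (T f)) (𝓝[>] f₂) (𝓝 t₂) :=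
  h.tendsto_right_of_le (fun _ hf => h.sInf_bound_le ⟨h.f₂_pos.le.trans hf.1, hf.2⟩)
    fun _ hf => h.sInf_le_two hf

/-- To the left of `f₂` the values exceed `c`, whereas the value at `f₂` is `t₂ < c`. -/
theorem not_continuousAt_of_le (h : TightBound R g T t₁ t₂ f₂ a b c) {F : ℝ → ℝ}
    (h1 : ∀ f ∈ Ico 0 f₂, sInf {t | 0 ≤ t ∧ R t ≤ f} ≤ F f) (h2 : F f₂ = t₂) :
    ¬ ContinuousAt F f₂ := by
  intro h3
  have h4 : Tendsto F (𝓝[<] f₂) (𝓝 t₂) := by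
    rw [← h2]; exact h3.tendsto.mono_left nhdsWithin_le_nhds
  refine h.two_lt_c.not_ge (ge_of_tendsto h4 ?_)
  filter_upwards [Ioo_mem_nhdsLT h.f₂_pos] with f hf
  exact (h.c_lt_sInf_bound ⟨hf.1.le, hf.2⟩).le.trans (h1 f ⟨hf.1.le, hf.2⟩)

theorem bound_le_f₂_iff (h : TightBound R g T t₁ t₂ f₂ a b c) :
    {t | 0 ≤ t ∧ R t ≤ f₂} = {t₂} ∪ Ici c := by
  ext t
  simp only [mem_ofPred_eq, singleton_union, mem_insert_iff, mem_Ici]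
  constructor
  · rintro ⟨h1, h2⟩
    by_contra! h3
    exact (h.above t h1 h3.2 h3.1).not_ge h2
  · rintro (rfl | h1)
    · exact ⟨h.pos_two.le, h.eq_two.le⟩
    · refine ⟨(h.pos_two.trans h.two_lt_c).le.trans h1, ?_⟩
      rcases h1.eq_or_lt with h2 | h2
      · rw [← h2, h.eq_c]
      · exact (h.below t h2).le

theorem bound_nonpos_iff (h : TightBound R g T t₁ t₂ f₂ a b c) (hb : 0 ≤ b) :
    {t | 0 ≤ t ∧ R t ≤ 0} = Icc t₁ a ∪ Ici b := by
  ext t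
  simp only [mem_ofPred_eq, mem_union, mem_Icc, mem_Ici]
  refine ⟨fun h1 => (h.nonpos_iff t h1.1).1 h1.2, fun h1 => ?_⟩
  have h0 : 0 ≤ t := by
    rcases h1 with h1 | h1
    · exact h.pos_one.le.trans h1.1
    · exact hb.trans h1
  exact ⟨h0, (h.nonpos_iff t h0).2 h1⟩

end TightBound

/-! ### Assembly of the main theorem -/

theorem abs_sqrt_sub_le {x y δ : ℝ} (h1 : (y - δ) ^ 2 ≤ x) (h2 : x ≤ (y + δ) ^ 2)
    (hy : 0 ≤ y + δ) : |√x - y| ≤ δ := by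
  have h3 := Real.le_sqrt_of_sq_le h1
  have h4 := Real.sqrt_le_iff.2 ⟨hy, h2⟩
  rw [abs_le]
  constructor <;> linarith

theorem continuous_exampleBound (v₁ v₂ : ℝ) : Continuous (exampleBound v₁ v₂) := by
  unfold exampleBound
  fun_prop

theorem permissibleTimes_examplePoly (v₁ v₂ : ℝ) {ħ : ℝ} (hħ : 0 < ħ) (f : ℝ) :
    permissibleTimes (examplePoly v₁ v₂) ħ f = {t | 0 ≤ t ∧ exampleBound v₁ v₂ t ≤ f} := by
  simp only [permissibleTimes, qslBound_examplePoly v₁ v₂ hħ]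

theorem qslBound_examplePoly_le {v₁ v₂ : ℝ} (h : NodeEnclosure v₁ v₂) (S : QuantumSystem.{u})
    {ħ : ℝ} (hS : ∀ k ∈ Finset.Icc 1 17, S.FiniteAbsMoment (2 * k)) (τ : ℝ) :
    qslBound (examplePoly v₁ v₂) ħ (fun k => S.absMoment (2 * k)) τ ≤ S.rootFidelity ħ τ :=
  S.qslBound_le_rootFidelity (eval_compNegSq_eq_sum _) (examplePoly_le_cos h) hS ħ τ

theorem exampleBound_le_rootFidelity {v₁ v₂ : ℝ} (h : NodeEnclosure v₁ v₂) {ħ : ℝ} (hħ : 0 < ħ)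
    {S : QuantumSystem.{u}} (hS : S.HasExampleMoments ħ) (τ : ℝ) :
    exampleBound v₁ v₂ τ ≤ S.rootFidelity ħ τ := by
  rw [← qslBound_examplePoly v₁ v₂ hħ, ← hS.qslBound_eq]
  exact qslBound_examplePoly_le h S (fun k hk => (hS k hk).1) τ

theorem exists_exampleBound_shape {v₁ v₂ : ℝ} (h : NodeEnclosure v₁ v₂) (e₁ : overlapFun v₁ = 0)
    (e₂ : overlapSlope v₂ = 0) :
    ∃ f₂ a b c : ℝ, (0.068201 < f₂ ∧ f₂ < 0.068202) ∧ |a - 10.139| ≤ 0.0005 ∧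
      |b - 10.247| ≤ 0.0005 ∧ |c - 9.519| ≤ 0.0005 ∧
      exampleBound v₁ v₂ √v₁ = exampleOverlap √v₁ ∧ exampleBound v₁ v₂ √v₂ = exampleOverlap √v₂ ∧
      SublevelShape (exampleBound v₁ v₂) √v₁ √v₂ f₂ a b c := by
  obtain ⟨b11, b12, b21, b22⟩ := h.nodeBounds
  have s₁ : √v₁ ^ 2 = v₁ := Real.sq_sqrt (by linarith)
  have s₂ : √v₂ ^ 2 = v₂ := Real.sq_sqrt (by linarith)
  obtain ⟨-, -, t₁, -, t₂, -, t₁', -, t₂', -⟩ := isExampleInterpolant_examplePoly h.nodeBounds s₁ s₂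
  have eq₁ := exampleBound_eq_exampleOverlap (t₁.eval_eq (by norm_num)) (t₁'.eval_eq (by norm_num))
  have eq₂ := exampleBound_eq_exampleOverlap (t₂.eval_eq (by norm_num)) (t₂'.eval_eq (by norm_num))
  have signs := boundSigns (fun k hk => (interpolant_coeff_mem h hk).1)
    fun k hk => (interpolant_coeff_mem h hk).2
  -- The bound meets the overlap at both nodes; this yields its exact zero at `v₁` and, below, its
  -- exact critical point at `v₂`.
  have z₁ : (boundPoly (coshSqrtInterpolant (exampleNodal v₁ v₂))).eval (1000 * v₁) = 0 := by
    have := eq₁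
    rwa [exampleBound, exampleOverlap_eq, s₁, e₁, zero_div] at this
  have z₂ := derivative_boundPoly_eq_zero h (Real.sqrt_pos.2 (by linarith : 0 < v₂)) eq₂
    (by rw [s₂, e₂])
  rw [s₂] at z₂
  obtain ⟨a, b, c, ha, hb, hc, hs⟩ := signs.exists_shape (w₁ := 1000 * v₁) (w₂ := 1000 * v₂)
    ⟨by linarith, by linarith⟩ ⟨by linarith, by linarith⟩ z₁ z₂
  have hs' := hs.comp_sq (by linarith) (by linarith) (by linarith) (by linarith) (by linarith)
  rw [mul_div_cancel_left₀ _ (by norm_num), mul_div_cancel_left₀ _ (by norm_num)] at hs'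
  refine ⟨_, _, _, _, ⟨signs.touch_lower (1000 * v₂) (by linarith) (by linarith),
    signs.touch_upper (1000 * v₂) (by linarith) (by linarith)⟩, ?_, ?_, ?_, eq₁, eq₂, hs'⟩
  · refine abs_sqrt_sub_le ?_ ?_ ?_ <;> norm_num <;> linarith
  · refine abs_sqrt_sub_le ?_ ?_ ?_ <;> norm_num <;> linarith
  · refine abs_sqrt_sub_le ?_ ?_ ?_ <;> norm_num <;> linarith

theorem mainTheorem2 :
    ∃ (τ₁ τ₂ f₂ a b c : ℝ) (p : Polynomial ℝ),
      -- numerical values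
      |τ₁ - 9.693| ≤ 0.0005 ∧ |τ₂ - 4.110| ≤ 0.0005 ∧ |f₂ - 0.0682| ≤ 0.00005 ∧
      |a - 10.139| ≤ 0.0005 ∧ |b - 10.247| ≤ 0.0005 ∧ |c - 9.519| ≤ 0.0005 ∧
      -- the interpolating polynomial
      (∀ q : Polynomial ℝ, IsExampleInterpolant τ₁ τ₂ q ↔ q = p) ∧
      p.natDegree = 34 ∧ (∀ k, p.coeff (2 * k + 1) = 0) ∧ HasExampleCoeffs p ∧
      (∀ x : ℝ, p.eval x ≤ Real.cos x) ∧
      ∀ ħ : ℝ, 0 < ħ →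
        -- the times and the root fidelity that the example state defines
        (exampleSystem ħ).HasExampleMoments ħ ∧
        IsLeast {τ | 0 ≤ τ ∧ (exampleSystem ħ).rootFidelity ħ τ = 0} τ₁ ∧
        IsLeast {τ | 0 ≤ τ ∧ (exampleSystem ħ).rootFidelity ħ τ = f₂} τ₂ ∧
        IsLocalMin ((exampleSystem ħ).rootFidelity ħ) τ₂ ∧
        -- the quantum speed limit, for all states whose moments up to order 34 are finite
        (∀ S : QuantumSystem.{u}, (∀ k ∈ Finset.Icc 1 17, S.FiniteAbsMoment (2 * k)) →
          ∀ τ : ℝ, 0 ≤ τ →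
            qslBound p ħ (fun k => S.absMoment (2 * k)) τ ≤ S.rootFidelity ħ τ) ∧
        -- the permissible times for the prescribed moments
        Monotone (permissibleTimes p ħ) ∧
        τ₁ < a ∧ a < b ∧ permissibleTimes p ħ 0 = Icc τ₁ a ∪ Ici b ∧
        τ₂ < c ∧ permissibleTimes p ħ f₂ = {τ₂} ∪ Ici c ∧
        (∀ S : QuantumSystem.{u}, S.HasExampleMoments ħ → ∀ τ : ℝ, 0 ≤ τ →
          τ ∈ permissibleTimes p ħ (S.rootFidelity ħ τ)) ∧
        -- tightness at both root fidelities
        qslBound p ħ (exampleMoment ħ) τ₁ = 0 ∧ qslBound p ħ (exampleMoment ħ) τ₂ = f₂ ∧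
        IsLeast (evolutionTimes ħ 0) τ₁ ∧ IsLeast (evolutionTimes ħ f₂) τ₂ ∧
        -- the forbidden interval `(τ₂, c)` is genuine: no state reaches root fidelity `f₂`, or a
        -- smaller one, before time `c` and away from `τ₂`, but the example state does at `τ₂` and
        -- again at or after `c`
        (∀ S : QuantumSystem.{u}, S.HasExampleMoments ħ → ∀ τ : ℝ, 0 ≤ τ → τ < c → τ ≠ τ₂ →
          f₂ < S.rootFidelity ħ τ) ∧
        (∃ τ : ℝ, c ≤ τ ∧ (exampleSystem ħ).rootFidelity ħ τ = f₂) ∧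
        -- the minimum evolution time jumps at root fidelity `f₂`
        (∀ f ∈ Icc (0 : ℝ) 1, (evolutionTimes ħ f).Nonempty ∧
          qslMinTime p ħ f ≤ minEvolutionTime ħ f ∧ minEvolutionTime ħ f ≤ τ₁) ∧
        qslMinTime p ħ 0 = τ₁ ∧ minEvolutionTime ħ 0 = τ₁ ∧
        (∀ f ∈ Ico 0 f₂, c < qslMinTime p ħ f) ∧
        (∀ f ∈ Icc f₂ 1, minEvolutionTime ħ f ≤ τ₂) ∧
        qslMinTime p ħ f₂ = τ₂ ∧ minEvolutionTime ħ f₂ = τ₂ ∧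
        Tendsto (qslMinTime p ħ) (𝓝[<] f₂) (𝓝 c) ∧
        Tendsto (qslMinTime p ħ) (𝓝[>] f₂) (𝓝 τ₂) ∧
        Tendsto (minEvolutionTime ħ) (𝓝[>] f₂) (𝓝 τ₂) ∧
        ¬ ContinuousAt (qslMinTime p ħ) f₂ ∧ ¬ ContinuousAt (minEvolutionTime ħ) f₂ := by
  obtain ⟨v₁, v₂, h, e₁, e₂⟩ := exists_nodes
  obtain ⟨f₂, a, b, c, ⟨f_lower, f_upper⟩, ha, hb, hc, eq₁, eq₂, hs⟩ :=
    exists_exampleBound_shape h e₁ e₂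
  obtain ⟨b11, b12, b21, b22⟩ := h.nodeBounds
  have s₁ : √v₁ ^ 2 = v₁ := Real.sq_sqrt (by linarith)
  have s₂ : √v₂ ^ 2 = v₂ := Real.sq_sqrt (by linarith)
  have d₁ : |√v₁ - 9.693| ≤ 0.0005 := by
    refine abs_sqrt_sub_le ?_ ?_ ?_ <;> norm_num <;> linarith
  have d₂ : |√v₂ - 4.110| ≤ 0.0005 := by
    refine abs_sqrt_sub_le ?_ ?_ ?_ <;> norm_num <;> linarith
  have d₁' := abs_le.1 d₁
  have d₂' := abs_le.1 d₂
  have ha' := abs_le.1 ha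
  have hb' := abs_le.1 hb
  have hc' := abs_le.1 hc
  have o₁ : exampleOverlap √v₁ = 0 := by rw [exampleOverlap_eq, s₁, e₁, zero_div]
  have o₂ : exampleOverlap √v₂ = f₂ := by rw [← eq₂, hs.eq_two]
  have tight : ∀ T : ℝ → Set ℝ, (∀ f, T f ⊆ {t | 0 ≤ t ∧ exampleBound v₁ v₂ t ≤ f}) →
      (∀ t, 0 ≤ t → t ∈ T |exampleOverlap t|) →
      TightBound (exampleBound v₁ v₂) exampleOverlap T √v₁ √v₂ f₂ a b c := fun T h1 h2 =>
    { hs with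
      continuous_bound := continuous_exampleBound v₁ v₂
      continuous_overlap := continuous_exampleOverlap
      bound_le := exampleBound_le_exampleOverlap h
      overlap_zero := by norm_num [exampleOverlap]
      overlap_one := o₁
      overlap_two := o₂
      subset := h1
      mem := h2
      pos_two := by linarith [d₂'.1]
      two_lt_c := by linarith [d₂'.2, hc'.1]
      c_lt_one := by linarith [d₁'.1, hc'.2]
      one_lt_a := by linarith [d₁'.2, ha'.1]
      f₂_pos := by linarith
      f₂_lt_one := by linarith }
  refine ⟨√v₁, √v₂, f₂, a, b, c, examplePoly v₁ v₂, d₁, d₂, ?_, ha, hb, hc, fun q => ⟨fun hq => ?_,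
    ?_⟩, natDegree_examplePoly h, compNegSq_coeff_odd _, hasExampleCoeffs_examplePoly h,
    examplePoly_le_cos h, fun ħ hħ => ?_⟩
  · rw [abs_le]
    constructor <;> linarith
  · exact IsExampleInterpolant.unique (by linarith) (by linarith)
      (isExampleInterpolant_examplePoly h.nodeBounds s₁ s₂) hq
  · rintro rfl
    exact isExampleInterpolant_examplePoly h.nodeBounds s₁ s₂
  have hperm := permissibleTimes_examplePoly v₁ v₂ hħ
  have hroot : (exampleSystem ħ).rootFidelity ħ = fun t => |exampleOverlap t| :=
    funext (rootFidelity_exampleSystem hħ)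
  -- First use of `TightBound`: the times at which the example state itself attains `f`. They give
  -- the least times of that state and its local minimum.
  have hE := tight (fun f => {t | 0 ≤ t ∧ |exampleOverlap t| = f})
    (fun f t ht => ⟨ht.1, ht.2 ▸ (exampleBound_le_exampleOverlap h t).trans (le_abs_self _)⟩)
    fun t ht => ⟨ht, rfl⟩
  -- Second use: the times of all states with the prescribed moments. They respect the bound by the
  -- speed limit and include those of the example state.
  have hT := tight (evolutionTimes ħ)
    (fun f t ⟨ht, S, hS, hf⟩ => ⟨ht, hf ▸ exampleBound_le_rootFidelity h hħ hS t⟩)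
    fun t ht => ⟨ht, _, hasExampleMoments_exampleSystem ħ, rootFidelity_exampleSystem hħ t⟩
  have hq : qslMinTime (examplePoly v₁ v₂) ħ =
      fun f => sInf {t | 0 ≤ t ∧ exampleBound v₁ v₂ t ≤ f} :=
    funext fun f => by rw [qslMinTime, hperm]
  have hb1 : √v₁ ≤ b := by linarith
  simp only [hq, hperm, hroot, qslBound_examplePoly v₁ v₂ hħ]
  refine ⟨hasExampleMoments_exampleSystem ħ, hE.isLeast_zero hb1, hE.isLeast_two, hE.isLocalMin,
    fun S hS τ _ => qslBound_examplePoly_le h S hS τ, ?_, hT.one_lt_a, by linarith,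
    hT.bound_nonpos_iff (by linarith), hT.two_lt_c, hT.bound_le_f₂_iff,
    fun S hS τ hτ => ⟨hτ, exampleBound_le_rootFidelity h hħ hS τ⟩, eq₁.trans o₁, hs.eq_two,
    hT.isLeast_zero hb1, hT.isLeast_two, fun S hS τ h0 h1 h2 =>
      (hs.above τ h0 h1 h2).trans_le (exampleBound_le_rootFidelity h hħ hS τ), hE.exists_ge_c,
    fun f hf => ⟨?_, hT.sInf_bound_le hf, hT.sInf_le_one hf⟩, (hT.isLeast_bound_zero hb1).csInf_eq,
    (hT.isLeast_zero hb1).csInf_eq, fun f hf => hT.c_lt_sInf_bound hf,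
    fun f hf => hT.sInf_le_two hf, hT.isLeast_bound_two.csInf_eq, hT.isLeast_two.csInf_eq,
    hT.tendsto_left, hT.tendsto_right_bound, hT.tendsto_right,
    hT.not_continuousAt_of_le (fun _ _ => le_rfl) hT.isLeast_bound_two.csInf_eq,
    hT.not_continuousAt_of_le
      (fun f hf => hT.sInf_bound_le ⟨hf.1, (hf.2.trans hT.f₂_lt_one).le⟩) hT.isLeast_two.csInf_eq⟩
  · intro f f' hff
    rw [hperm, hperm]
    exact fun t ht => ⟨ht.1, ht.2.trans hff⟩
  · obtain ⟨t, ht, -⟩ := hT.exists_mem_le_one hf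
    exact ⟨t, ht⟩
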